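/- Let $b,c>0$ and let $V\in L^1_{\mathrm{loc}}(\mathbb R)$ be real-valued with $\lim_{|x|\to\infty}\int_x^{x+1}|V(s)|\,ds=0$. Put $D=-\mathrm i\,\frac{d}{dx}$ with domain $H^1(\mathbb R)$ in $L^2(\mathbb R)$, and let $H_V$ be the maximal operator associated with $-c^2\frac{d^2}{dx^2}+b^2+V(x)$ in $L^2(\mathbb R)$: $\operatorname{dom}(H_V)$ consists of all $u\in L^2(\mathbb R)$ such that $u,u'$ are locally absolutely continuous and $-c^2u''+b^2u+Vu\in L^2(\mathbb R)$. Original problem. Consider the spectral problem $-c^2y''+b^2y+V(x)y=-\mathrm i z y'$, that is, $H_Vu=zDu$ in $L^2(\mathbb R)$. For $z\in\mathbb C$ let $K_0(z)=\{0\}$, $K_{n+1}(z)=\{u\in \operatorname{dom}(H_V)\cap H^1(\mathbb R): H_Vu-zDu\in D(K_n(z)\cap H^1(\mathbb R))\}$ and $\mathrm E_z(A)=\bigcup_n K_n(z)$. Problem in $\dot H^{1/2}(\mathbb R)$. Let $\hat u$ be the unitary Fourier transform of $u$ and let $\dot H^{1/2}(\mathbb R)$ be the completion of $H^{1/2}(\mathbb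 R)$ in the norm $\|u\|_{\dot H^{1/2}}=\||\lambda|^{1/2}\hat u\|_{L^2}$. Let $\mathcal L$ be the operator in $\dot H^{1/2}(\mathbb R)$ associated with the form $$\mathfrak t_V[u,v]=c^2\int u'\overline{v'}\,dx+b^2\int u\bar v\,dx+\int Vu\bar v\,dx,\qquad u,v\in H^1(\mathbb R),$$ that is, $u\in\operatorname{dom}(\mathcal L)$ and $\mathcal Lu=w$ iff $u\in H^1(\mathbb R)$, $w\in\dot H^{1/2}(\mathbb R)$ and $\mathfrak t_V[u,v]=(w,v)_{\dot H^{1/2}}$ for all $v\in H^1(\mathbb R)$. Let $\mathcal J$ be the bounded operator in $\dot H^{1/2}(\mathbb R)$ that multiplies the Fourier transform by $\operatorname{sgn}(\lambda)$, let $\mathcal A=\mathcal J\mathcal L$ and $\mathrm E_z(\mathcal A)=\bigcup_n\ker((\mathcal A-z)^n)$. Indices. Let $\kappa_{\mathbb C_+}(A)=\sum_{\operatorname{Im}z>0}\dim\mathrm E_z(A)$ and $\kappa_{\mathbb C_+}(\mathcal A)=\sum_{\operatorname{Im}z>0}\dim\mathrm E_z(\mathcal A)$. For $\lambda\in\mathbb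 R\setminus\{0\}$ let $\kappa^-_\lambda(A)$ be the number of non-positive eigenvalues, counted with multiplicities, of the compression $P_\lambda H_V|_{\mathrm E_\lambda(A)}$, where $P_\lambda$ is the orthogonal projection in $L^2(\mathbb R)$ onto $\mathrm E_\lambda(A)$, and let $\kappa^-_\lambda(\mathcal A)$ be the number of non-positive eigenvalues, counted with multiplicities, of the compression of $\mathcal L$ to $\mathrm E_\lambda(\mathcal A)$ formed with the orthogonal projection in $\dot H^{1/2}(\mathbb R)$ onto $\mathrm E_\lambda(\mathcal A)$. (If the subspace is not closed, the projection is the one onto its closure.) Put $\kappa^-_{\mathbb R}(A)=\sum_{\lambda\in\mathbb R\setminus\{0\}}\kappa^-_\lambda(A)$ and $\kappa^-_{\mathbb R}(\mathcal A)=\sum_{\lambda\in\mathbb R\setminus\{0\}}\kappa^-_\lambda(\mathcal A)$. All these numbers are taken in $\{0,1,2,\dots\}\cup\{\infty\}$. Finally put $$\kappa_{\mathrm{Ham}}(A)=\sum_{\operatorname{Re}z=0,\ \operatorname{Im}z>0}\dim\mathrm E_z(A)+2\sum_{\operatorname{Re}z>0,\ \operatorname{Im}z>0}\dim\mathrm E_z(A)+2\sum_{\lambda>0}\kappa^-_\lambda(A),\qquad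 \kappa_{\mathrm{Ham}}(\mathcal A)=\kappa_{\mathbb C_+}(\mathcal A)+\kappa^-_{\mathbb R}(\mathcal A).$$ Then $$\kappa_{\mathbb C_+}(A)=\kappa_{\mathbb C_+}(\mathcal A),\qquad \kappa^-_{\mathbb R}(A)=\kappa^-_{\mathbb R}(\mathcal A),\qquad \kappa_{\mathrm{Ham}}(A)=\kappa_{\mathrm{Ham}}(\mathcal A).$$ -/

import Mathlib

open MeasureTheory Filter Topology
open scoped ENNReal InnerProductSpace ComplexConjugate FourierTransform

noncomputable section

namespace KreinIndex

/-! ## Sums of multiplicities, generalized eigenspaces, negative index -/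

section Abstract

variable {H : Type*} [NormedAddCommGroup H] [InnerProductSpace ℂ H]

/-- The sum, in `[0, ∞]`, of an arbitrary family of extended natural numbers. -/
def totalSum {ι : Type*} (f : ι → ℕ∞) : ℕ∞ := ⨆ s : Finset ι, ∑ i ∈ s, f i

/-- The dimension of a complex subspace as an extended natural number. -/
def edim (E : Submodule ℂ H) : ℕ∞ := Cardinal.toENat (Module.rank ℂ E)

/-- `ker ((T - z) ^ n)` for an unbounded operator `T`, with the natural domain of the power:
`x ∈ ker ((T - z) ^ (n + 1))` iff `x ∈ dom T` and `T x - z x ∈ ker ((T - z) ^ n)`. -/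
def powKer (T : H →ₗ.[ℂ] H) (z : ℂ) : ℕ → Submodule ℂ H
  | 0 => ⊥
  | n + 1 => ((powKer T z n).comap (T.toFun - z • T.domain.subtype)).map T.domain.subtype

/-- The generalized eigenspace `⋃ n, ker ((T - z) ^ n)`; the subspaces `powKer T z n` increase with
`n`, so their supremum is their union. -/
def genEigenspace (T : H →ₗ.[ℂ] H) (z : ℂ) : Submodule ℂ H := ⨆ n, powKer T z n

/-- The subspaces `ker ((D⁻¹ T - z) ^ n)` of the pencil `T - z D`, defined without inverting `D`:
`u ∈ ker ((D⁻¹ T - z) ^ (n + 1))` iff `T u - z D u ∈ D (ker ((D⁻¹ T - z) ^ n))`. -/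
def pencilPowKer (T D : H →ₗ.[ℂ] H) (z : ℂ) : ℕ → Submodule ℂ H
  | 0 => ⊥
  | n + 1 => ((((pencilPowKer T D z n).comap D.domain.subtype).map D.toFun).comap
      (T - z • D).toFun).map (T - z • D).domain.subtype

/-- The generalized eigenspace of the pencil `T - z D`. -/
def pencilGenEigenspace (T D : H →ₗ.[ℂ] H) (z : ℂ) : Submodule ℂ H := ⨆ n, pencilPowKer T D z n

/-- The eigenspace for the eigenvalue `μ` of the compression of `T` to the subspace `E`:
all `u ∈ E ∩ dom T` with `P T u = μ u`, where `P` is the orthogonal projection onto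
(the closure of) `E`. -/
def compressionEigenspace [CompleteSpace H] (T : H →ₗ.[ℂ] H) (E : Submodule ℂ H) (μ : ℝ) :
    Submodule ℂ H :=
  E ⊓ (LinearMap.ker ((E.topologicalClosure.starProjection : H →ₗ[ℂ] H) ∘ₗ T.toFun
    - (μ : ℂ) • T.domain.subtype)).map T.domain.subtype

/-- The number of non-positive eigenvalues, with multiplicities, of the compression of `T`
to `E`. -/
def negIndexOn [CompleteSpace H] (T : H →ₗ.[ℂ] H) (E : Submodule ℂ H) : ℕ∞ :=
  totalSum fun μ : Set.Iic (0 : ℝ) => edim (compressionEigenspace T E μ)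

/-- For a family `E z` of generalized eigenspaces, the total algebraic multiplicity of the
eigenvalues in `S` (points which are not eigenvalues contribute `0`). -/
def totalMultiplicity (E : ℂ → Submodule ℂ H) (S : Set ℂ) : ℕ∞ :=
  totalSum fun z : S => edim (E z)

/-- For a family `E z` of generalized eigenspaces, the sum over the real points `lam ∈ S` of the
negative indices of `T` on `E lam`. -/
def totalNegIndex [CompleteSpace H] (T : H →ₗ.[ℂ] H) (E : ℂ → Submodule ℂ H) (S : Set ℝ) : ℕ∞ :=
  totalSum fun lam : S => negIndexOn T (E ((lam : ℝ) : ℂ))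

end Abstract

/-! ## Fourier multipliers on `L²(ℝ)` -/

/-- The space `L²(ℝ)` of complex-valued functions. -/
abbrev L2 : Type := Lp ℂ 2 (volume : Measure ℝ)

/-- The Fourier transform `û(ξ) = ∫ exp(-2πiξx) u(x) dx` as a unitary operator on `L²(ℝ)`. -/
abbrev fourierL2 : L2 ≃ₗᵢ[ℂ] L2 := Lp.fourierTransformₗᵢ ℝ ℂ

/-- The maximal domain `{u ∈ L²(ℝ) : m(2πξ) û(ξ) ∈ L²(ℝ)}` of the Fourier multiplier with
symbol `m`. -/
def fourierMultiplierDomain (m : ℝ → ℂ) : Submodule ℂ L2 where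
  carrier := {u | MemLp (fun ξ : ℝ => m (2 * Real.pi * ξ) * fourierL2 u ξ) 2 volume}
  add_mem' := by
    intro u v hu hv
    refine (memLp_congr_ae ?_).1 (MemLp.add hu hv)
    rw [map_add]
    filter_upwards [Lp.coeFn_add (fourierL2 u) (fourierL2 v)] with ξ hξ
    simp only [Pi.add_apply] at hξ ⊢
    rw [hξ, mul_add]
  zero_mem' := by
    refine (memLp_congr_ae ?_).1 (MemLp.zero (ε := ℂ) (p := 2) (μ := (volume : Measure ℝ)))
    rw [map_zero]
    filter_upwards [Lp.coeFn_zero ℂ 2 (volume : Measure ℝ)] with ξ hξ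
    rw [hξ]; simp
  smul_mem' := by
    intro a u hu
    refine (memLp_congr_ae ?_).1 (MemLp.const_mul hu a)
    rw [map_smul]
    filter_upwards [Lp.coeFn_smul a (fourierL2 u)] with ξ hξ
    rw [hξ, Pi.smul_apply, smul_eq_mul]; ring

theorem mem_fourierMultiplierDomain {m : ℝ → ℂ} {u : L2} :
    u ∈ fourierMultiplierDomain m ↔
      MemLp (fun ξ : ℝ => m (2 * Real.pi * ξ) * fourierL2 u ξ) 2 volume := Iff.rfl

/-- Multiplication of `û` by the symbol. -/
def symbolMul (m : ℝ → ℂ) : fourierMultiplierDomain m →ₗ[ℂ] L2 where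
  toFun u := MemLp.toLp (fun ξ : ℝ => m (2 * Real.pi * ξ) * fourierL2 (u : L2) ξ)
    (mem_fourierMultiplierDomain.1 u.2)
  map_add' := by
    intro u v
    rw [← MemLp.toLp_add]
    refine MemLp.toLp_congr _ _ ?_
    rw [Submodule.coe_add, map_add]
    filter_upwards [Lp.coeFn_add (fourierL2 (u : L2)) (fourierL2 (v : L2))] with ξ hξ
    simp only [Pi.add_apply] at hξ ⊢
    rw [hξ, mul_add]
  map_smul' := by
    intro a u
    rw [RingHom.id_apply, ← MemLp.toLp_const_smul]
    refine MemLp.toLp_congr _ _ ?_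
    rw [Submodule.coe_smul, map_smul]
    filter_upwards [Lp.coeFn_smul a (fourierL2 (u : L2))] with ξ hξ
    rw [hξ, Pi.smul_apply, Pi.smul_apply, smul_eq_mul, smul_eq_mul]; ring

/-- The Fourier multiplier `u ↦ ℱ⁻¹ (m(λ) ℱu)` on its maximal domain in `L²(ℝ)`, where
`(ℱu)(λ) = (2π)^(-1/2) ∫ exp(-iλx) u(x) dx`. The transform `û` is the unitary rescaling of `ℱu`
by `λ = 2πξ`, so that multiplying `ℱu` by `m(λ)` is multiplying `û` by `m(2πξ)`. -/
def fourierMultiplier (m : ℝ → ℂ) : L2 →ₗ.[ℂ] L2 where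
  domain := fourierMultiplierDomain m
  toFun := (fourierL2.symm.toLinearEquiv : L2 →ₗ[ℂ] L2) ∘ₗ symbolMul m

/-- `D = -i d/dx` as a self-adjoint operator in `L²(ℝ)`; its domain is the Sobolev space `H¹(ℝ)`. -/
def opD : L2 →ₗ.[ℂ] L2 := fourierMultiplier fun t => (t : ℂ)

/-- The Sobolev space `H¹(ℝ)`. -/
abbrev H1 : Submodule ℂ L2 := opD.domain

/-- `|D|^(1/2)` in `L²(ℝ)`. -/
def opSqrtAbsD : L2 →ₗ.[ℂ] L2 := fourierMultiplier fun t => ((|t| ^ (1 / 2 : ℝ) : ℝ) : ℂ)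

/-- The multiplier with symbol `sgn λ`. -/
def opSgnD : L2 →ₗ.[ℂ] L2 := fourierMultiplier fun t => ((Real.sign t : ℝ) : ℂ)


theorem fourierL2_fourierMultiplier (m : ℝ → ℂ) (u : (fourierMultiplier m).domain) :
    fourierL2 (fourierMultiplier m u) =ᵐ[volume]
      fun ξ : ℝ => m (2 * Real.pi * ξ) * fourierL2 (u : L2) ξ := by
  have h : fourierL2 (fourierMultiplier m u) = symbolMul m u :=
    fourierL2.apply_symm_apply _
  rw [h]
  exact MemLp.coeFn_toLp (mem_fourierMultiplierDomain.1 u.2)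

theorem ae_two_pi_mul_ne_zero : ∀ᵐ ξ : ℝ, 2 * Real.pi * ξ ≠ 0 := by
  have h : ∀ᵐ ξ : ℝ, ξ ≠ 0 := by simp [ae_iff]
  filter_upwards [h] with ξ hξ
  have := Real.pi_pos
  positivity

theorem H1_le : H1 ≤ opSqrtAbsD.domain := by
  intro u hu
  have hu' : MemLp (fun ξ : ℝ => ((2 * Real.pi * ξ : ℝ) : ℂ) * fourierL2 u ξ) 2 volume := hu
  have h0 : MemLp (fun ξ : ℝ => fourierL2 u ξ) 2 volume := Lp.memLp _
  refine MemLp.mono (hu'.norm.add h0.norm) ?_ ?_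
  · refine AEStronglyMeasurable.mul (Measurable.aestronglyMeasurable ?_) h0.1
    fun_prop
  · refine Eventually.of_forall fun ξ => ?_
    have h1 : |2 * Real.pi * ξ| ^ (1 / 2 : ℝ) ≤ |2 * Real.pi * ξ| + 1 := by
      rcases le_total 1 (|2 * Real.pi * ξ|) with h | h
      · have := Real.rpow_le_rpow_of_exponent_le h (show (1 / 2 : ℝ) ≤ 1 by norm_num)
        rw [Real.rpow_one] at this
        linarith
      · have := Real.rpow_le_one (abs_nonneg _) h (show (0 : ℝ) ≤ 1 / 2 by norm_num)
        have := abs_nonneg (2 * Real.pi * ξ)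
        linarith
    have h2 : 0 ≤ |2 * Real.pi * ξ| ^ (1 / 2 : ℝ) := Real.rpow_nonneg (abs_nonneg _) _
    have h3 := mul_le_mul_of_nonneg_right h1 (norm_nonneg (fourierL2 u ξ))
    calc ‖((|2 * Real.pi * ξ| ^ (1 / 2 : ℝ) : ℝ) : ℂ) * fourierL2 u ξ‖
        = |2 * Real.pi * ξ| ^ (1 / 2 : ℝ) * ‖fourierL2 u ξ‖ := by
          rw [norm_mul, Complex.norm_real, Real.norm_eq_abs, abs_of_nonneg h2]
      _ ≤ ‖((2 * Real.pi * ξ : ℝ) : ℂ) * fourierL2 u ξ‖ + ‖fourierL2 u ξ‖ := by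
          rw [norm_mul, Complex.norm_real, Real.norm_eq_abs]; linarith
      _ ≤ _ := le_abs_self _

theorem eq_zero_of_opSqrtAbsD_eq_zero (u : opSqrtAbsD.domain) (hu : opSqrtAbsD u = 0) : u = 0 := by
  have h := fourierL2_fourierMultiplier _ u
  have h' : fourierL2 (opSqrtAbsD u) = 0 := by
    rw [hu]; exact fourierL2.map_zero
  have h2 : fourierL2 (u : L2) = 0 := by
    rw [Lp.eq_zero_iff_ae_eq_zero]
    have h3 := (Lp.eq_zero_iff_ae_eq_zero).1 h'
    filter_upwards [h, h3, ae_two_pi_mul_ne_zero] with ξ a1 a2 a3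
    rw [show (fourierMultiplier _) u = opSqrtAbsD u from rfl, a2] at a1
    rcases mul_eq_zero.1 a1.symm with h | h
    · exfalso
      have : 0 < |2 * Real.pi * ξ| ^ (1 / 2 : ℝ) := Real.rpow_pos_of_pos (abs_pos.2 a3) _
      rw [Complex.ofReal_eq_zero] at h
      linarith
    · simpa using h
  exact Subtype.ext (fourierL2.map_eq_zero_iff.1 h2)

/-! ## The space `Ḣ^(1/2)(ℝ)` -/

/-- The Sobolev space `H^(1/2)(ℝ)`, as a type that carries the homogeneous norm
`‖|D|^(1/2) u‖` of `L²(ℝ)`. -/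
def HHalf : Type := opSqrtAbsD.domain

instance : AddCommGroup HHalf := inferInstanceAs (AddCommGroup opSqrtAbsD.domain)
instance : Module ℂ HHalf := inferInstanceAs (Module ℂ opSqrtAbsD.domain)

/-- `|D|^(1/2)` as a linear map from `H^(1/2)(ℝ)` to `L²(ℝ)`. -/
def HHalf.sqrtAbsD : HHalf →ₗ[ℂ] L2 := opSqrtAbsD.toFun

/-- The inner product `(|D|^(1/2) u, |D|^(1/2) v)` on `H^(1/2)(ℝ)`. -/
@[reducible] def HHalf.core : InnerProductSpace.Core ℂ HHalf where
  inner u v := ⟪HHalf.sqrtAbsD u, HHalf.sqrtAbsD v⟫_ℂ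
  conj_inner_symm u v := inner_conj_symm _ _
  re_inner_nonneg u := inner_self_nonneg
  add_left u v w := by rw [map_add, inner_add_left]
  smul_left u v r := by rw [map_smul, inner_smul_left]
  definite u hu := eq_zero_of_opSqrtAbsD_eq_zero u (inner_self_eq_zero.1 hu)

instance : NormedAddCommGroup HHalf := HHalf.core.toNormedAddCommGroup
instance : InnerProductSpace ℂ HHalf := InnerProductSpace.ofCore HHalf.core.toCore

theorem HHalf.inner_def (u v : HHalf) :
    ⟪u, v⟫_ℂ = ⟪HHalf.sqrtAbsD u, HHalf.sqrtAbsD v⟫_ℂ := rfl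

/-- The homogeneous space `Ḣ^(1/2)(ℝ)`: the completion of `H^(1/2)(ℝ)` in the homogeneous norm. -/
abbrev HDot : Type := UniformSpace.Completion HHalf

/-- The embedding of `H¹(ℝ)` into `Ḣ^(1/2)(ℝ)`. -/
def toHDot : H1 →ₗ[ℂ] HDot :=
  (UniformSpace.Completion.toComplL (𝕜 := ℂ) (E := HHalf) : HHalf →ₗ[ℂ] HDot) ∘ₗ
    (show H1 →ₗ[ℂ] HHalf from Submodule.inclusion H1_le)

/-! ## The operator `𝒥` -/

theorem mem_opSgnD (u : L2) : u ∈ opSgnD.domain := by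
  have h0 : MemLp (fun ξ : ℝ => fourierL2 u ξ) 2 volume := Lp.memLp _
  refine MemLp.mono h0 ?_ ?_
  · refine AEStronglyMeasurable.mul (Measurable.aestronglyMeasurable ?_) h0.1
    have : Measurable Real.sign := by
      unfold Real.sign
      exact Measurable.ite measurableSet_Iio measurable_const
        (Measurable.ite measurableSet_Ioi measurable_const measurable_const)
    fun_prop
  · refine Eventually.of_forall fun ξ => ?_
    rw [norm_mul]
    refine mul_le_of_le_one_left (norm_nonneg _) ?_
    simp only []
    rcases Real.sign_apply_eq (2 * Real.pi * ξ) with h | h | h <;> rw [h] <;> simp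

theorem fourierL2_opSgnD (u : L2) :
    fourierL2 (opSgnD ⟨u, mem_opSgnD u⟩) =ᵐ[volume]
      fun ξ : ℝ => ((Real.sign (2 * Real.pi * ξ) : ℝ) : ℂ) * fourierL2 u ξ :=
  fourierL2_fourierMultiplier _ ⟨u, mem_opSgnD u⟩

theorem abs_sign_ae : ∀ᵐ ξ : ℝ, |Real.sign (2 * Real.pi * ξ)| = 1 := by
  filter_upwards [ae_two_pi_mul_ne_zero] with ξ hξ
  rcases lt_or_gt_of_ne hξ with h | h
  · rw [Real.sign_of_neg h]; simp
  · rw [Real.sign_of_pos h]; simp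

theorem opSgnD_mem_sqrt (u : opSqrtAbsD.domain) :
    opSgnD ⟨u, mem_opSgnD u⟩ ∈ opSqrtAbsD.domain := by
  have h := mem_fourierMultiplierDomain.1 u.2
  refine (memLp_congr_norm (AEStronglyMeasurable.mul (Measurable.aestronglyMeasurable ?_)
    (Lp.memLp _).1) h.1 ?_).2 h
  · fun_prop
  · filter_upwards [fourierL2_opSgnD (u : L2), abs_sign_ae] with ξ h1 h2
    rw [Pi.mul_apply, h1]
    simp only [norm_mul, Complex.norm_real, Real.norm_eq_abs, h2, one_mul]

/-- The operator `u ↦ ℱ⁻¹ (sgn(λ) ℱu)` in `H^(1/2)(ℝ)`. -/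
def sgnHHalf : HHalf →ₗ[ℂ] HHalf :=
  show opSqrtAbsD.domain →ₗ[ℂ] opSqrtAbsD.domain from
    { toFun := fun u => ⟨opSgnD ⟨u, mem_opSgnD u⟩, opSgnD_mem_sqrt u⟩
      map_add' := fun u v => Subtype.ext (opSgnD.map_add ⟨u, mem_opSgnD u⟩ ⟨v, mem_opSgnD v⟩)
      map_smul' := fun a u => Subtype.ext (opSgnD.map_smul a ⟨u, mem_opSgnD u⟩) }

theorem norm_sgnHHalf (u : HHalf) : ‖sgnHHalf u‖ = ‖u‖ := by
  have key : ∀ w : HHalf, ‖w‖ = ‖fourierL2 (HHalf.sqrtAbsD w)‖ := fun w => by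
    rw [LinearIsometryEquiv.norm_map, @norm_eq_sqrt_re_inner ℂ, HHalf.inner_def,
      ← @norm_eq_sqrt_re_inner ℂ]
  rw [key, key]
  refine le_antisymm (Lp.norm_le_norm_of_ae_le ?_) (Lp.norm_le_norm_of_ae_le ?_)
  all_goals
    filter_upwards [fourierL2_fourierMultiplier _ (show opSqrtAbsD.domain from u),
      fourierL2_fourierMultiplier _ (show opSqrtAbsD.domain from sgnHHalf u),
      fourierL2_opSgnD (show opSqrtAbsD.domain from u), abs_sign_ae] with ξ h1 h2 h3 h4
    change fourierL2 (HHalf.sqrtAbsD u) ξ = _ at h1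
    change fourierL2 (HHalf.sqrtAbsD (sgnHHalf u)) ξ = _ at h2
    refine le_of_eq ?_
    rw [h1, h2]
    change _ = ((Real.sign (2 * Real.pi * ξ) : ℝ) : ℂ) * _ at h3
    change fourierL2 (show opSqrtAbsD.domain from sgnHHalf u).1 ξ = _ at h3
    rw [norm_mul, norm_mul, h3, norm_mul, Complex.norm_real (Real.sign _), Real.norm_eq_abs, h4,
      one_mul]

/-- The operator `𝒥` in `Ḣ^(1/2)(ℝ)`: the extension by continuity of `u ↦ ℱ⁻¹ (sgn(λ) ℱu)`. -/
def opJ : HDot →L[ℂ] HDot :=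
  (⟨sgnHHalf, norm_sgnHHalf⟩ : HHalf →ₗᵢ[ℂ] HHalf).toContinuousLinearMap.completion


/-! ## The form `𝔱_V` and the operators `ℒ` and `𝒜 = 𝒥ℒ` in `Ḣ^(1/2)(ℝ)` -/

/-- The sesquilinear form
`𝔱_V[u, v] = c² ∫ u' v'^* + b² ∫ u v^* + ∫ V u v^*` on `H¹(ℝ)`, linear in `u`
(Mathlib's inner product is conjugate-linear in its first argument, and `|u'| = |D u|`). -/
def formV (c b : ℝ) (V : ℝ → ℝ) (u v : H1) : ℂ :=
  (c : ℂ) ^ 2 * ⟪opD v, opD u⟫_ℂ + (b : ℂ) ^ 2 * ⟪(v : L2), (u : L2)⟫_ℂ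
    + ∫ x, (V x : ℂ) * (u : L2) x * conj ((v : L2) x)

/-- The graph of the operator associated with `𝔱_V` in `Ḣ^(1/2)(ℝ)`: the pairs `(u, w)` with
`u ∈ H¹(ℝ)` and `𝔱_V[u, v] = (w, v)` for all `v ∈ H¹(ℝ)`; the integral in `𝔱_V[u, v]` is required
to converge. -/
def graphL (c b : ℝ) (V : ℝ → ℝ) : Submodule ℂ (HDot × HDot) where
  carrier := {p | ∃ u : H1, toHDot u = p.1 ∧ ∀ v : H1,
    Integrable (fun x => (V x : ℂ) * (u : L2) x * conj ((v : L2) x)) ∧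
      formV c b V u v = ⟪toHDot v, p.2⟫_ℂ}
  add_mem' := by
    rintro ⟨p1, p2⟩ ⟨q1, q2⟩ ⟨u, rfl, hu⟩ ⟨w, rfl, hw⟩
    refine ⟨u + w, map_add _ _ _, fun v => ?_⟩
    have hae : (fun x => (V x : ℂ) * (u : L2) x * conj ((v : L2) x)
        + (V x : ℂ) * (w : L2) x * conj ((v : L2) x)) =ᵐ[volume]
        fun x => (V x : ℂ) * ((u + w : H1) : L2) x * conj ((v : L2) x) := by
      rw [Submodule.coe_add]
      filter_upwards [Lp.coeFn_add (u : L2) (w : L2)] with x hx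
      rw [hx, Pi.add_apply]; ring
    refine ⟨((hu v).1.add (hw v).1).congr hae, ?_⟩
    have h1 := (hu v).2
    have h2 := (hw v).2
    simp only [formV, Prod.snd_add, inner_add_right] at h1 h2 ⊢
    rw [← h1, ← h2, ← integral_congr_ae hae, integral_add (hu v).1 (hw v).1, Submodule.coe_add,
      LinearPMap.map_add, inner_add_right, inner_add_right]
    ring
  zero_mem' := by
    refine ⟨0, map_zero _, fun v => ?_⟩
    have hae : (fun _ => (0 : ℂ)) =ᵐ[volume]
        fun x => (V x : ℂ) * ((0 : H1) : L2) x * conj ((v : L2) x) := by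
      rw [Submodule.coe_zero]
      filter_upwards [Lp.coeFn_zero ℂ 2 (volume : Measure ℝ)] with x hx
      rw [hx, Pi.zero_apply]; ring
    refine ⟨(integrable_zero _ _ _).congr hae, ?_⟩
    simp only [formV]
    rw [← integral_congr_ae hae, LinearPMap.map_zero, Submodule.coe_zero]
    simp
  smul_mem' := by
    rintro a ⟨p1, p2⟩ ⟨u, rfl, hu⟩
    refine ⟨a • u, map_smul _ _ _, fun v => ?_⟩
    have hae : (fun x => a * ((V x : ℂ) * (u : L2) x * conj ((v : L2) x))) =ᵐ[volume]
        fun x => (V x : ℂ) * ((a • u : H1) : L2) x * conj ((v : L2) x) := by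
      rw [Submodule.coe_smul]
      filter_upwards [Lp.coeFn_smul a (u : L2)] with x hx
      rw [hx, Pi.smul_apply, smul_eq_mul]; ring
    refine ⟨((hu v).1.const_mul a).congr hae, ?_⟩
    have h1 := (hu v).2
    simp only [formV, Prod.smul_snd, inner_smul_right] at h1 ⊢
    rw [← h1, ← integral_congr_ae hae, integral_const_mul, Submodule.coe_smul,
      LinearPMap.map_smul, inner_smul_right, inner_smul_right]
    ring

/-- `H¹(ℝ)` is dense in `H^(1/2)(ℝ)` in the homogeneous norm. -/
theorem exists_lowPass (u : opSqrtAbsD.domain) {ε : ℝ} (hε : 0 < ε) :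
    ∃ v : H1, ‖opSqrtAbsD (u - Submodule.inclusion H1_le v)‖ ≤ ε := by
  have hg := mem_fourierMultiplierDomain.1 u.2
  set g : ℝ → ℂ := fun ξ =>
    ((|2 * Real.pi * ξ| ^ (1 / 2 : ℝ) : ℝ) : ℂ) * fourierL2 (u : L2) ξ with hgdef
  obtain ⟨f, hf1, hf2, -, -⟩ := hg.exists_hasCompactSupport_eLpNorm_sub_le
    ENNReal.ofNat_ne_top (ε := ENNReal.ofReal ε) (by simpa using hε)
  obtain ⟨R, hR⟩ := hf1.isCompact.isBounded.subset_closedBall (0 : ℝ)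
  have hS : MeasurableSet (Metric.closedBall (0 : ℝ) R) := measurableSet_closedBall
  have hu0 : MemLp (fun ξ : ℝ => fourierL2 (u : L2) ξ) 2 volume := Lp.memLp _
  have hv0 := hu0.indicator hS
  obtain ⟨w, hw⟩ : ∃ w : L2, fourierL2 w = MemLp.toLp _ hv0 :=
    ⟨fourierL2.symm (MemLp.toLp _ hv0), fourierL2.apply_symm_apply _⟩
  have hwae : fourierL2 w =ᵐ[volume]
      (Metric.closedBall (0 : ℝ) R).indicator fun ξ => fourierL2 (u : L2) ξ := by
    rw [hw]; exact MemLp.coeFn_toLp hv0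
  have hw1 : w ∈ H1 := by
    refine mem_fourierMultiplierDomain.2 (MemLp.of_le_mul (c := 2 * Real.pi * |R|) hv0
      (AEStronglyMeasurable.mul (Measurable.aestronglyMeasurable (by fun_prop))
        (Lp.memLp _).1) ?_)
    filter_upwards [hwae] with ξ hξ
    rw [hξ, norm_mul]
    by_cases h : ξ ∈ Metric.closedBall (0 : ℝ) R
    · refine mul_le_mul_of_nonneg_right ?_ (norm_nonneg _)
      rw [mem_closedBall_zero_iff, Real.norm_eq_abs] at h
      rw [Complex.norm_real, Real.norm_eq_abs, abs_mul,
        abs_of_pos (show (0 : ℝ) < 2 * Real.pi by positivity)]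
      exact mul_le_mul_of_nonneg_left (h.trans (le_abs_self R)) (by positivity)
    · rw [Set.indicator_of_notMem h]; simp
  refine ⟨⟨w, hw1⟩, ?_⟩
  rw [← fourierL2.norm_map, Lp.norm_def]
  refine ENNReal.toReal_le_of_le_ofReal hε.le (le_trans ?_ hf2)
  refine eLpNorm_mono_ae ?_
  have h1 := fourierL2_fourierMultiplier _ (u - Submodule.inclusion H1_le ⟨w, hw1⟩)
  have h2 : fourierL2 ((u - Submodule.inclusion H1_le ⟨w, hw1⟩ : opSqrtAbsD.domain) : L2)
      = fourierL2 (u : L2) - fourierL2 w := map_sub _ _ _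
  rw [h2] at h1
  filter_upwards [h1, hwae, Lp.coeFn_sub (fourierL2 (u : L2)) (fourierL2 w)] with ξ a1 a2 a3
  change fourierL2 (opSqrtAbsD _) ξ = _ at a1
  rw [a1, a3, Pi.sub_apply, a2]
  by_cases h : ξ ∈ Metric.closedBall (0 : ℝ) R
  · rw [Set.indicator_of_mem h]; simp
  · rw [Set.indicator_of_notMem h, sub_zero, Pi.sub_apply,
      image_eq_zero_of_notMem_tsupport fun h' => h (hR h'), sub_zero]

theorem denseRange_toHDot : DenseRange toHDot := by
  have h : DenseRange (fun v : H1 => (show HHalf from Submodule.inclusion H1_le v)) := by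
    refine Metric.denseRange_iff.2 fun u r hr => ?_
    obtain ⟨v, hv⟩ := exists_lowPass u (half_pos hr)
    refine ⟨v, ?_⟩
    rw [dist_eq_norm, @norm_eq_sqrt_re_inner ℂ, HHalf.inner_def, ← @norm_eq_sqrt_re_inner ℂ]
    exact lt_of_le_of_lt hv (half_lt_self hr)
  exact UniformSpace.Completion.denseRange_coe.comp h (UniformSpace.Completion.continuous_coe _)

theorem toHDot_injective : Function.Injective toHDot := by
  intro u v h
  exact Submodule.inclusion_injective H1_le (UniformSpace.Completion.coe_injective HHalf h)

/-- `graphL` is the graph of a single-valued operator. -/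
theorem graphL_functional (c b : ℝ) (V : ℝ → ℝ) :
    ∀ p ∈ graphL c b V, p.1 = 0 → p.2 = 0 := by
  rintro ⟨p1, p2⟩ ⟨u, rfl, hu⟩ h0
  obtain rfl : u = 0 := toHDot_injective (by rw [map_zero]; exact h0)
  refine DenseRange.eq_zero_of_inner_right ℂ denseRange_toHDot fun v => ?_
  rw [← (hu v).2]
  have hae : (fun _ => (0 : ℂ)) =ᵐ[volume]
      fun x => (V x : ℂ) * ((0 : H1) : L2) x * conj ((v : L2) x) := by
    rw [Submodule.coe_zero]
    filter_upwards [Lp.coeFn_zero ℂ 2 (volume : Measure ℝ)] with x hx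
    rw [hx, Pi.zero_apply]; ring
  simp only [formV]
  rw [← integral_congr_ae hae, LinearPMap.map_zero, Submodule.coe_zero]
  simp

/-- The operator `ℒ` associated with the form `𝔱_V` in `Ḣ^(1/2)(ℝ)`. -/
def opL (c b : ℝ) (V : ℝ → ℝ) : HDot →ₗ.[ℂ] HDot := (graphL c b V).toLinearPMap

theorem opL_graph (c b : ℝ) (V : ℝ → ℝ) : (opL c b V).graph = graphL c b V :=
  Submodule.toLinearPMap_graph_eq _ (graphL_functional c b V)

/-- The operator `𝒜 = 𝒥ℒ` in `Ḣ^(1/2)(ℝ)`. -/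
def opA (c b : ℝ) (V : ℝ → ℝ) : HDot →ₗ.[ℂ] HDot := (opJ : HDot →ₗ[ℂ] HDot).compPMap (opL c b V)

/-! ## The maximal Schrödinger operator in `L²(ℝ)` -/

/-- Local absolute continuity on `ℝ`. -/
def LocallyAC (f : ℝ → ℂ) : Prop := ∀ x y : ℝ, AbsolutelyContinuousOnInterval f x y

theorem LocallyAC.ae_differentiableAt {f : ℝ → ℂ} (hf : LocallyAC f) :
    ∀ᵐ x : ℝ, DifferentiableAt ℝ f x := by
  have h : LocallyBoundedVariationOn f Set.univ := by
    intro x y _ _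
    refine ne_top_of_le_ne_top (hf x y).boundedVariationOn (eVariationOn.mono _ ?_)
    rw [Set.univ_inter]
    exact Set.Icc_subset_uIcc
  exact h.ae_differentiableAt

/-- The graph of the maximal operator `H_V` associated with `-c² d²/dx² + b² + V(x)` in `L²(ℝ)`:
the pairs `(u, f)` such that `u` (has a representative `φ` which) is differentiable with a locally
absolutely continuous derivative, and `f = -c² u'' + b² u + V u` almost everywhere. -/
def graphHV (c b : ℝ) (V : ℝ → ℝ) : Submodule ℂ (L2 × L2) where
  carrier := {p | ∃ φ : ℝ → ℂ, p.1 =ᵐ[volume] φ ∧ Differentiable ℝ φ ∧ LocallyAC (deriv φ) ∧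
    p.2 =ᵐ[volume] fun x => -(c : ℂ) ^ 2 * deriv (deriv φ) x + (b : ℂ) ^ 2 * φ x + (V x : ℂ) * φ x}
  add_mem' := by
    rintro ⟨p1, p2⟩ ⟨q1, q2⟩ ⟨φ, h1, h2, h3, h4⟩ ⟨ψ, k1, k2, k3, k4⟩
    have hd : deriv (φ + ψ) = deriv φ + deriv ψ :=
      funext fun x => deriv_add (h2 x) (k2 x)
    refine ⟨φ + ψ, (Lp.coeFn_add p1 q1).trans (h1.add k1), h2.add k2, ?_, ?_⟩
    · rw [hd]; exact fun x y => (h3 x y).add (k3 x y)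
    · filter_upwards [Lp.coeFn_add p2 q2, h4, k4, h3.ae_differentiableAt, k3.ae_differentiableAt]
        with x a1 a2 a3 a4 a5
      simp only [Prod.mk_add_mk] at a1 a2 a3 ⊢
      rw [a1, Pi.add_apply, a2, a3, hd, deriv_add a4 a5, Pi.add_apply]
      ring
  zero_mem' := by
    refine ⟨0, Lp.coeFn_zero ℂ 2 _, differentiable_const 0, ?_, ?_⟩
    · have : deriv (0 : ℝ → ℂ) = fun _ => 0 := by ext x; simp
      rw [this]
      intro x y
      exact (LipschitzWith.const (0 : ℂ)).lipschitzOnWith.absolutelyContinuousOnInterval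
    · filter_upwards [Lp.coeFn_zero ℂ 2 (volume : Measure ℝ)] with x hx
      have : deriv (0 : ℝ → ℂ) = fun _ => 0 := by ext x; simp
      simp only [Prod.snd_zero]
      rw [hx, this]; simp
  smul_mem' := by
    rintro a ⟨p1, p2⟩ ⟨φ, h1, h2, h3, h4⟩
    have hd : deriv (a • φ) = a • deriv φ :=
      funext fun x => deriv_const_smul a (h2 x)
    refine ⟨a • φ, (Lp.coeFn_smul a p1).trans (h1.const_smul a), h2.const_smul a, ?_, ?_⟩
    · rw [hd]; exact fun x y => (h3 x y).const_smul a
    · filter_upwards [Lp.coeFn_smul a p2, h4, h3.ae_differentiableAt] with x a1 a2 a4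
      simp only [Prod.smul_mk] at a1 a2 ⊢
      rw [a1, Pi.smul_apply, a2, hd, deriv_const_smul a a4, Pi.smul_apply]
      simp only [smul_eq_mul]
      ring

/-- `graphHV` is the graph of a single-valued operator. -/
theorem graphHV_functional (c b : ℝ) (V : ℝ → ℝ) :
    ∀ p ∈ graphHV c b V, p.1 = 0 → p.2 = 0 := by
  rintro ⟨p1, p2⟩ ⟨φ, h1, h2, h3, h4⟩ rfl
  have h0 : φ = 0 := by
    refine Continuous.ae_eq_iff_eq volume h2.continuous continuous_zero |>.1 ?_
    exact h1.symm.trans (Lp.coeFn_zero ℂ 2 _)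
  subst h0
  have : deriv (0 : ℝ → ℂ) = fun _ => 0 := by ext x; simp
  rw [Lp.eq_zero_iff_ae_eq_zero]
  filter_upwards [h4] with x hx
  rw [hx, this]; simp

/-- The maximal operator `H_V` associated with `-c² d²/dx² + b² + V(x)` in `L²(ℝ)`. -/
def opHV (c b : ℝ) (V : ℝ → ℝ) : L2 →ₗ.[ℂ] L2 := (graphHV c b V).toLinearPMap

theorem opHV_graph (c b : ℝ) (V : ℝ → ℝ) : (opHV c b V).graph = graphHV c b V :=
  Submodule.toLinearPMap_graph_eq _ (graphHV_functional c b V)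

/-! ## The indices -/

/-- The generalized eigenspace at `z` of the spectral problem `H_V u = z D u` in `L²(ℝ)`. -/
def eigA (c b : ℝ) (V : ℝ → ℝ) (z : ℂ) : Submodule ℂ L2 :=
  pencilGenEigenspace (opHV c b V) opD z

/-- The generalized eigenspace at `z` of `𝒜` in `Ḣ^(1/2)(ℝ)`. -/
def eigCalA (c b : ℝ) (V : ℝ → ℝ) (z : ℂ) : Submodule ℂ HDot := genEigenspace (opA c b V) z

/-- The total algebraic multiplicity of the eigenvalues of `H_V u = z D u` in the open upper
half-plane. -/
def kappaUpperA (c b : ℝ) (V : ℝ → ℝ) : ℕ∞ :=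
  totalMultiplicity (eigA c b V) {z | 0 < z.im}

/-- The total algebraic multiplicity of the eigenvalues of `𝒜` in the open upper half-plane. -/
def kappaUpperCalA (c b : ℝ) (V : ℝ → ℝ) : ℕ∞ :=
  totalMultiplicity (eigCalA c b V) {z | 0 < z.im}

/-- The total negative Krein index of `H_V u = z D u`. -/
def kappaNegA (c b : ℝ) (V : ℝ → ℝ) : ℕ∞ :=
  totalNegIndex (opHV c b V) (eigA c b V) {lam | lam ≠ 0}

/-- The total negative Krein index of `𝒜`. -/
def kappaNegCalA (c b : ℝ) (V : ℝ → ℝ) : ℕ∞ :=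
  totalNegIndex (opL c b V) (eigCalA c b V) {lam | lam ≠ 0}

/-- The Hamiltonian--Krein index of `H_V u = z D u`: the total multiplicity of the eigenvalues on
the positive imaginary half-axis, plus twice the total multiplicity of those in the open first
quadrant, plus twice the negative index of the positive eigenvalues. -/
def kappaHamA (c b : ℝ) (V : ℝ → ℝ) : ℕ∞ :=
  totalMultiplicity (eigA c b V) {z | z.re = 0 ∧ 0 < z.im}
    + 2 * totalMultiplicity (eigA c b V) {z | 0 < z.re ∧ 0 < z.im}
    + 2 * totalNegIndex (opHV c b V) (eigA c b V) {lam | 0 < lam}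

/-- The Hamiltonian--Krein index of `𝒜`. -/
def kappaHamCalA (c b : ℝ) (V : ℝ → ℝ) : ℕ∞ := kappaUpperCalA c b V + kappaNegCalA c b V

end KreinIndex

end

/-! The two spectral problems have the same generalized eigenvectors. Since `|λ|^(1/2) · |λ|^(1/2) ·
sgn λ = λ`, one has `(𝒥a, v) = ⟨Da, v⟩` for `a, v ∈ H¹`, the left side taken in `Ḣ^(1/2)` and the
right side in `L²` (`inner_toHDot_opJ`). Hence `ℒu = 𝒥a` says that `𝔱_V[u, v] = ⟨Da, v⟩` for all `v
∈ H¹`, and by integration by parts and the lemma of du Bois-Reymond this is `H_V u = Da`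
(`mem_graphL_iff`). As `𝒥² = 1`, the relation `(𝒜 - z)u = w` with `w ∈ H¹` becomes `H_V u = D(zu +
w)`, which is one step of a Jordan chain of the pencil. By induction on the chain length the
embedding of `H¹` into `Ḣ^(1/2)` carries `E_z(A)` onto `E_z(𝒜)` (`powKer_opA`, `eigCalA_eq`), and
the multiplicities agree for every `z`.

The compressions are formed with different inner products, so their eigenvalues differ. On a
finite-dimensional space, however, the number of non-positive eigenvalues of a symmetric compression
is the largest dimension of a subspace on which the quadratic form is non-positive
(`negIndexOn_eq_nonposIndex`). In both problems the form is `𝔱_V`, so the numbers coincide.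

This requires `E_λ` to be finite-dimensional for real `λ` (`finiteDimensional_eigCalA`). The
eigenspace itself is finite-dimensional because its elements solve a second-order equation. Jordan
chains are bounded in length because `𝒜 - λ` is symmetric for `𝔱_V`: a long chain would contain a
large neutral subspace, while `𝔱_V` is positive on the functions in `H¹` that vanish at suitable
finitely many points (`exists_finset_formV_pos`).

For the Hamiltonian index, complex conjugation maps `E_z(A)` onto `E_{-z̄}(A)` and preserves `𝔱_V[u,
u]`. The open second quadrant therefore contributes as much as the first, and the negative half-line
as much as the positive one. -/

noncomputable section

namespace KreinIndex

/-! ## Sums of extended natural numbers -/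

theorem totalSum_congr {ι : Type*} {f g : ι → ℕ∞} (h : ∀ i, f i = g i) :
    totalSum f = totalSum g := by
  rw [funext h]

theorem totalSum_equiv {ι κ : Type*} (e : ι ≃ κ) (f : κ → ℕ∞) :
    totalSum (fun i => f (e i)) = totalSum f := by
  unfold totalSum
  refine le_antisymm (iSup_le fun s => ?_) (iSup_le fun s => ?_)
  · refine le_iSup_of_le (s.map e.toEmbedding) ?_
    rw [Finset.sum_map]
    rfl
  · refine le_iSup_of_le (s.map e.symm.toEmbedding) ?_
    rw [Finset.sum_map]
    simp

theorem totalSum_sum {ι κ : Type*} (f : ι ⊕ κ → ℕ∞) :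
    totalSum f = totalSum (fun i => f (Sum.inl i)) + totalSum fun k => f (Sum.inr k) := by
  unfold totalSum
  refine le_antisymm (iSup_le fun s => ?_) ?_
  · rw [← Finset.toLeft_disjSum_toRight (u := s), Finset.sum_disjSum]
    exact add_le_add (le_iSup (fun s : Finset ι => ∑ i ∈ s, f (Sum.inl i)) _)
      (le_iSup (fun s : Finset κ => ∑ i ∈ s, f (Sum.inr i)) _)
  · refine ENat.iSup_add_iSup_le fun s t => ?_
    refine le_iSup_of_le (s.disjSum t) ?_
    rw [Finset.sum_disjSum]

theorem totalSum_union {α : Type*} (f : α → ℕ∞) {S T : Set α} (h : Disjoint S T) :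
    totalSum (fun z : (S ∪ T : Set α) => f z)
      = totalSum (fun z : S => f z) + totalSum (fun z : T => f z) := by
  classical
  rw [← totalSum_equiv (Equiv.Set.union h).symm, totalSum_sum]
  rfl

theorem totalSum_involution {α : Type*} (f : α → ℕ∞) (e : α ≃ α) {S T : Set α}
    (hST : ∀ z, z ∈ S ↔ e z ∈ T) (hf : ∀ z ∈ S, f (e z) = f z) :
    totalSum (fun z : S => f z) = totalSum (fun z : T => f z) := by
  rw [← totalSum_equiv (e.subtypeEquiv hST)]
  exact totalSum_congr fun z => (hf z z.2).symm

/-- Fibres over distinct values are disjoint, so a finite partial sum counts a union of fibres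
inside the non-positive indices. Used with `g` the list of eigenvalues of a compression. -/
theorem totalSum_card_fiber {ι : Type*} [Fintype ι] (g : ι → ℝ) :
    totalSum (fun μ : Set.Iic (0 : ℝ) => ((Finset.univ.filter fun i => g i = μ).card : ℕ∞))
      = ((Finset.univ.filter fun i => g i ≤ 0).card : ℕ∞) := by
  classical
  unfold totalSum
  have key : ∀ s : Finset (Set.Iic (0 : ℝ)),
      ∑ μ ∈ s, ((Finset.univ.filter fun i => g i = μ).card : ℕ∞)
        = ((s.biUnion fun μ => Finset.univ.filter fun i => g i = μ).card : ℕ∞) := by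
    intro s
    rw [Finset.card_biUnion]
    · push_cast; rfl
    · intro a _ b _ hab
      refine Finset.disjoint_left.2 fun i hi hj => hab (Subtype.ext ?_)
      rw [Finset.mem_filter] at hi hj
      rw [← hi.2, ← hj.2]
  refine le_antisymm (iSup_le fun s => ?_) ?_
  · rw [key]
    refine Nat.cast_le.2 (Finset.card_le_card fun i hi => ?_)
    obtain ⟨μ, _, hi⟩ := Finset.mem_biUnion.1 hi
    rw [Finset.mem_filter] at hi ⊢
    exact ⟨hi.1, hi.2.trans_le μ.2⟩
  · refine le_iSup_of_le ((Finset.univ.filter fun i => g i ≤ 0).attach.image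
      fun i : {i // i ∈ Finset.univ.filter fun i => g i ≤ 0} =>
        ⟨g i, (Finset.mem_filter.1 i.2).2⟩) ?_
    rw [key]
    refine Nat.cast_le.2 (Finset.card_le_card fun i hi => ?_)
    rw [Finset.mem_biUnion]
    exact ⟨⟨g i, (Finset.mem_filter.1 hi).2⟩,
      Finset.mem_image.2 ⟨⟨i, hi⟩, Finset.mem_attach _ _, rfl⟩, by simp⟩

/-! ## Dimensions and numbers of non-positive squares -/

section Index

variable {H H' : Type*} [NormedAddCommGroup H] [InnerProductSpace ℂ H]
  [NormedAddCommGroup H'] [InnerProductSpace ℂ H']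

/-- Semilinear maps are allowed so that the same lemma serves the linear embeddings of `H¹` and
complex conjugation. -/
theorem edim_map {σ σ' : ℂ →+* ℂ} [RingHomInvPair σ σ'] [RingHomInvPair σ' σ] (f : H →ₛₗ[σ] H')
    (hf : Function.Injective f) (E : Submodule ℂ H) : edim (E.map f) = edim E := by
  have h := lift_rank_eq_of_equiv_equiv (R := ℂ) (R' := ℂ) σ
    (E.equivMapOfInjective f hf).toAddEquiv
    (RingHomInvPair.toRingEquiv σ σ').bijective
    (fun r m => (E.equivMapOfInjective f hf).map_smulₛₗ r m)
  unfold edim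
  rw [← Cardinal.toENat_lift, ← h, Cardinal.toENat_lift]

theorem edim_eq_finrank (E : Submodule ℂ H) [FiniteDimensional ℂ E] :
    edim E = (Module.finrank ℂ E : ℕ∞) := by
  unfold edim
  rw [← Module.finrank_eq_rank, Cardinal.toENat_nat]

/-- The supremum of the dimensions of the subspaces of `E` on which `q` is non-positive. -/
def nonposIndex (q : H → ℝ) (E : Submodule ℂ H) : ℕ∞ :=
  ⨆ (W : Submodule ℂ H) (_ : W ≤ E ∧ ∀ u ∈ W, q u ≤ 0), edim W

/-- No inner product enters the index, only the form. This is what allows the indices in `L²` and in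
`Ḣ^(1/2)` to be compared, both being pulled back to `H¹`. -/
theorem nonposIndex_map {σ σ' : ℂ →+* ℂ} [RingHomInvPair σ σ'] [RingHomInvPair σ' σ]
    (f : H →ₛₗ[σ] H') (hf : Function.Injective f) {q : H → ℝ} {q' : H' → ℝ} {E : Submodule ℂ H}
    (hq : ∀ u ∈ E, q' (f u) = q u) : nonposIndex q' (E.map f) = nonposIndex q E := by
  refine le_antisymm (iSup₂_le fun W hW => ?_) (iSup₂_le fun W hW => ?_)
  · have hmap : (W.comap f).map f = W := by
      refine Submodule.map_comap_eq_self fun x hx => ?_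
      obtain ⟨u, -, rfl⟩ := hW.1 hx
      exact ⟨u, rfl⟩
    have hE : W.comap f ≤ E := fun u hu => by
      obtain ⟨v, hv, hvu⟩ := hW.1 hu
      rwa [← hf hvu]
    refine le_iSup₂_of_le (W.comap f) ⟨hE, fun u hu => ?_⟩ ?_
    · rw [← hq u (hE hu)]
      exact hW.2 _ hu
    · rw [← edim_map f hf, hmap]
  · refine le_iSup₂_of_le (W.map f) ⟨Submodule.map_mono hW.1, ?_⟩ (edim_map f hf W).ge
    rintro _ ⟨u, hu, rfl⟩
    rw [hq u (hW.1 hu)]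
    exact hW.2 u hu

theorem starProjection_congr [CompleteSpace H] {K K' : Submodule ℂ H} (h : K = K')
    [K.HasOrthogonalProjection] [K'.HasOrthogonalProjection] :
    K.starProjection = K'.starProjection := by
  subst h; rfl

/-- The compression of `T` to a finite-dimensional subspace of its domain. -/
def compression (T : H →ₗ.[ℂ] H) (E : Submodule ℂ H) [FiniteDimensional ℂ E]
    (hE : E ≤ T.domain) : E →ₗ[ℂ] E :=
  (E.orthogonalProjectionOnto : H →ₗ[ℂ] E) ∘ₗ T.toFun ∘ₗ Submodule.inclusion hE

theorem inner_compression (T : H →ₗ.[ℂ] H) (E : Submodule ℂ H) [FiniteDimensional ℂ E]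
    (hE : E ≤ T.domain) (u v : E) :
    ⟪u, compression T E hE v⟫_ℂ = ⟪(u : H), T ⟨v, hE v.2⟩⟫_ℂ := by
  rw [Submodule.coe_inner]
  change ⟪(u : H), E.starProjection (T ⟨v, hE v.2⟩)⟫_ℂ = _
  rw [← Submodule.inner_starProjection_left_eq_right, Submodule.starProjection_eq_self_iff.2 u.2]

variable [CompleteSpace H]

theorem compressionEigenspace_eq (T : H →ₗ.[ℂ] H) (E : Submodule ℂ H) [FiniteDimensional ℂ E]
    (hE : E ≤ T.domain) (μ : ℝ) :
    compressionEigenspace T E μ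
      = (Module.End.eigenspace (compression T E hE) (μ : ℂ)).map E.subtype := by
  have hP : E.topologicalClosure.starProjection = E.starProjection :=
    starProjection_congr (Submodule.closed_of_finiteDimensional E).submodule_topologicalClosure_eq
  ext x
  unfold compressionEigenspace
  rw [hP]
  constructor
  · rintro ⟨hx, ⟨y, hy⟩, hy', rfl⟩
    refine ⟨⟨y, hx⟩, ?_, rfl⟩
    refine Module.End.mem_eigenspace_iff.2 (Subtype.ext ?_)
    have := LinearMap.mem_ker.1 hy'
    exact sub_eq_zero.1 this
  · rintro ⟨y, hy, rfl⟩
    refine ⟨y.2, ⟨y, hE y.2⟩, ?_, rfl⟩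
    have := congrArg Subtype.val (Module.End.mem_eigenspace_iff.1 hy)
    exact LinearMap.mem_ker.2 (sub_eq_zero.2 this)

/-- Sylvester's law of inertia. In an orthonormal eigenbasis of the compression the form is `∑ ev i
|uᵢ|²`. The eigenvectors with `ev i ≤ 0` span a non-positive subspace, and no larger one exists,
because a non-positive subspace meets the span of the remaining eigenvectors only in `0`. -/
theorem negIndexOn_eq_nonposIndex (T : H →ₗ.[ℂ] H) (E : Submodule ℂ H) [FiniteDimensional ℂ E]
    (hE : E ≤ T.domain) (q : H → ℝ)
    (hsymm : ∀ (u v : H) (hu : u ∈ E) (hv : v ∈ E),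
      ⟪T ⟨u, hE hu⟩, v⟫_ℂ = ⟪u, T ⟨v, hE hv⟩⟫_ℂ)
    (hq : ∀ (u : H) (hu : u ∈ E), q u = (⟪u, T ⟨u, hE hu⟩⟫_ℂ).re) :
    negIndexOn T E = nonposIndex q E := by
  classical
  have hB : (compression T E hE).IsSymmetric := by
    intro u v
    rw [inner_compression, ← hsymm u v u.2 v.2, ← inner_conj_symm, inner_compression,
      inner_conj_symm]
  set B := compression T E hE with hBdef
  set n := Module.finrank ℂ E with hn
  set e := hB.eigenvectorBasis hn.symm with he
  set ev := hB.eigenvalues hn.symm with hev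
  have hqB : ∀ u : E, q u = ∑ i, ev i * ‖e.repr u i‖ ^ 2 := by
    intro u
    rw [hq u u.2, ← inner_compression, ← e.repr.inner_map_map, PiLp.inner_apply, Complex.re_sum]
    refine Finset.sum_congr rfl fun i _ => ?_
    rw [hB.eigenvectorBasis_apply_self_apply hn.symm u i]
    change (inner ℂ (e.repr u i) ((ev i : ℂ) * e.repr u i)).re = _
    rw [RCLike.inner_apply, mul_assoc, Complex.mul_conj, Complex.normSq_eq_norm_sq,
      ← Complex.ofReal_mul, Complex.ofReal_re]
  have hdim : negIndexOn T E = ((Finset.univ.filter fun i => ev i ≤ 0).card : ℕ∞) := by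
    rw [← totalSum_card_fiber]
    refine totalSum_congr fun μ => ?_
    rw [compressionEigenspace_eq T E hE, edim_map _ E.subtype_injective, edim_eq_finrank,
      ← hB.card_filter_eigenvalues_eq hn.symm]
    congr 2
    ext i
    simp [hev]
  have hsp : ∀ (p : Fin n → Prop) [DecidablePred p], Module.finrank ℂ
      (Submodule.span ℂ (Set.range fun i : {i // p i} => e i))
        = (Finset.univ.filter p).card := by
    intro p _
    have hli : LinearIndependent ℂ fun i : {i // p i} => e i :=
      e.orthonormal.linearIndependent.comp _ Subtype.val_injective
    rw [finrank_span_eq_card hli, Fintype.card_subtype]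
  have hrep : ∀ (p : Fin n → Prop) (u : E),
      u ∈ Submodule.span ℂ (Set.range fun i : {i // p i} => e i) → ∀ j, ¬ p j →
        e.repr u j = 0 := by
    intro p u hu j hj
    induction hu using Submodule.span_induction with
    | mem x hx =>
      obtain ⟨i, rfl⟩ := hx
      rw [e.repr_self, PiLp.single_apply, if_neg]
      rintro rfl
      exact hj i.2
    | zero => simp
    | add x y _ _ hx hy => simp [hx, hy]
    | smul a x _ hx => simp [hx]
  rw [hdim]
  refine le_antisymm ?_ (iSup₂_le fun W hW => ?_)
  · refine le_iSup₂_of_le ((Submodule.span ℂ (Set.range fun i : {i // ev i ≤ 0} => e i)).map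
      E.subtype) ⟨Submodule.map_subtype_le _ _, ?_⟩ ?_
    · rintro _ ⟨u, hu, rfl⟩
      rw [Submodule.coe_subtype, hqB]
      refine Finset.sum_nonpos fun i _ => ?_
      by_cases hi : ev i ≤ 0
      · exact mul_nonpos_of_nonpos_of_nonneg hi (by positivity)
      · rw [hrep _ u hu i hi]; simp
    · rw [edim_map _ E.subtype_injective, edim_eq_finrank, hsp]
  · set W' := W.comap E.subtype with hW'
    have hWW : W'.map E.subtype = W :=
      Submodule.map_comap_eq_self (by rw [Submodule.range_subtype]; exact hW.1)
    rw [← hWW, edim_map _ E.subtype_injective, edim_eq_finrank]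
    -- The span of the positive eigenvectors. Disjointness from it bounds `dim W'` by `n - dim Wp`.
    set Wp := Submodule.span ℂ (Set.range fun i : {i // ¬ ev i ≤ 0} => e i) with hWp
    have hdisj : Disjoint W' Wp := by
      rw [Submodule.disjoint_def]
      intro u hu hu'
      have h1 : q u ≤ 0 := hW.2 _ hu
      rw [hqB] at h1
      have h2 : ∀ i ∈ Finset.univ, 0 ≤ ev i * ‖e.repr u i‖ ^ 2 := fun i _ => by
        by_cases hi : ev i ≤ 0
        · rw [hrep _ u hu' i (not_not.2 hi)]; simp
        · exact mul_nonneg (not_le.1 hi).le (by positivity)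
      have h3 := (Finset.sum_eq_zero_iff_of_nonneg h2).1 (le_antisymm h1 (Finset.sum_nonneg h2))
      refine e.repr.map_eq_zero_iff.1 ?_
      ext i
      by_cases hi : ev i ≤ 0
      · exact hrep _ u hu' i (not_not.2 hi)
      · rcases mul_eq_zero.1 (h3 i (Finset.mem_univ i)) with h | h
        · exact absurd h.le hi
        · simpa using h
    have h1 := Submodule.finrank_add_finrank_le_of_disjoint hdisj
    rw [hsp, ← hn] at h1
    have h2 := Finset.card_filter_add_card_filter_not (s := (Finset.univ : Finset (Fin n)))
      (fun i => ev i ≤ 0)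
    rw [Finset.card_univ, Fintype.card_fin] at h2
    exact Nat.cast_le.2 (by omega)

end Index

/-! ## Locally nilpotent operators -/

/-- `N` maps `ker N^(n+1)` into `ker N^n`, and the kernel of this map lies in `ker N`. -/
theorem finiteDimensional_ker_pow {E : Type*} [AddCommGroup E] [Module ℂ E] (N : E →ₗ[ℂ] E)
    [FiniteDimensional ℂ (LinearMap.ker N)] (n : ℕ) :
    FiniteDimensional ℂ (LinearMap.ker (N ^ n)) := by
  induction n with
  | zero =>
    rw [pow_zero, Module.End.one_eq_id, LinearMap.ker_id]
    infer_instance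
  | succ n ih =>
    rw [pow_succ, Module.End.mul_eq_comp, LinearMap.ker_comp]
    rw [← Submodule.fg_iff_finiteDimensional] at ih ⊢
    refine Submodule.fg_of_fg_map_of_fg_inf_ker N ?_ ?_
    · have := (Submodule.fg_iff_finiteDimensional _).1 ih
      exact (Submodule.fg_iff_finiteDimensional _).2
        (Submodule.finiteDimensional_of_le (Submodule.map_comap_le N _))
    · exact (Submodule.fg_iff_finiteDimensional _).2
        (Submodule.finiteDimensional_of_le inf_le_right)

theorem linearIndependent_pow_apply {E : Type*} [AddCommGroup E] [Module ℂ E]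
    (N : E →ₗ[ℂ] E) (κ : ℕ) (z : E) (h0 : (N ^ κ) z ≠ 0) (h1 : (N ^ (κ + 1)) z = 0) :
    LinearIndependent ℂ fun i : Fin (κ + 1) => (N ^ (i : ℕ)) z := by
  have hbig : ∀ m, κ < m → (N ^ m) z = 0 := fun m hm => by
    obtain ⟨d, rfl⟩ := Nat.exists_eq_add_of_le (Nat.succ_le_of_lt hm)
    rw [Nat.succ_eq_add_one, add_comm, pow_add, Module.End.mul_apply, h1, map_zero]
  rw [Fintype.linearIndependent_iff]
  intro g hg
  by_contra! hne
  obtain ⟨i, hi⟩ := hne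
  have hex : ∃ m, ∃ h : m < κ + 1, g ⟨m, h⟩ ≠ 0 := ⟨i, i.2, hi⟩
  classical
  obtain ⟨h, hm⟩ := Nat.find_spec hex
  have hmin := fun m (hm : m < Nat.find hex) => Nat.find_min hex hm
  set m := Nat.find hex
  -- With `m` the least index of a nonzero coefficient, `N^(κ-m)` kills all later terms and turns
  -- the `m`-th one into a multiple of `N^κ z ≠ 0`.
  have h2 := congrArg (N ^ (κ - m)) hg
  rw [map_sum, map_zero, Finset.sum_eq_single ⟨m, h⟩] at h2
  · rw [map_smul, ← Module.End.mul_apply, ← pow_add, Nat.sub_add_cancel (by omega)] at h2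
    exact (smul_ne_zero hm h0) h2
  · intro j _ hj
    rw [map_smul, ← Module.End.mul_apply, ← pow_add]
    rcases lt_trichotomy (j : ℕ) m with hjm | hjm | hjm
    · have : g j = 0 := by
        by_contra h'
        exact hmin j hjm ⟨j.2, h'⟩
      rw [this, zero_smul]
    · exact absurd (Fin.ext hjm) hj
    · rw [hbig _ (by omega), smul_zero]
  · intro h'
    exact absurd (Finset.mem_univ _) h'

/-- If `N` is symmetric for `t`, then `range N^k ∩ ker N^k` is `t`-neutral. A Jordan chain longer
than `2κ + 2` would put `κ + 1` independent vectors into this space for `k = κ + 1`. Hence `N^(2κ+2)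
= 0`, and the whole space is the kernel of a power of `N`. -/
theorem finiteDimensional_of_locallyNilpotent {E : Type*} [AddCommGroup E] [Module ℂ E]
    (N : E →ₗ[ℂ] E) [FiniteDimensional ℂ (LinearMap.ker N)] (hnil : ∀ x, ∃ n, (N ^ n) x = 0)
    (t : E → E → ℂ) (ht : ∀ x y, t (N x) y = t x (N y)) (ht0 : ∀ x, t x 0 = 0) (κ : ℕ)
    (hκ : ∀ W : Submodule ℂ E, FiniteDimensional ℂ W → (∀ x ∈ W, t x x = 0) →
      Module.finrank ℂ W ≤ κ) : FiniteDimensional ℂ E := by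
  have htn : ∀ n x y, t ((N ^ n) x) y = t x ((N ^ n) y) := by
    intro n
    induction n with
    | zero => intro x y; rfl
    | succ n ih =>
      intro x y
      rw [pow_succ', Module.End.mul_apply, ht, ih, ← Module.End.mul_apply, ← pow_succ, pow_succ',
        Module.End.mul_apply, ← Module.End.mul_apply, ← pow_succ', pow_succ]
  have hzero : ∀ x, (N ^ (2 * κ + 2)) x = 0 := by
    intro x
    by_contra hx
    classical
    have hspec := Nat.find_spec (hnil x)
    have hmin := fun m (hm : m < Nat.find (hnil x)) => Nat.find_min (hnil x) hm
    set n := Nat.find (hnil x)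
    have hn : 2 * κ + 2 < n := by
      by_contra hle
      obtain ⟨d, hd⟩ := Nat.exists_eq_add_of_le (not_lt.1 hle)
      rw [hd, add_comm, pow_add, Module.End.mul_apply, hspec, map_zero] at hx
      exact hx rfl
    obtain ⟨d, hd⟩ := Nat.exists_eq_add_of_le hn.le
    -- Here `n = 2κ + 2 + d` is the exact order of `x`, so `z, Nz, …, N^κ z` are the last `κ + 1`
    -- nonzero vectors of its chain.
    set z := (N ^ (κ + 1)) ((N ^ d) x) with hz
    have hzx : ∀ m, (N ^ m) z = (N ^ (m + (κ + 1) + d)) x := fun m => by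
      rw [hz, ← Module.End.mul_apply, ← Module.End.mul_apply, ← pow_add, ← pow_add]
    have hli := linearIndependent_pow_apply N κ z
      (by rw [hzx]; exact hmin _ (by omega))
      (by rw [hzx, show κ + 1 + (κ + 1) + d = n by omega]; exact hspec)
    have hW : ∀ w ∈ Submodule.span ℂ (Set.range fun i : Fin (κ + 1) => (N ^ (i : ℕ)) z),
        w ∈ LinearMap.range (N ^ (κ + 1)) ⊓ LinearMap.ker (N ^ (κ + 1)) := by
      refine fun w hw => Submodule.span_le.2 ?_ hw
      rintro _ ⟨i, rfl⟩
      refine ⟨⟨(N ^ (i : ℕ)) ((N ^ d) x), ?_⟩, ?_⟩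
      · simp only [hz, ← Module.End.mul_apply, ← pow_add]
        rw [show κ + 1 + (i + d) = i + (κ + 1 + d) by omega]
      · refine LinearMap.mem_ker.2 ?_
        change (N ^ (κ + 1)) ((N ^ (i : ℕ)) z) = 0
        rw [← Module.End.mul_apply, ← pow_add, hzx,
          show κ + 1 + i + (κ + 1) + d = i + n by omega, pow_add, Module.End.mul_apply, hspec,
          map_zero]
    have := hκ _ (FiniteDimensional.span_of_finite ℂ (Set.finite_range _)) fun w hw => by
      obtain ⟨⟨v, rfl⟩, h2⟩ := hW w hw
      -- Neutrality: with `w = N^(κ+1) v`, `t(w, w) = t(v, N^(κ+1) w) = t(v, 0)`.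
      rw [htn, LinearMap.mem_ker.1 h2, ht0]
    rw [finrank_span_eq_card hli, Fintype.card_fin] at this
    omega
  have h := finiteDimensional_ker_pow N (2 * κ + 2)
  rw [show LinearMap.ker (N ^ (2 * κ + 2)) = ⊤ from
    (Submodule.eq_top_iff').2 fun x => LinearMap.mem_ker.2 (hzero x)] at h
  exact Submodule.topEquiv.finiteDimensional

/-! ## Locally absolutely continuous functions -/

theorem _root_.AbsolutelyContinuousOnInterval.comp_of_dist_le {X Y : Type*} [PseudoMetricSpace X]
    [PseudoMetricSpace Y] {f : ℝ → X} {a b : ℝ} (hf : AbsolutelyContinuousOnInterval f a b)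
    {g : X → Y} (hg : ∀ x y, dist (g x) (g y) ≤ dist x y) :
    AbsolutelyContinuousOnInterval (fun x => g (f x)) a b := by
  rw [absolutelyContinuousOnInterval_iff] at hf ⊢
  intro ε hε
  obtain ⟨δ, hδ, h⟩ := hf ε hε
  exact ⟨δ, hδ, fun E hE hE' => (Finset.sum_le_sum fun i _ => hg _ _).trans_lt (h E hE hE')⟩

theorem _root_.IntervalIntegrable.complex_ofReal {f : ℝ → ℝ} {a b : ℝ}
    (h : IntervalIntegrable f volume a b) :
    IntervalIntegrable (fun x => (f x : ℂ)) volume a b :=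
  ⟨h.1.ofReal, h.2.ofReal⟩

theorem LocallyAC.re {f : ℝ → ℂ} (hf : LocallyAC f) (a b : ℝ) :
    AbsolutelyContinuousOnInterval (fun x => (f x).re) a b :=
  (hf a b).comp_of_dist_le fun x y => by
    rw [Real.dist_eq, dist_eq_norm, ← Complex.sub_re]; exact Complex.abs_re_le_norm _

theorem LocallyAC.im {f : ℝ → ℂ} (hf : LocallyAC f) (a b : ℝ) :
    AbsolutelyContinuousOnInterval (fun x => (f x).im) a b :=
  (hf a b).comp_of_dist_le fun x y => by
    rw [Real.dist_eq, dist_eq_norm, ← Complex.sub_im]; exact Complex.abs_im_le_norm _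

theorem LocallyAC.ofReal_add_ofReal_mul_I {f g : ℝ → ℝ}
    (hf : ∀ a b, AbsolutelyContinuousOnInterval f a b)
    (hg : ∀ a b, AbsolutelyContinuousOnInterval g a b) :
    LocallyAC fun x => (f x : ℂ) + (g x : ℂ) * Complex.I := by
  intro a b
  have h1 := (hf a b).comp_of_dist_le (g := fun x : ℝ => (x : ℂ))
    fun x y => by
      rw [dist_eq_norm, dist_eq_norm, ← Complex.ofReal_sub, Complex.norm_real]
  have h2 := ((hg a b).comp_of_dist_le (g := fun x : ℝ => (x : ℂ))
    fun x y => by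
      rw [dist_eq_norm, dist_eq_norm, ← Complex.ofReal_sub, Complex.norm_real]).const_smul Complex.I
  convert! h1.add h2 using 2
  simp [mul_comm]

theorem LocallyAC.continuous {f : ℝ → ℂ} (hf : LocallyAC f) : Continuous f := by
  refine continuous_iff_continuousAt.2 fun x => ?_
  have h := (hf (x - 1) (x + 1)).continuousOn
  rw [Set.uIcc_of_le (by linarith)] at h
  exact h.continuousAt (Icc_mem_nhds (by linarith) (by linarith))

theorem LocallyAC.mul {f g : ℝ → ℂ} (hf : LocallyAC f) (hg : LocallyAC g) :
    LocallyAC fun x => f x * g x :=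
  fun a b => (hf a b).smul (hg a b)

theorem LocallyAC.deriv_ae {f : ℝ → ℂ} (hf : LocallyAC f) :
    ∀ᵐ x : ℝ, deriv f x = ((deriv (fun x => (f x).re) x : ℝ) : ℂ)
      + ((deriv (fun x => (f x).im) x : ℝ) : ℂ) * Complex.I := by
  filter_upwards [hf.ae_differentiableAt] with x hx
  have h1 := (Complex.reCLM.hasFDerivAt.comp_hasDerivAt x hx.hasDerivAt).deriv
  have h2 := (Complex.imCLM.hasFDerivAt.comp_hasDerivAt x hx.hasDerivAt).deriv
  simp only [Function.comp_def, Complex.reCLM_apply, Complex.imCLM_apply] at h1 h2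
  rw [h1, h2, Complex.re_add_im]

theorem LocallyAC.intervalIntegrable_deriv {f : ℝ → ℂ} (hf : LocallyAC f) (a b : ℝ) :
    IntervalIntegrable (deriv f) volume a b := by
  have h1 := (hf.re a b).intervalIntegrable_deriv
  have h2 := (hf.im a b).intervalIntegrable_deriv
  have h3 := h1.complex_ofReal.add (h2.complex_ofReal.mul_const Complex.I)
  refine h3.congr_ae (ae_restrict_of_ae ?_)
  filter_upwards [hf.deriv_ae] with x hx
  rw [hx]

/-- The fundamental theorem of calculus for absolutely continuous functions, reduced to the real and
imaginary parts. -/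
theorem LocallyAC.integral_deriv {f : ℝ → ℂ} (hf : LocallyAC f) (a b : ℝ) :
    ∫ x in a..b, deriv f x = f b - f a := by
  have h1 := (hf.re a b).intervalIntegrable_deriv
  have h2 := (hf.im a b).intervalIntegrable_deriv
  rw [intervalIntegral.integral_congr_ae (hf.deriv_ae.mono fun x hx _ => hx),
    intervalIntegral.integral_add h1.complex_ofReal (h2.complex_ofReal.mul_const _),
    intervalIntegral.integral_mul_const, intervalIntegral.integral_ofReal,
    intervalIntegral.integral_ofReal, (hf.re a b).integral_deriv_eq_sub,
    (hf.im a b).integral_deriv_eq_sub]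
  apply Complex.ext <;> simp

theorem LocallyAC.locallyIntegrable_deriv {f : ℝ → ℂ} (hf : LocallyAC f) :
    LocallyIntegrable (deriv f) volume := by
  intro x
  refine ⟨Set.Icc (x - 1) (x + 1), Icc_mem_nhds (by linarith) (by linarith), ?_⟩
  have := hf.intervalIntegrable_deriv (x - 1) (x + 1)
  rwa [intervalIntegrable_iff_integrableOn_Icc_of_le (by linarith)] at this

theorem intervalIntegrable_of_locallyIntegrable {E : Type*} [NormedAddCommGroup E] {g : ℝ → E}
    (hg : LocallyIntegrable g volume) (a b : ℝ) : IntervalIntegrable g volume a b :=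
  (hg.integrableOn_isCompact isCompact_uIcc).intervalIntegrable

theorem absolutelyContinuousOnInterval_primitive {g : ℝ → ℝ} (hg : LocallyIntegrable g volume)
    (a b : ℝ) : AbsolutelyContinuousOnInterval (fun x => ∫ s in (0 : ℝ)..x, g s) a b := by
  -- The interval is enlarged to contain the base point `0` of the primitive.
  have h := (intervalIntegrable_of_locallyIntegrable hg (min 0 (min a b)) (max 0 (max a b)))
  refine (h.absolutelyContinuousOnInterval_intervalIntegral (c := 0) ?_).mono ?_
  · rw [Set.mem_uIcc]; left; exact ⟨min_le_left _ _, le_max_left _ _⟩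
  · rw [Set.uIcc_of_le (a := min 0 _) ((min_le_left _ _).trans (le_max_left _ _))]
    exact Set.Icc_subset_Icc (min_le_right _ _) (le_max_right _ _)

theorem _root_.MeasureTheory.LocallyIntegrable.complex_re {g : ℝ → ℂ}
    (hg : LocallyIntegrable g volume) : LocallyIntegrable (fun x => (g x).re) volume :=
  fun x => by obtain ⟨s, hs, h⟩ := hg x; exact ⟨s, hs, h.re⟩

theorem _root_.MeasureTheory.LocallyIntegrable.complex_im {g : ℝ → ℂ}
    (hg : LocallyIntegrable g volume) : LocallyIntegrable (fun x => (g x).im) volume :=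
  fun x => by obtain ⟨s, hs, h⟩ := hg x; exact ⟨s, hs, h.im⟩

theorem locallyAC_primitive {g : ℝ → ℂ} (hg : LocallyIntegrable g volume) (C : ℂ) :
    LocallyAC fun x => C + ∫ s in (0 : ℝ)..x, g s := by
  have h1 := LocallyAC.ofReal_add_ofReal_mul_I
    (absolutelyContinuousOnInterval_primitive hg.complex_re)
    (absolutelyContinuousOnInterval_primitive hg.complex_im)
  have h2 : (fun x : ℝ => ((∫ s in (0 : ℝ)..x, (g s).re : ℝ) : ℂ)
      + ((∫ s in (0 : ℝ)..x, (g s).im : ℝ) : ℂ) * Complex.I)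
      = fun x => ∫ s in (0 : ℝ)..x, g s := by
    funext x
    rw [← intervalIntegral.integral_ofReal, ← intervalIntegral.integral_ofReal,
      ← intervalIntegral.integral_mul_const, ← intervalIntegral.integral_add
        (intervalIntegrable_of_locallyIntegrable hg.complex_re 0 x).complex_ofReal
        ((intervalIntegrable_of_locallyIntegrable hg.complex_im 0 x).complex_ofReal.mul_const _)]
    simp only [Complex.re_add_im]
  rw [h2] at h1
  intro a b
  exact ((LipschitzWith.const C).lipschitzOnWith.absolutelyContinuousOnInterval).add (h1 a b)

theorem ae_hasDerivAt_primitive {g : ℝ → ℂ} (hg : LocallyIntegrable g volume) (C : ℂ) :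
    ∀ᵐ x, HasDerivAt (fun x => C + ∫ s in (0 : ℝ)..x, g s) (g x) x := by
  have h := ae_all_iff.2 fun n : ℕ =>
    (intervalIntegrable_of_locallyIntegrable hg (-n) n).ae_hasDerivAt_integral
  filter_upwards [h] with x hx
  obtain ⟨n, hn⟩ := exists_nat_ge |x|
  rw [abs_le] at hn
  refine (hx n ?_ 0 ?_).const_add C
  · rw [Set.uIcc_of_le (by linarith)]; exact ⟨hn.1, hn.2⟩
  · rw [Set.uIcc_of_le (by linarith)]; exact ⟨by linarith, by linarith⟩

theorem _root_.ContDiff.locallyAC {f : ℝ → ℂ} (hf : ContDiff ℝ 1 f) : LocallyAC f :=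
  fun _ _ => hf.contDiffOn.absolutelyContinuousOnInterval

theorem LocallyAC.integral_deriv_eq_zero {f : ℝ → ℂ} (hf : LocallyAC f)
    (hc : HasCompactSupport f) : ∫ x, deriv f x = 0 := by
  obtain ⟨R, hR⟩ := hc.isCompact.isBounded.subset_closedBall (0 : ℝ)
  -- The added `1` makes `f` vanish at both endpoints; `|R|` covers a possibly negative radius.
  have hsub : tsupport f ⊆ Set.Ioc (-(|R| + 1)) (|R| + 1) := fun x hx => by
    have := hR hx
    rw [mem_closedBall_zero_iff, Real.norm_eq_abs] at this
    have := abs_le.1 (this.trans (le_abs_self R))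
    exact ⟨by linarith, by linarith⟩
  rw [← intervalIntegral.integral_eq_integral_of_support_subset
    ((support_deriv_subset).trans hsub), hf.integral_deriv]
  have hz : ∀ x, x ∉ Set.Ioo (-(|R| + 1)) (|R| + 1) → f x = 0 := fun x hx => by
    by_contra h
    have := hR (subset_tsupport f h)
    rw [mem_closedBall_zero_iff, Real.norm_eq_abs] at this
    have := abs_le.1 (this.trans (le_abs_self R))
    exact hx ⟨by linarith, by linarith⟩
  rw [hz _ fun h => lt_irrefl _ h.2, hz _ fun h => lt_irrefl _ h.1, sub_zero]

/-! ## The fundamental lemma of du Bois-Reymond -/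

theorem integral_deriv_smul_primitive {g : ℝ → ℂ} (hg : LocallyIntegrable g volume) (C : ℂ)
    {ψ : ℝ → ℝ} (hψ : ContDiff ℝ (⊤ : ℕ∞) ψ) (hc : HasCompactSupport ψ) :
    ∫ x, deriv ψ x • (C + ∫ s in (0 : ℝ)..x, g s) = -∫ x, ψ x • g x := by
  have hψC : ContDiff ℝ 1 fun x => (ψ x : ℂ) :=
    Complex.ofRealCLM.contDiff.comp (hψ.of_le (by exact_mod_cast le_top))
  have hF := locallyAC_primitive hg C
  have hprod := hψC.locallyAC.mul hF
  have hcc : HasCompactSupport fun x : ℝ => (ψ x : ℂ) * (C + ∫ s in (0 : ℝ)..x, g s) := by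
    refine hc.mono fun x hx => ?_
    contrapose! hx
    simp only [Function.mem_support, not_not] at hx ⊢
    rw [hx]; simp
  have h0 := hprod.integral_deriv_eq_zero hcc
  have hd : Differentiable ℝ ψ := hψ.differentiable (by simp)
  have hae : (fun x => deriv (fun x : ℝ => (ψ x : ℂ) * (C + ∫ s in (0 : ℝ)..x, g s)) x)
      =ᵐ[volume] fun x => deriv ψ x • (C + ∫ s in (0 : ℝ)..x, g s) + ψ x • g x := by
    filter_upwards [ae_hasDerivAt_primitive hg C] with x hx
    have h1 := ((hd x).hasDerivAt.ofReal_comp.fun_mul hx).deriv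
    rw [h1, Complex.real_smul, Complex.real_smul]
  rw [integral_congr_ae hae, integral_add] at h0
  · exact eq_neg_of_add_eq_zero_left h0
  · have hcd := hψ.continuous_deriv (by simp)
    exact (hcd.smul hF.continuous).integrable_of_hasCompactSupport hc.deriv.smul_right
  · exact hg.integrable_smul_left_of_hasCompactSupport hψ.continuous hc

/-- A test function is the derivative of a test function exactly when its mean is zero. Subtracting
from `η` the multiple `(∫ η) ρ` of a fixed bump of mass one achieves this, and the hypothesis then
gives `∫ η w = (∫ η) ∫ ρ w`, so the constant is `∫ ρ w`. -/
theorem ae_eq_const_of_integral_deriv_smul {w : ℝ → ℂ} (hw : LocallyIntegrable w volume)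
    (h : ∀ ψ : ℝ → ℝ, ContDiff ℝ (⊤ : ℕ∞) ψ → HasCompactSupport ψ → ∫ x, deriv ψ x • w x = 0) :
    ∃ C, w =ᵐ[volume] fun _ => C := by
  let β : ContDiffBump (0 : ℝ) := default
  set ρ : ℝ → ℝ := β.normed volume
  have hρ : ContDiff ℝ (⊤ : ℕ∞) ρ := β.contDiff_normed
  have hρc : HasCompactSupport ρ := β.hasCompactSupport_normed
  have hρ1 : ∫ x, ρ x = 1 := β.integral_normed
  refine ⟨∫ x, ρ x • w x, ae_eq_of_integral_contDiff_smul_eq hw (locallyIntegrable_const _)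
    fun η hη hηc => ?_⟩
  set θ : ℝ → ℝ := fun x => η x - (∫ y, η y) * ρ x with hθ
  have hθd : ContDiff ℝ (⊤ : ℕ∞) θ := hη.sub (contDiff_const.mul hρ)
  have hηi : Integrable η := hη.continuous.integrable_of_hasCompactSupport hηc
  have hρi : Integrable ρ := hρ.continuous.integrable_of_hasCompactSupport hρc
  have hθc : HasCompactSupport θ := hηc.sub hρc.mul_left
  have hθ0 : ∫ x, θ x = 0 := by
    rw [hθ, integral_sub hηi (hρi.const_mul _), integral_const_mul, hρ1, mul_one, sub_self]
  obtain ⟨R, hR⟩ := hθc.isCompact.isBounded.subset_closedBall (0 : ℝ)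
  have hz : ∀ x, |R| < |x| → θ x = 0 := fun x hx => by
    by_contra h'
    have := hR (subset_tsupport θ h')
    rw [mem_closedBall_zero_iff, Real.norm_eq_abs] at this
    exact absurd (this.trans (le_abs_self R)) (not_le.2 hx)
  set a := |R| + 1
  have ha : |R| < a := lt_add_one _
  have ha0 : 0 ≤ |R| := abs_nonneg R
  have hψd : ∀ x, HasDerivAt (fun x => ∫ s in (-a)..x, θ s) (θ x) x := fun x =>
    (hθd.continuous.integral_hasStrictDerivAt _ _).hasDerivAt
  have hψ' : deriv (fun x => ∫ s in (-a)..x, θ s) = θ := funext fun x => (hψd x).deriv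
  -- The primitive of `θ` is the test function needed; it vanishes to the right of `a` because `θ`
  -- has mean zero.
  have hψ : ContDiff ℝ (⊤ : ℕ∞) fun x => ∫ s in (-a)..x, θ s :=
    contDiff_infty_iff_deriv.2 ⟨fun x => (hψd x).differentiableAt, by rw [hψ']; exact hθd⟩
  have hsupp : Function.support θ ⊆ Set.Ioc (-a) a := fun x hx => by
    have : |x| ≤ |R| := by
      by_contra h'
      exact hx (hz x (not_le.1 h'))
    have := abs_le.1 this
    exact ⟨by linarith, by linarith⟩
  have hψc : HasCompactSupport fun x => ∫ s in (-a)..x, θ s := by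
    refine HasCompactSupport.intro (isCompact_Icc (a := -a) (b := a)) fun x hx => ?_
    rw [Set.mem_Icc, not_and_or, not_le, not_le] at hx
    rcases hx with hx | hx
    · refine intervalIntegral.integral_zero_ae (ae_of_all _ fun s hs => hz s ?_)
      rw [Set.uIoc_of_ge hx.le] at hs
      rw [lt_abs]; right; linarith [hs.2]
    · rw [intervalIntegral.integral_eq_integral_of_support_subset
        (hsupp.trans (Set.Ioc_subset_Ioc_right hx.le)), hθ0]
  have h1 := h _ hψ hψc
  rw [hψ'] at h1
  have hηw := hw.integrable_smul_left_of_hasCompactSupport hη.continuous hηc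
  have hρw := hw.integrable_smul_left_of_hasCompactSupport hρ.continuous hρc
  have h2 : (fun x => θ x • w x) = fun x => η x • w x - (∫ y, η y) • (ρ x • w x) := by
    funext x
    simp only [hθ, sub_smul, mul_smul]
  rw [h2, integral_sub hηw (hρw.fun_smul _), integral_smul] at h1
  rw [integral_smul_const]
  exact sub_eq_zero.1 h1

/-- The difference of `u` and a primitive of `g` has weak derivative zero, hence is constant. -/
theorem ae_eq_primitive_of_weakDeriv {u g : ℝ → ℂ} (hu : LocallyIntegrable u volume)
    (hg : LocallyIntegrable g volume)
    (h : ∀ ψ : ℝ → ℝ, ContDiff ℝ (⊤ : ℕ∞) ψ → HasCompactSupport ψ →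
      ∫ x, deriv ψ x • u x = -∫ x, ψ x • g x) :
    ∃ C, u =ᵐ[volume] fun x => C + ∫ s in (0 : ℝ)..x, g s := by
  have hF := (locallyAC_primitive hg 0).continuous.locallyIntegrable (μ := volume)
  obtain ⟨C, hC⟩ := ae_eq_const_of_integral_deriv_smul (hu.sub hF) fun ψ hψ hψc => by
    have hcd := hψ.continuous_deriv (by simp)
    simp only [Pi.sub_apply, smul_sub]
    rw [integral_sub (hu.integrable_smul_left_of_hasCompactSupport hcd hψc.deriv)
      (hF.integrable_smul_left_of_hasCompactSupport hcd hψc.deriv), h ψ hψ hψc,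
      integral_deriv_smul_primitive hg 0 hψ hψc, sub_self]
  refine ⟨C, ?_⟩
  filter_upwards [hC] with x hx
  simp only [Pi.sub_apply, zero_add] at hx
  rw [← hx, sub_add_cancel]

/-! ## `D` as the weak derivative -/

open SchwartzMap in
theorem fourier_derivCLM_apply (ψ : 𝓢(ℝ, ℂ)) (ξ : ℝ) :
    𝓕 (derivCLM ℂ ℂ ψ) ξ = (2 * Real.pi * Complex.I * ξ) * 𝓕 ψ ξ := by
  have h := congrFun (Real.fourier_deriv ψ.integrable ψ.differentiable
    (derivCLM ℂ ℂ ψ).integrable) ξ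
  rw [fourier_coe, fourier_coe]
  rw [show ((derivCLM ℂ ℂ ψ : 𝓢(ℝ, ℂ)) : ℝ → ℂ) = deriv ψ from rfl, h, smul_eq_mul]

open SchwartzMap in
theorem fourierL2_toLp (ψ : 𝓢(ℝ, ℂ)) : fourierL2 (ψ.toLp 2) = (𝓕 ψ).toLp 2 :=
  toLp_fourier_eq ψ

open SchwartzMap in
/-- `D u = w` in the sense of Fourier multipliers if and only if `u' = i w` in the sense of
distributions. -/
theorem opD_eq_iff (u w : L2) :
    (∃ h : u ∈ H1, opD ⟨u, h⟩ = w) ↔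
      ∀ ψ : 𝓢(ℝ, ℂ), ⟪(derivCLM ℂ ℂ ψ).toLp 2, u⟫_ℂ = -Complex.I * ⟪ψ.toLp 2, w⟫_ℂ := by
  have hL : ∀ (ψ : 𝓢(ℝ, ℂ)), ⟪(derivCLM ℂ ℂ ψ).toLp 2, u⟫_ℂ
      = -Complex.I * ∫ ξ, conj (𝓕 ψ ξ) * (((2 * Real.pi * ξ : ℝ) : ℂ) * fourierL2 u ξ) := by
    intro ψ
    rw [← fourierL2.inner_map_map, fourierL2_toLp, L2.inner_def, ← integral_const_mul]
    refine integral_congr_ae ?_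
    filter_upwards [(𝓕 (derivCLM ℂ ℂ ψ)).coeFn_toLp 2] with ξ h1
    rw [h1, fourier_derivCLM_apply, RCLike.inner_apply]
    simp only [map_mul, Complex.conj_I, Complex.conj_ofReal, map_ofNat, Complex.ofReal_mul,
      Complex.ofReal_ofNat]
    ring
  have hR : ∀ (ψ : 𝓢(ℝ, ℂ)), ⟪ψ.toLp 2, w⟫_ℂ = ∫ ξ, conj (𝓕 ψ ξ) * fourierL2 w ξ := by
    intro ψ
    rw [← fourierL2.inner_map_map, fourierL2_toLp, L2.inner_def]
    refine integral_congr_ae ?_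
    filter_upwards [(𝓕 ψ).coeFn_toLp 2] with ξ h1
    rw [h1, RCLike.inner_apply, mul_comm]
  constructor
  · rintro ⟨h, rfl⟩ ψ
    rw [hL, hR]
    congr 1
    refine integral_congr_ae ?_
    filter_upwards [fourierL2_fourierMultiplier _ ⟨u, h⟩] with ξ h1
    change fourierL2 (opD ⟨u, h⟩) ξ = _ at h1
    rw [h1]
  · intro h
    have hae : (fun ξ : ℝ => ((2 * Real.pi * ξ : ℝ) : ℂ) * fourierL2 u ξ) =ᵐ[volume]
        fun ξ => fourierL2 w ξ := by
      have hu : LocallyIntegrable (fun ξ => fourierL2 u ξ) volume :=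
        (Lp.memLp (fourierL2 u)).locallyIntegrable (by norm_num)
      have hw : LocallyIntegrable (fun ξ => fourierL2 w ξ) volume :=
        (Lp.memLp (fourierL2 w)).locallyIntegrable (by norm_num)
      refine ae_eq_of_integral_contDiff_smul_eq ?_ hw fun g hg hgc => ?_
      · exact hu.continuous_mul (by fun_prop)
      · have hgC : ContDiff ℝ (⊤ : ℕ∞) fun x => (g x : ℂ) := Complex.ofRealCLM.contDiff.comp hg
        have hgCc : HasCompactSupport fun x => (g x : ℂ) := hgc.comp_left Complex.ofReal_zero
        set G : 𝓢(ℝ, ℂ) := hgCc.toSchwartzMap hgC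
        -- Testing with an inverse Fourier transform makes the weight on the Fourier side an
        -- arbitrary real test function, so the two symbols can be compared almost everywhere.
        have h1 := h (𝓕⁻ G)
        rw [hL, hR] at h1
        have h2 := mul_left_cancel₀ (neg_ne_zero.2 Complex.I_ne_zero) h1
        have hG : ∀ ξ, conj (𝓕 (𝓕⁻ G) ξ) = (g ξ : ℂ) := fun ξ => by
          rw [FourierTransform.fourier_fourierInv_eq]
          exact Complex.conj_ofReal _
        simp only [hG] at h2
        simpa only [Complex.real_smul] using h2
    have hmem : u ∈ H1 := (memLp_congr_ae hae).2 (Lp.memLp _)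
    refine ⟨hmem, fourierL2.injective (Lp.ext ?_)⟩
    exact (fourierL2_fourierMultiplier _ ⟨u, hmem⟩).trans hae

theorem inner_eq_integral (u v : L2) : ⟪v, u⟫_ℂ = ∫ x, u x * conj (v x) := by
  rw [L2.inner_def]
  exact integral_congr_ae (ae_of_all _ fun x => RCLike.inner_apply _ _)

open SchwartzMap in
/-- Real test functions as elements of `L²(ℝ)`. -/
theorem exists_H1_of_test {ψ : ℝ → ℝ} (hψ : ContDiff ℝ (⊤ : ℕ∞) ψ) (hc : HasCompactSupport ψ) :
    ∃ v : H1, (v : L2) =ᵐ[volume] (fun x => (ψ x : ℂ)) ∧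
      opD v =ᵐ[volume] fun x => -Complex.I * ((deriv ψ x : ℝ) : ℂ) := by
  have hgC : ContDiff ℝ (⊤ : ℕ∞) fun x => (ψ x : ℂ) := Complex.ofRealCLM.contDiff.comp hψ
  have hgCc : HasCompactSupport fun x => (ψ x : ℂ) := hc.comp_left Complex.ofReal_zero
  set G : 𝓢(ℝ, ℂ) := hgCc.toSchwartzMap hgC
  have hG : ∀ x, G x = (ψ x : ℂ) := fun x => rfl
  have hG' : ∀ x, derivCLM ℂ ℂ G x = ((deriv ψ x : ℝ) : ℂ) := fun x => by
    rw [derivCLM_apply]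
    exact ((hψ.differentiable (by simp) x).hasDerivAt.ofReal_comp).deriv
  obtain ⟨h, h'⟩ := (opD_eq_iff (G.toLp 2) (-Complex.I • (derivCLM ℂ ℂ G).toLp 2 volume)).2 fun φ => by
    rw [inner_smul_right, ← mul_assoc, neg_mul_neg, Complex.I_mul_I, neg_one_mul]
    have h := integral_bilinear_deriv_right_eq_neg_left φ G
      ((ContinuousLinearMap.mul ℝ ℂ).comp (Complex.conjCLE : ℂ →L[ℝ] ℂ))
    rw [← neg_eq_iff_eq_neg] at h
    rw [inner_eq_integral, inner_eq_integral]
    calc _ = ∫ x, conj (deriv φ x) * G x := integral_congr_ae (by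
          filter_upwards [(derivCLM ℂ ℂ φ).coeFn_toLp 2 volume, G.coeFn_toLp 2 volume] with x h1 h2
          rw [h1, h2, derivCLM_apply, mul_comm])
      _ = -∫ x, conj (φ x) * deriv G x := h.symm
      _ = _ := congrArg _ (integral_congr_ae (by
          filter_upwards [(derivCLM ℂ ℂ G).coeFn_toLp 2 volume, φ.coeFn_toLp 2 volume] with x h1 h2
          rw [h1, h2, derivCLM_apply, mul_comm]))
  refine ⟨⟨_, h⟩, (G.coeFn_toLp 2).trans (ae_of_all _ hG), ?_⟩
  rw [h']
  filter_upwards [Lp.coeFn_smul (-Complex.I) ((derivCLM ℂ ℂ G).toLp 2),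
    (derivCLM ℂ ℂ G).coeFn_toLp 2] with x h1 h2
  rw [h1, Pi.smul_apply, h2, hG', smul_eq_mul]

theorem locallyIntegrable_L2 (u : L2) : LocallyIntegrable u volume :=
  (Lp.memLp u).locallyIntegrable (by norm_num)

/-- By `opD_eq_iff` the weak derivative of `u` is `i Du`, so `u` is a primitive of it. This passes
from the Fourier description of `H¹` to the classical one. -/
theorem exists_rep (u : H1) : ∃ φ : ℝ → ℂ, (u : L2) =ᵐ[volume] φ ∧ LocallyAC φ ∧
    ∀ᵐ x, HasDerivAt φ (Complex.I * opD u x) x := by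
  have hg : LocallyIntegrable (fun x => Complex.I * opD u x) volume :=
    (locallyIntegrable_L2 (opD u)).continuous_mul continuous_const
  obtain ⟨C, hC⟩ := ae_eq_primitive_of_weakDeriv (locallyIntegrable_L2 (u : L2)) hg
    fun ψ hψ hψc => by
      have hgC : ContDiff ℝ (⊤ : ℕ∞) fun x => (ψ x : ℂ) := Complex.ofRealCLM.contDiff.comp hψ
      have hgCc : HasCompactSupport fun x => (ψ x : ℂ) := hψc.comp_left Complex.ofReal_zero
      have h := (opD_eq_iff (u : L2) (opD u)).1 ⟨u.2, rfl⟩ (hgCc.toSchwartzMap hgC)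
      rw [inner_eq_integral, inner_eq_integral, ← integral_const_mul] at h
      rw [← integral_neg]
      refine Eq.trans (integral_congr_ae ?_) (h.trans (integral_congr_ae ?_))
      · filter_upwards [(SchwartzMap.derivCLM ℂ ℂ (hgCc.toSchwartzMap hgC)).coeFn_toLp 2]
          with x h1
        have h2 := ((hψ.differentiable (by simp) x).hasDerivAt.ofReal_comp).deriv
        rw [h1, SchwartzMap.derivCLM_apply, Complex.real_smul]
        change _ = _ * conj (deriv (fun x => (ψ x : ℂ)) x)
        rw [h2, Complex.conj_ofReal, mul_comm]
      · filter_upwards [(hgCc.toSchwartzMap hgC).coeFn_toLp 2] with x h1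
        rw [h1, Complex.real_smul]
        change _ * (_ * conj (ψ x : ℂ)) = _
        rw [Complex.conj_ofReal]
        ring
  exact ⟨_, hC, locallyAC_primitive hg C, ae_hasDerivAt_primitive hg C⟩

/-! ## Estimates on cells -/

theorem _root_.ENNReal.add_sq_le_two_mul (a b : ℝ≥0∞) : (a + b) ^ 2 ≤ 2 * (a ^ 2 + b ^ 2) := by
  induction a with
  | top => simp
  | coe a =>
    induction b with
    | top => simp
    | coe b => exact_mod_cast add_sq_le (a := a) (b := b)

/-- Cauchy–Schwarz against the constant `1`. -/
theorem sq_lintegral_le {α : Type*} [MeasurableSpace α] (μ : Measure α) {f : α → ℝ≥0∞}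
    (hf : AEMeasurable f μ) : (∫⁻ x, f x ∂μ) ^ 2 ≤ μ Set.univ * ∫⁻ x, f x ^ 2 ∂μ := by
  have h := ENNReal.lintegral_mul_le_Lp_mul_Lq μ (p := 2) (q := 2)
    (by rw [Real.holderConjugate_iff]; norm_num) hf (aemeasurable_const (b := (1 : ℝ≥0∞)))
  simp only [Pi.mul_apply, mul_one, one_pow, lintegral_const, one_mul,
    ENNReal.rpow_ofNat] at h
  calc (∫⁻ x, f x ∂μ) ^ 2
      ≤ ((∫⁻ x, f x ^ 2 ∂μ) ^ (1 / 2 : ℝ) * μ Set.univ ^ (1 / 2 : ℝ)) ^ 2 :=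
        pow_le_pow_left' h 2
    _ = μ Set.univ * ∫⁻ x, f x ^ 2 ∂μ := by
      rw [mul_pow, ← ENNReal.rpow_natCast, ← ENNReal.rpow_natCast, ← ENNReal.rpow_mul,
        ← ENNReal.rpow_mul]
      norm_num
      rw [mul_comm]

theorem LocallyAC.enorm_sub_le {φ : ℝ → ℂ} (hφ : LocallyAC φ) {a b : ℝ} {x y : ℝ}
    (hx : x ∈ Set.Icc a b) (hy : y ∈ Set.Icc a b) :
    ‖φ x - φ y‖ₑ ≤ ∫⁻ s in Set.Ioc a b, ‖deriv φ s‖ₑ := by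
  wlog hxy : y ≤ x generalizing x y
  · rw [← enorm_neg, neg_sub]
    exact this hy hx (not_le.1 hxy).le
  rw [← hφ.integral_deriv, intervalIntegral.integral_of_le hxy]
  exact (enorm_integral_le_lintegral_enorm _).trans
    (lintegral_mono_set (Set.Ioc_subset_Ioc hy.1 hx.2))

theorem LocallyAC.sq_enorm_sub_le {φ : ℝ → ℂ} (hφ : LocallyAC φ) {a b : ℝ} {x y : ℝ}
    (hx : x ∈ Set.Icc a b) (hy : y ∈ Set.Icc a b) :
    ‖φ x - φ y‖ₑ ^ 2 ≤ ENNReal.ofReal (b - a) * ∫⁻ s in Set.Ioc a b, ‖deriv φ s‖ₑ ^ 2 := by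
  refine (pow_le_pow_left' (hφ.enorm_sub_le hx hy) 2).trans ?_
  have h := sq_lintegral_le (volume.restrict (Set.Ioc a b))
    (f := fun s => ‖deriv φ s‖ₑ) (measurable_deriv φ).enorm.aemeasurable
  rwa [Measure.restrict_apply_univ, Real.volume_Ioc] at h

/-- The bound `|φ(x)|² ≤ 2|φ(y)|² + 2∫|φ'|²` is averaged over `y` in a cell of length one. -/
theorem LocallyAC.sq_enorm_le {φ : ℝ → ℂ} (hφ : LocallyAC φ) {a x : ℝ}
    (hx : x ∈ Set.Icc a (a + 1)) :
    ‖φ x‖ₑ ^ 2 ≤ 2 * ∫⁻ s in Set.Ioc a (a + 1), (‖φ s‖ₑ ^ 2 + ‖deriv φ s‖ₑ ^ 2) := by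
  set A := ∫⁻ s in Set.Ioc a (a + 1), ‖deriv φ s‖ₑ ^ 2 with hA
  have hvol : volume (Set.Ioc a (a + 1)) = 1 := by simp
  have h1 : ∀ y ∈ Set.Ioc a (a + 1), ‖φ x‖ₑ ^ 2 ≤ 2 * (‖φ y‖ₑ ^ 2 + A) := by
    intro y hy
    have h2 := hφ.sq_enorm_sub_le hx (Set.Ioc_subset_Icc_self hy)
    rw [add_sub_cancel_left, ENNReal.ofReal_one, one_mul] at h2
    have h3 : ‖φ x‖ₑ ≤ ‖φ y‖ₑ + ‖φ x - φ y‖ₑ := by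
      simpa using enorm_add_le (φ y) (φ x - φ y)
    calc ‖φ x‖ₑ ^ 2 ≤ (‖φ y‖ₑ + ‖φ x - φ y‖ₑ) ^ 2 := pow_le_pow_left' h3 2
      _ ≤ 2 * (‖φ y‖ₑ ^ 2 + ‖φ x - φ y‖ₑ ^ 2) := ENNReal.add_sq_le_two_mul _ _
      _ ≤ _ := by gcongr
  have hm : Measurable fun s => ‖φ s‖ₑ ^ 2 := hφ.continuous.measurable.enorm.pow_const 2
  calc ‖φ x‖ₑ ^ 2 = ∫⁻ _ in Set.Ioc a (a + 1), ‖φ x‖ₑ ^ 2 := by simp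
    _ ≤ ∫⁻ y in Set.Ioc a (a + 1), 2 * (‖φ y‖ₑ ^ 2 + A) :=
      setLIntegral_mono' measurableSet_Ioc h1
    _ = _ := by
      rw [lintegral_const_mul _ (hm.add_const A), lintegral_add_left hm, lintegral_add_left hm]
      simp [hA]

theorem lintegral_eq_tsum_cells (f : ℝ → ℝ≥0∞) :
    ∫⁻ x, f x = ∑' k : ℤ, ∫⁻ x in Set.Ioc (k : ℝ) (k + 1), f x := by
  rw [← lintegral_iUnion (fun _ => measurableSet_Ioc) (Set.pairwise_disjoint_Ioc_intCast ℝ),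
    iUnion_Ioc_intCast, Measure.restrict_univ]

theorem setLIntegral_mul_le_of_forall_le {V : ℝ → ℝ≥0∞} {f : ℝ → ℝ≥0∞} {s : Set ℝ}
    (hs : MeasurableSet s) {M : ℝ≥0∞} (hV : AEMeasurable V volume) (h : ∀ x ∈ s, f x ≤ M) :
    ∫⁻ x in s, V x * f x ≤ (∫⁻ x in s, V x) * M := by
  rw [← lintegral_mul_const'' _ hV.restrict]
  exact setLIntegral_mono' hs fun x hx => mul_le_mul_right (h x hx) _

section Potential

variable {V : ℝ → ℝ}

/-- The decay of `V` enters the argument only through this consequence. -/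
theorem finite_cells_lt (hlim : Tendsto (fun x : ℝ => ∫ s in x..(x + 1), |V s|) (cocompact ℝ) (𝓝 0))
    (hV : LocallyIntegrable V volume) {ε : ℝ≥0∞} (hε : ε ≠ 0) :
    {k : ℤ | ¬ ∫⁻ x in Set.Ioc (k : ℝ) (k + 1), ‖V x‖ₑ ≤ ε}.Finite := by
  have h1 : Tendsto (fun k : ℤ => ENNReal.ofReal (∫ s in (k : ℝ)..(k + 1), |V s|)) cofinite
      (𝓝 0) := by
    have := ENNReal.tendsto_ofReal (hlim.comp Int.tendsto_coe_cofinite)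
    rwa [ENNReal.ofReal_zero] at this
  have h2 : ∀ k : ℤ, ENNReal.ofReal (∫ s in (k : ℝ)..(k + 1), |V s|)
      = ∫⁻ x in Set.Ioc (k : ℝ) (k + 1), ‖V x‖ₑ := fun k => by
    rw [intervalIntegral.integral_of_le (by linarith)]
    exact ofReal_integral_norm_eq_lintegral_enorm
      (intervalIntegrable_of_locallyIntegrable hV k (k + 1)).1
  simp only [h2] at h1
  exact h1.eventually (ge_mem_nhds (pos_iff_ne_zero.2 hε))

theorem lintegral_cell_ne_top (hV : LocallyIntegrable V volume) (k : ℤ) :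
    ∫⁻ x in Set.Ioc (k : ℝ) (k + 1), ‖V x‖ₑ ≠ ⊤ :=
  (intervalIntegrable_of_locallyIntegrable hV k (k + 1)).1.2.ne

theorem exists_bound_cells
    (hlim : Tendsto (fun x : ℝ => ∫ s in x..(x + 1), |V s|) (cocompact ℝ) (𝓝 0))
    (hV : LocallyIntegrable V volume) :
    ∃ C : ℝ≥0∞, C ≠ ⊤ ∧ ∀ k : ℤ, ∫⁻ x in Set.Ioc (k : ℝ) (k + 1), ‖V x‖ₑ ≤ C := by
  have hfin := finite_cells_lt hlim hV one_ne_zero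
  refine ⟨1 + ∑ k ∈ hfin.toFinset, ∫⁻ x in Set.Ioc (k : ℝ) (k + 1), ‖V x‖ₑ, ?_, fun k => ?_⟩
  · exact ENNReal.add_ne_top.2 ⟨ENNReal.one_ne_top,
      ENNReal.sum_ne_top.2 fun k _ => lintegral_cell_ne_top hV k⟩
  · by_cases hk : ∫⁻ x in Set.Ioc (k : ℝ) (k + 1), ‖V x‖ₑ ≤ 1
    · exact hk.trans le_self_add
    · exact (Finset.single_le_sum
        (f := fun k : ℤ => ∫⁻ x in Set.Ioc (k : ℝ) (k + 1), ‖V x‖ₑ) (fun _ _ => zero_le)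
        (hfin.mem_toFinset.2 hk)).trans le_add_self

/-- On each unit cell `|φ|²` is bounded by the local `H¹` norm and `∫|V|` by a uniform constant;
summing over cells shows that the potential energy of an `H¹` function is finite. -/
theorem lintegral_potential_ne_top
    (hlim : Tendsto (fun x : ℝ => ∫ s in x..(x + 1), |V s|) (cocompact ℝ) (𝓝 0))
    (hV : LocallyIntegrable V volume) {φ : ℝ → ℂ} (hφ : LocallyAC φ)
    (h0 : ∫⁻ x, ‖φ x‖ₑ ^ 2 ≠ ⊤) (h1 : ∫⁻ x, ‖deriv φ x‖ₑ ^ 2 ≠ ⊤) :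
    ∫⁻ x, ‖V x‖ₑ * ‖φ x‖ₑ ^ 2 ≠ ⊤ := by
  obtain ⟨C, hC, hle⟩ := exists_bound_cells hlim hV
  have hm : Measurable fun s => ‖φ s‖ₑ ^ 2 := hφ.continuous.measurable.enorm.pow_const 2
  refine ne_top_of_le_ne_top (b := C * (2 * ∫⁻ x, (‖φ x‖ₑ ^ 2 + ‖deriv φ x‖ₑ ^ 2))) ?_ ?_
  · rw [lintegral_add_left hm]
    exact ENNReal.mul_ne_top hC (ENNReal.mul_ne_top ENNReal.ofNat_ne_top
      (ENNReal.add_ne_top.2 ⟨h0, h1⟩))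
  · rw [lintegral_eq_tsum_cells, lintegral_eq_tsum_cells fun x => ‖φ x‖ₑ ^ 2 + _,
      ← ENNReal.tsum_mul_left, ← ENNReal.tsum_mul_left]
    refine ENNReal.tsum_le_tsum fun k => ?_
    refine (setLIntegral_mul_le_of_forall_le measurableSet_Ioc
      hV.aestronglyMeasurable.aemeasurable.enorm fun x hx =>
        hφ.sq_enorm_le (Set.Ioc_subset_Icc_self hx)).trans ?_
    gcongr
    exact hle k

end Potential

/-! ## The continuous representative of an element of `H¹(ℝ)` -/

/-- The locally absolutely continuous representative of `u ∈ H¹(ℝ)`. -/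
def rep (u : H1) : ℝ → ℂ := (exists_rep u).choose

theorem ae_eq_rep (u : H1) : (u : L2) =ᵐ[volume] rep u := (exists_rep u).choose_spec.1

theorem locallyAC_rep (u : H1) : LocallyAC (rep u) := (exists_rep u).choose_spec.2.1

theorem ae_hasDerivAt_rep (u : H1) : ∀ᵐ x, HasDerivAt (rep u) (Complex.I * opD u x) x :=
  (exists_rep u).choose_spec.2.2

theorem ae_deriv_rep (u : H1) : deriv (rep u) =ᵐ[volume] fun x => Complex.I * opD u x :=
  (ae_hasDerivAt_rep u).mono fun _ hx => hx.deriv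

theorem rep_eq_of_ae_eq (u : H1) {φ : ℝ → ℂ} (hφ : Continuous φ) (h : (u : L2) =ᵐ[volume] φ) :
    rep u = φ :=
  (Continuous.ae_eq_iff_eq volume (locallyAC_rep u).continuous hφ).1 ((ae_eq_rep u).symm.trans h)

theorem memLp_rep (u : H1) : MemLp (rep u) 2 volume := (memLp_congr_ae (ae_eq_rep u)).1 (Lp.memLp _)

theorem memLp_deriv_rep (u : H1) : MemLp (deriv (rep u)) 2 volume :=
  (memLp_congr_ae (ae_deriv_rep u)).2 ((Lp.memLp (opD u)).const_mul Complex.I)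

theorem lintegral_sq_enorm_ne_top {f : ℝ → ℂ} (hf : MemLp f 2 volume) : ∫⁻ x, ‖f x‖ₑ ^ 2 ≠ ⊤ := by
  have h := (lintegral_rpow_enorm_lt_top_of_eLpNorm_lt_top two_ne_zero ENNReal.ofNat_ne_top
    hf.2).ne
  simpa using h

theorem integrable_potential_rep {V : ℝ → ℝ}
    (hlim : Tendsto (fun x : ℝ => ∫ s in x..(x + 1), |V s|) (cocompact ℝ) (𝓝 0))
    (hV : LocallyIntegrable V volume) (u v : H1) :
    Integrable fun x => (V x : ℂ) * rep u x * conj (rep v x) := by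
  have hVm : AEStronglyMeasurable (fun x => (V x : ℂ)) volume :=
    Complex.continuous_ofReal.comp_aestronglyMeasurable hV.aestronglyMeasurable
  have hu := (locallyAC_rep u).continuous
  have hv := (locallyAC_rep v).continuous
  refine ⟨(hVm.mul hu.aestronglyMeasurable).mul
    (Complex.continuous_conj.comp hv).aestronglyMeasurable, ?_⟩
  have key : ∀ w : H1, ∫⁻ x, ‖V x‖ₑ * ‖rep w x‖ₑ ^ 2 ≠ ⊤ := fun w =>
    lintegral_potential_ne_top hlim hV (locallyAC_rep w)
      (lintegral_sq_enorm_ne_top (memLp_rep w)) (lintegral_sq_enorm_ne_top (memLp_deriv_rep w))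
  have hm : AEMeasurable (fun x => ‖V x‖ₑ * ‖rep u x‖ₑ ^ 2) volume :=
    hV.aestronglyMeasurable.aemeasurable.enorm.mul (hu.measurable.enorm.pow_const 2).aemeasurable
  refine lt_of_le_of_lt (lintegral_mono fun x => ?_)
    (lintegral_add_left' hm (fun x => ‖V x‖ₑ * ‖rep v x‖ₑ ^ 2) ▸
      ENNReal.add_lt_top.2 ⟨(key u).lt_top, (key v).lt_top⟩)
  rw [← mul_add, enorm_mul, enorm_mul, mul_assoc, RCLike.enorm_conj]
  have h1 : ‖(V x : ℂ)‖ₑ = ‖V x‖ₑ := by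
    rw [← ofReal_norm, ← ofReal_norm, Complex.norm_real]
  rw [h1]
  gcongr
  -- A product is at most the larger of the two squares.
  rcases le_total ‖rep u x‖ₑ ‖rep v x‖ₑ with h | h
  · exact le_add_left (by rw [sq]; gcongr)
  · exact le_add_right (by rw [sq]; gcongr)

theorem potential_ae_eq (V : ℝ → ℝ) (u v : H1) :
    (fun x => (V x : ℂ) * (u : L2) x * conj ((v : L2) x)) =ᵐ[volume]
      fun x => (V x : ℂ) * rep u x * conj (rep v x) := by
  filter_upwards [ae_eq_rep u, ae_eq_rep v] with x h1 h2
  rw [h1, h2]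

/-! ## The form `𝔱_V` and the operator `H_V` -/

theorem LocallyAC.conj {f : ℝ → ℂ} (hf : LocallyAC f) : LocallyAC fun x => conj (f x) :=
  fun a b => (hf a b).comp_of_dist_le fun x y => (Complex.dist_conj_conj x y).le

theorem inner_opD (u v : H1) :
    ⟪opD v, opD u⟫_ℂ = ∫ x, deriv (rep u) x * conj (deriv (rep v) x) := by
  rw [inner_eq_integral]
  refine integral_congr_ae ?_
  filter_upwards [ae_deriv_rep u, ae_deriv_rep v] with x h1 h2
  rw [h1, h2, map_mul, Complex.conj_I]
  linear_combination (opD u x * conj (opD v x)) * Complex.I_mul_I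

theorem formV_eq (c b : ℝ) (V : ℝ → ℝ) (u v : H1) :
    formV c b V u v = (c : ℂ) ^ 2 * (∫ x, deriv (rep u) x * conj (deriv (rep v) x))
      + (b : ℂ) ^ 2 * (∫ x, rep u x * conj (rep v x))
      + ∫ x, (V x : ℂ) * rep u x * conj (rep v x) := by
  rw [formV, inner_opD, inner_eq_integral, integral_congr_ae (potential_ae_eq V u v)]
  congr 3
  refine integral_congr_ae ?_
  filter_upwards [ae_eq_rep u, ae_eq_rep v] with x h1 h2
  rw [h1, h2]

theorem integrable_mul_conj {f g : ℝ → ℂ} (hf : MemLp f 2 volume) (hg : MemLp g 2 volume) :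
    Integrable fun x => f x * conj (g x) :=
  MemLp.integrable_mul hf hg.star

/-- Integrability of `h'` gives limits of `h` at `±∞`, and integrability of `h` forces them to be
zero. It is applied to products, where it is integration by parts without boundary terms. -/
theorem LocallyAC.integral_deriv_eq_zero_of_integrable {h : ℝ → ℂ} (hh : LocallyAC h)
    (hi : Integrable h) (hi' : Integrable (deriv h)) : ∫ x, deriv h x = 0 := by
  have hz : ∀ l : Filter ℝ, (∀ s ∈ l, volume s = ∞) → ∀ a : ℂ, Tendsto h l (𝓝 a) → a = 0 :=
    fun l hl a ha => (hi.integrableAtFilter l).eq_zero_of_tendsto hl ha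
  have htop : Tendsto h atTop (𝓝 (h 0 + ∫ x in Set.Ioi 0, deriv h x)) := by
    have h1 := intervalIntegral_tendsto_integral_Ioi (μ := volume) (f := deriv h) 0
      hi'.integrableOn tendsto_id
    simp only [id, hh.integral_deriv] at h1
    simpa using h1.const_add (h 0)
  have hbot : Tendsto h atBot (𝓝 (h 0 - ∫ x in Set.Iic 0, deriv h x)) := by
    have h1 := intervalIntegral_tendsto_integral_Iic (μ := volume) (f := deriv h) 0
      hi'.integrableOn tendsto_id
    simp only [id, hh.integral_deriv] at h1
    simpa using h1.const_sub (h 0)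
  have h1 := hz _ (fun s hs => by
    obtain ⟨a, ha⟩ := mem_atTop_sets.1 hs
    exact top_le_iff.1 (Real.volume_Ici (a := a) ▸ measure_mono ha)) _ htop
  have h2 := hz _ (fun s hs => by
    obtain ⟨a, ha⟩ := mem_atBot_sets.1 hs
    exact top_le_iff.1 (Real.volume_Iic (a := a) ▸ measure_mono ha)) _ hbot
  rw [← intervalIntegral.integral_Iic_add_Ioi hi'.integrableOn hi'.integrableOn (b := 0)]
  linear_combination h1 - h2

/-- `u ∈ H¹(ℝ)` satisfies `H_V u = f` in terms of its representative. -/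
theorem mem_graphHV_iff (c b : ℝ) (V : ℝ → ℝ) (u : H1) (f : L2) :
    ((u : L2), f) ∈ graphHV c b V ↔ Differentiable ℝ (rep u) ∧ LocallyAC (deriv (rep u)) ∧
      f =ᵐ[volume] fun x => -(c : ℂ) ^ 2 * deriv (deriv (rep u)) x + (b : ℂ) ^ 2 * rep u x
        + (V x : ℂ) * rep u x := by
  constructor
  · rintro ⟨φ, h1, h2, h3, h4⟩
    rw [rep_eq_of_ae_eq u h2.continuous h1]
    exact ⟨h2, h3, h4⟩
  · rintro ⟨h2, h3, h4⟩
    exact ⟨rep u, ae_eq_rep u, h2, h3, h4⟩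

section Form

variable {b c : ℝ} {V : ℝ → ℝ}

/-- Integration by parts over the whole line. Neither `φ''` nor `Vφ` need lie in `L²` separately, so
integrability of `(φ' η̄)'` is obtained only after `φ''` has been eliminated through the equation.
-/
theorem formV_eq_inner
    (hlim : Tendsto (fun x : ℝ => ∫ s in x..(x + 1), |V s|) (cocompact ℝ) (𝓝 0))
    (hV : LocallyIntegrable V volume) (hc : 0 < c) {u : H1} {f : L2}
    (h : ((u : L2), f) ∈ graphHV c b V) (v : H1) : formV c b V u v = ⟪(v : L2), f⟫_ℂ := by
  obtain ⟨h1, h2, h3⟩ := (mem_graphHV_iff c b V u f).1 h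
  have hc0 : (c : ℂ) ≠ 0 := by exact_mod_cast hc.ne'
  set φ := rep u with hφ
  set η := rep v with hη
  have i1 : Integrable fun x => deriv φ x * conj (deriv η x) :=
    integrable_mul_conj (memLp_deriv_rep u) (memLp_deriv_rep v)
  have i2 : Integrable fun x => φ x * conj (η x) := integrable_mul_conj (memLp_rep u) (memLp_rep v)
  have i3 : Integrable fun x => (V x : ℂ) * φ x * conj (η x) := integrable_potential_rep hlim hV u v
  have i4 : Integrable fun x => f x * conj (η x) := integrable_mul_conj (Lp.memLp f) (memLp_rep v)
  have hprod : LocallyAC fun x => deriv φ x * conj (η x) := h2.mul (locallyAC_rep v).conj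
  have hpi : Integrable fun x => deriv φ x * conj (η x) :=
    integrable_mul_conj (memLp_deriv_rep u) (memLp_rep v)
  have hder : ∀ᵐ x, deriv (fun x => deriv φ x * conj (η x)) x
      = deriv φ x * conj (deriv η x) + (c : ℂ)⁻¹ ^ 2 * ((b : ℂ) ^ 2 * (φ x * conj (η x))
        + (V x : ℂ) * φ x * conj (η x) - f x * conj (η x)) := by
    filter_upwards [h3, h2.ae_differentiableAt, (locallyAC_rep v).ae_differentiableAt]
      with x a1 a2 a3
    have := (a2.hasDerivAt.fun_mul (a3.hasDerivAt.star)).deriv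
    refine this.trans ?_
    rw [a1]
    simp only [starRingEnd_apply]
    field_simp
    ring
  have i5 : Integrable fun x => (b : ℂ) ^ 2 * (φ x * conj (η x)) + (V x : ℂ) * φ x * conj (η x)
      - f x * conj (η x) := ((i2.const_mul _).add i3).sub i4
  have hdi : Integrable (deriv fun x => deriv φ x * conj (η x)) :=
    (i1.add (i5.const_mul _)).congr
      (hder.mono fun x hx => hx.symm)
  have h0 := hprod.integral_deriv_eq_zero_of_integrable hpi hdi
  rw [integral_congr_ae hder, integral_add i1 (i5.const_mul _),
    integral_const_mul, integral_sub ((i2.const_mul _).fun_add i3) i4,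
    integral_add (i2.const_mul _) i3, integral_const_mul] at h0
  have h5 : ⟪(v : L2), f⟫_ℂ = ∫ x, f x * conj (η x) := by
    rw [inner_eq_integral]
    refine integral_congr_ae ?_
    filter_upwards [ae_eq_rep v] with x hx
    rw [hx]
  rw [formV_eq, h5, ← hφ, ← hη]
  field_simp at h0
  linear_combination h0

/-- Elliptic regularity in one dimension: tested on smooth compactly supported `v`, the form
identity states that `φ'` has a locally integrable weak derivative, namely the second derivative
prescribed by the equation. -/
theorem mem_graphHV_of_formV (hV : LocallyIntegrable V volume) (hc : 0 < c) {u : H1} {f : L2}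
    (h : ∀ v : H1, formV c b V u v = ⟪(v : L2), f⟫_ℂ)
    (hlim : Tendsto (fun x : ℝ => ∫ s in x..(x + 1), |V s|) (cocompact ℝ) (𝓝 0)) :
    ((u : L2), f) ∈ graphHV c b V := by
  have hc0 : (c : ℂ) ≠ 0 := by exact_mod_cast hc.ne'
  set φ := rep u with hφ
  have hφc : Continuous φ := (locallyAC_rep u).continuous
  have hVC : LocallyIntegrable (fun x => (V x : ℂ)) volume := fun x => by
    obtain ⟨s, hs, hi⟩ := hV x
    exact ⟨s, hs, hi.ofReal⟩
  have l1 : LocallyIntegrable (fun x => (V x : ℂ) * φ x) volume := hVC.mul_continuous hφc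
  have l2 : LocallyIntegrable (fun x => (b : ℂ) ^ 2 * φ x) volume :=
    (continuous_const.mul hφc).locallyIntegrable
  have l3 : LocallyIntegrable (fun x => (b : ℂ) ^ 2 * φ x + (V x : ℂ) * φ x - f x) volume :=
    (l2.add l1).sub (locallyIntegrable_L2 f)
  set g : ℝ → ℂ := fun x => (c : ℂ)⁻¹ ^ 2 * ((b : ℂ) ^ 2 * φ x + (V x : ℂ) * φ x - f x) with hg
  have hgl : LocallyIntegrable g volume := l3.continuous_mul continuous_const
  have hG : LocallyIntegrable (deriv φ) volume := (locallyAC_rep u).locallyIntegrable_deriv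
  obtain ⟨C, hC⟩ := ae_eq_primitive_of_weakDeriv hG hgl fun ψ hψ hψc => by
    obtain ⟨v, hv1, hv2⟩ := exists_H1_of_test hψ hψc
    have hψC : Continuous fun x => (ψ x : ℂ) := Complex.continuous_ofReal.comp hψ.continuous
    have hrep : rep v = fun x => (ψ x : ℂ) := rep_eq_of_ae_eq v hψC hv1
    have hrep' : ∀ x, deriv (rep v) x = ((deriv ψ x : ℝ) : ℂ) := fun x => by
      rw [hrep]
      exact ((hψ.differentiable (by simp) x).hasDerivAt.ofReal_comp).deriv
    have h1 := h v
    have h5 : ⟪(v : L2), f⟫_ℂ = ∫ x, f x * conj (rep v x) := by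
      rw [inner_eq_integral]
      refine integral_congr_ae ?_
      filter_upwards [ae_eq_rep v] with x hx
      rw [hx]
    have i2 := integrable_mul_conj (memLp_rep u) (memLp_rep v)
    have i3 := integrable_potential_rep hlim hV u v
    have i4 := integrable_mul_conj (Lp.memLp f) (memLp_rep v)
    rw [formV_eq, h5] at h1
    have e1 : ∫ x, deriv ψ x • deriv φ x = ∫ x, deriv φ x * conj (deriv (rep v) x) :=
      integral_congr_ae (ae_of_all _ fun x => by
        simp only [hrep', Complex.conj_ofReal, Complex.real_smul, mul_comm])
    have e2 : ∫ x, ψ x • g x = (c : ℂ)⁻¹ ^ 2 * ((b : ℂ) ^ 2 * (∫ x, φ x * conj (rep v x))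
        + (∫ x, (V x : ℂ) * φ x * conj (rep v x)) - ∫ x, f x * conj (rep v x)) := by
      rw [← integral_const_mul, ← integral_add (i2.const_mul _) i3,
        ← integral_sub ((i2.const_mul _).fun_add i3) i4, ← integral_const_mul]
      refine integral_congr_ae (ae_of_all _ fun x => ?_)
      simp only [hg, hrep, Complex.conj_ofReal, Complex.real_smul]
      ring
    rw [e1, e2]
    field_simp
    linear_combination h1
  have hP := locallyAC_primitive hgl C
  set P : ℝ → ℂ := fun x => C + ∫ s in (0 : ℝ)..x, g s with hPdef
  -- So far `φ' = P` only almost everywhere. Since `φ` is the integral of its derivative and `P` is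
  -- continuous, the equality holds everywhere.
  have hφP : ∀ x, HasDerivAt φ (P x) x := by
    have h2 : φ = fun x => φ 0 + ∫ s in (0 : ℝ)..x, P s := by
      funext x
      rw [← intervalIntegral.integral_congr_ae (hC.mono fun x hx _ => hx),
        (locallyAC_rep u).integral_deriv]
      simp [hφ]
    intro x
    rw [h2]
    exact ((hP.continuous.integral_hasStrictDerivAt 0 x).hasDerivAt).const_add _
  have hd : deriv φ = P := funext fun x => (hφP x).deriv
  refine (mem_graphHV_iff c b V u f).2 ⟨fun x => (hφP x).differentiableAt, ?_, ?_⟩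
  · rw [← hφ, hd]; exact hP
  · rw [← hφ, hd]
    filter_upwards [ae_hasDerivAt_primitive hgl C] with x hx
    rw [hx.deriv, hg]
    field_simp
    ring

end Form

/-! ## Positivity of the form on a subspace of finite codimension -/

theorem rep_add (u v : H1) : rep (u + v) = rep u + rep v :=
  rep_eq_of_ae_eq _ ((locallyAC_rep u).continuous.add (locallyAC_rep v).continuous)
    ((Lp.coeFn_add (u : L2) (v : L2)).trans ((ae_eq_rep u).add (ae_eq_rep v)))

theorem rep_smul (a : ℂ) (u : H1) : rep (a • u) = a • rep u :=
  rep_eq_of_ae_eq _ ((locallyAC_rep u).continuous.const_smul a)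
    ((Lp.coeFn_smul a (u : L2)).trans ((ae_eq_rep u).const_smul a))

theorem eq_zero_of_rep_eq_zero {u : H1} (h : rep u = 0) : u = 0 := by
  refine Subtype.ext ((Lp.eq_zero_iff_ae_eq_zero).2 ?_)
  rw [← h]
  exact ae_eq_rep u

/-- Evaluation of the continuous representative on a finite set of points. -/
def evalOn (P : Finset ℝ) : H1 →ₗ[ℂ] (P → ℂ) where
  toFun u p := rep u p
  map_add' u v := by rw [rep_add]; rfl
  map_smul' a u := by rw [rep_smul]; rfl

section Potential

variable {V : ℝ → ℝ}

/-- On all but finitely many cells `∫|V|` is small and the plain Sobolev bound suffices. On the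
exceptional cells smallness comes from `φ`: vanishing on a grid of mesh `1/M` forces `|φ|² ≤ (1/M)
∫|φ'|²`. Finitely many linear conditions thus make the potential a small perturbation. -/
theorem exists_finset_lintegral_potential_le
    (hlim : Tendsto (fun x : ℝ => ∫ s in x..(x + 1), |V s|) (cocompact ℝ) (𝓝 0))
    (hV : LocallyIntegrable V volume) {δ : ℝ≥0∞} (hδ : δ ≠ 0) :
    ∃ P : Finset ℝ, ∀ φ : ℝ → ℂ, LocallyAC φ → (∀ p ∈ P, φ p = 0) →
      ∫⁻ x, ‖V x‖ₑ * ‖φ x‖ₑ ^ 2 ≤ δ * ∫⁻ x, (‖φ x‖ₑ ^ 2 + ‖deriv φ x‖ₑ ^ 2) := by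
  classical
  have hδ2 : δ / 2 ≠ 0 := ENNReal.div_ne_zero.2 ⟨hδ, ENNReal.ofNat_ne_top⟩
  have hfin := finite_cells_lt hlim hV hδ2
  obtain ⟨C, hC, hle⟩ := exists_bound_cells hlim hV
  -- The mesh is chosen so that `C/M ≤ δ`, with `C` the uniform bound of `∫|V|` over cells.
  obtain ⟨M, hM⟩ := ENNReal.exists_nat_gt (ENNReal.div_ne_top hC hδ)
  have hM0 : 0 < M := by
    rcases Nat.eq_zero_or_pos M with h | h
    · subst h; simp at hM
    · exact h
  have hMr : (0 : ℝ) < M := Nat.cast_pos.2 hM0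
  have hCM : C * ENNReal.ofReal (1 / M) ≤ δ := by
    rw [one_div, ENNReal.ofReal_inv_of_pos hMr, ENNReal.ofReal_natCast, ← div_eq_mul_inv]
    refine ENNReal.div_le_of_le_mul ?_
    by_cases hδt : δ = ⊤
    · rw [hδt, ENNReal.top_mul (by exact_mod_cast hM0.ne')]; exact le_top
    · exact (mul_comm δ _).symm ▸ (ENNReal.div_le_iff_le_mul (Or.inl hδ) (Or.inl hδt)).1 hM.le
  refine ⟨(hfin.toFinset ×ˢ Finset.range (M + 1)).image fun q => (q.1 : ℝ) + q.2 / M,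
    fun φ hφ hP => ?_⟩
  rw [lintegral_eq_tsum_cells, lintegral_eq_tsum_cells fun x => ‖φ x‖ₑ ^ 2 + _,
    ← ENNReal.tsum_mul_left]
  refine ENNReal.tsum_le_tsum fun k => ?_
  by_cases hk : ∫⁻ x in Set.Ioc (k : ℝ) (k + 1), ‖V x‖ₑ ≤ δ / 2
  -- The threshold `δ/2` absorbs the factor `2` in `sq_enorm_le`.
  · refine (setLIntegral_mul_le_of_forall_le measurableSet_Ioc
      hV.aestronglyMeasurable.aemeasurable.enorm fun x hx =>
        hφ.sq_enorm_le (Set.Ioc_subset_Icc_self hx)).trans ?_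
    rw [← mul_assoc]
    gcongr
    calc _ ≤ δ / 2 * 2 := by gcongr
      _ = δ := ENNReal.div_mul_cancel two_ne_zero ENNReal.ofNat_ne_top
  · have hbound : ∀ x ∈ Set.Ioc (k : ℝ) (k + 1), ‖φ x‖ₑ ^ 2 ≤ ENNReal.ofReal (1 / M) *
        ∫⁻ s in Set.Ioc (k : ℝ) (k + 1), (‖φ s‖ₑ ^ 2 + ‖deriv φ s‖ₑ ^ 2) := by
      intro x hx
      have hx0 : 0 < (x - k) * M := mul_pos (by linarith [hx.1]) hMr
      -- The subinterval containing `x` ends at `k + n/M`, a point where `φ` vanishes. The value `n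
      -- = M` occurs, hence `range (M + 1)` in the choice of the grid.
      set n := ⌈(x - k) * M⌉₊ with hn
      have hn1 : (x - k) * M ≤ n := Nat.le_ceil _
      have hn2 : (n : ℝ) < (x - k) * M + 1 := Nat.ceil_lt_add_one hx0.le
      have hn3 : n ≤ M := Nat.ceil_le.2 (by nlinarith [hx.2])
      have hn4 : 1 ≤ n := Nat.ceil_pos.2 hx0
      have hn3' : (n : ℝ) ≤ M := Nat.cast_le.2 hn3
      have hn4' : (1 : ℝ) ≤ n := by exact_mod_cast hn4
      have hq : φ ((k : ℝ) + n / M) = 0 := hP _ (Finset.mem_image.2 ⟨(k, n),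
        Finset.mem_product.2 ⟨hfin.mem_toFinset.2 hk, Finset.mem_range.2 (by omega)⟩, rfl⟩)
      have h1 : x ∈ Set.Icc ((k : ℝ) + (n - 1) / M) (k + n / M) := by
        constructor
        · have : (n - 1 : ℝ) / M ≤ x - k := (div_le_iff₀ hMr).2 (by linarith)
          linarith
        · have : x - k ≤ n / M := (le_div_iff₀ hMr).2 hn1
          linarith
      have h2 := hφ.sq_enorm_sub_le h1 (Set.right_mem_Icc.2 (h1.1.trans h1.2))
      rw [hq, sub_zero, show (k : ℝ) + n / M - (k + (n - 1) / M) = 1 / M by ring] at h2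
      refine h2.trans ?_
      refine mul_le_mul_right ?_ _
      refine (lintegral_mono_set (Set.Ioc_subset_Ioc ?_ ?_)).trans
        (lintegral_mono fun s => le_add_self)
      · have : 0 ≤ (n - 1 : ℝ) / M := div_nonneg (by linarith) hMr.le
        linarith
      · have : (n : ℝ) / M ≤ 1 := (div_le_one hMr).2 hn3'
        linarith
    refine (setLIntegral_mul_le_of_forall_le measurableSet_Ioc
      hV.aestronglyMeasurable.aemeasurable.enorm hbound).trans ?_
    rw [← mul_assoc]
    gcongr
    exact (mul_le_mul_left (hle k) _).trans hCM

theorem lintegral_sq_enorm (u : L2) : ∫⁻ x, ‖u x‖ₑ ^ 2 = ENNReal.ofReal (‖u‖ ^ 2) := by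
  have h := eLpNorm_nnreal_pow_eq_lintegral (f := u) (μ := (volume : Measure ℝ)) (p := 2) two_ne_zero
  rw [Lp.norm_def, ← ENNReal.toReal_pow, ENNReal.ofReal_toReal
    (ENNReal.pow_ne_top (Lp.eLpNorm_ne_top u))]
  simpa using h.symm

theorem lintegral_rep (u : H1) : ∫⁻ x, (‖rep u x‖ₑ ^ 2 + ‖deriv (rep u) x‖ₑ ^ 2)
    = ENNReal.ofReal (‖(u : L2)‖ ^ 2 + ‖opD u‖ ^ 2) := by
  rw [ENNReal.ofReal_add (by positivity) (by positivity), ← lintegral_sq_enorm,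
    ← lintegral_sq_enorm, ← lintegral_add_left'
      ((Lp.aestronglyMeasurable (u : L2)).aemeasurable.enorm.pow_const 2)]
  refine lintegral_congr_ae ?_
  filter_upwards [ae_eq_rep u, ae_deriv_rep u] with x h1 h2
  rw [h1, h2, enorm_mul, show ‖Complex.I‖ₑ = 1 by rw [← ofReal_norm]; simp, one_mul]

/-- The potential is at most `δ(‖u‖² + ‖Du‖²)` with `2δ = min(b², c²)`, so at least `δ(‖u‖² +
‖Du‖²)` is left over. -/
theorem exists_finset_formV_pos {b c : ℝ} (hb : 0 < b) (hc : 0 < c)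
    (hlim : Tendsto (fun x : ℝ => ∫ s in x..(x + 1), |V s|) (cocompact ℝ) (𝓝 0))
    (hV : LocallyIntegrable V volume) :
    ∃ P : Finset ℝ, ∀ u : H1, evalOn P u = 0 → u ≠ 0 → 0 < (formV c b V u u).re := by
  set δ : ℝ := min (b ^ 2) (c ^ 2) / 2 with hδ
  have hδ0 : 0 < δ := by positivity
  have hδb : 2 * δ ≤ b ^ 2 := by rw [hδ]; linarith [min_le_left (b ^ 2) (c ^ 2)]
  have hδc : 2 * δ ≤ c ^ 2 := by rw [hδ]; linarith [min_le_right (b ^ 2) (c ^ 2)]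
  obtain ⟨P, hP⟩ := exists_finset_lintegral_potential_le hlim hV (δ := ENNReal.ofReal δ)
    (by simpa using hδ0)
  refine ⟨P, fun u hu hu0 => ?_⟩
  have h1 := hP (rep u) (locallyAC_rep u) fun p hp => congrFun hu ⟨p, hp⟩
  rw [lintegral_rep, ← ENNReal.ofReal_mul hδ0.le] at h1
  have h2 : ‖∫ x, (V x : ℂ) * (u : L2) x * conj ((u : L2) x)‖
      ≤ δ * (‖(u : L2)‖ ^ 2 + ‖opD u‖ ^ 2) := by
    rw [integral_congr_ae (potential_ae_eq V u u)]
    refine (norm_integral_le_lintegral_norm _).trans (ENNReal.toReal_le_of_le_ofReal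
      (by positivity) (le_trans (le_of_eq (lintegral_congr fun x => ?_)) h1))
    rw [ofReal_norm, enorm_mul, enorm_mul, RCLike.enorm_conj, mul_assoc, sq]
    congr 1
    rw [← ofReal_norm, ← ofReal_norm, Complex.norm_real]
  have h3 := (abs_le.1 ((Complex.abs_re_le_norm _).trans h2)).1
  have h4 : 0 < ‖(u : L2)‖ := norm_pos_iff.2 fun h => hu0 (Subtype.ext h)
  have h5 : (formV c b V u u).re = c ^ 2 * ‖opD u‖ ^ 2 + b ^ 2 * ‖(u : L2)‖ ^ 2
      + (∫ x, (V x : ℂ) * (u : L2) x * conj ((u : L2) x)).re := by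
    rw [formV, inner_self_eq_norm_sq_to_K, inner_self_eq_norm_sq_to_K, Complex.add_re,
      Complex.add_re]
    congr 2
    · norm_cast
      rw [Complex.re_ofReal_mul]
      rfl
    · norm_cast
      rw [Complex.re_ofReal_mul]
      rfl
  rw [h5]
  have h6 : 0 ≤ ‖opD u‖ ^ 2 := by positivity
  have h7 : 0 < ‖(u : L2)‖ ^ 2 := by positivity
  nlinarith [mul_le_mul_of_nonneg_right hδc h6, mul_le_mul_of_nonneg_right hδb h7.le,
    mul_pos hδ0 h7, mul_nonneg hδ0.le h6]

/-- Evaluation at the points of `P` is injective on a non-positive subspace. -/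
theorem exists_finrank_le_of_formV_nonpos {b c : ℝ} (hb : 0 < b) (hc : 0 < c)
    (hlim : Tendsto (fun x : ℝ => ∫ s in x..(x + 1), |V s|) (cocompact ℝ) (𝓝 0))
    (hV : LocallyIntegrable V volume) :
    ∃ κ : ℕ, ∀ W : Submodule ℂ H1, (∀ u ∈ W, (formV c b V u u).re ≤ 0) →
      Module.finrank ℂ W ≤ κ := by
  obtain ⟨P, hP⟩ := exists_finset_formV_pos hb hc hlim hV
  refine ⟨P.card, fun W hW => ?_⟩
  have hinj : Function.Injective (evalOn P ∘ₗ W.subtype) := by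
    refine (injective_iff_map_eq_zero _).2 fun u hu => ?_
    by_contra hne
    exact absurd (hP u hu fun h => hne (Subtype.ext h)) (not_lt.2 (hW u u.2))
  have := LinearMap.finrank_le_finrank_of_injective hinj
  rwa [Module.finrank_fintype_fun_eq_card, Fintype.card_coe] at this

end Potential

/-! ## Uniqueness for the differential equation -/

/-- The zero set of `m = |φ| + |φ'|` is closed and contains `0`; it is shown to be open. Near a zero
of `m` the maximum of `m` over a short interval is at most half of itself. -/
theorem eq_zero_of_second_order_bound {φ : ℝ → ℂ} (hφ : LocallyAC φ) (hφ' : LocallyAC (deriv φ))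
    {K : ℝ → ℝ} (hK : LocallyIntegrable K volume)
    (h : ∀ᵐ x, ‖deriv (deriv φ) x‖ₑ ≤ ‖K x‖ₑ * (‖φ x‖ₑ + ‖deriv φ x‖ₑ))
    (h0 : φ 0 = 0) (h0' : deriv φ 0 = 0) : φ = 0 := by
  set m : ℝ → ℝ := fun x => ‖φ x‖ + ‖deriv φ x‖ with hm
  have hmc : Continuous m := hφ.continuous.norm.add hφ'.continuous.norm
  have hm0 : ∀ x, 0 ≤ m x := fun x => by positivity
  have hme : ∀ x, ENNReal.ofReal (m x) = ‖φ x‖ₑ + ‖deriv φ x‖ₑ := fun x => by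
    rw [hm, ENNReal.ofReal_add (norm_nonneg _) (norm_nonneg _), ofReal_norm, ofReal_norm]
  -- The `1` accounts for the increment of `φ`, the `|K|` for that of `φ'`.
  set k : ℝ → ℝ := fun x => 1 + |K x| with hk
  have hki : LocallyIntegrable k volume := (locallyIntegrable_const 1).add fun x => (hK x).norm
  have hke : ∀ x, ENNReal.ofReal (k x) = 1 + ‖K x‖ₑ := fun x => by
    rw [hk, ENNReal.ofReal_add zero_le_one (abs_nonneg _), ENNReal.ofReal_one, ← Real.norm_eq_abs,
      ofReal_norm]
  have hopen : IsOpen {x | m x = 0} := by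
    refine isOpen_iff_mem_nhds.2 fun x₀ hx₀ => ?_
    have hx₀' : ‖φ x₀‖ₑ + ‖deriv φ x₀‖ₑ = 0 := by
      rw [← hme, show m x₀ = 0 from hx₀, ENNReal.ofReal_zero]
    obtain ⟨hz, hz'⟩ := add_eq_zero.1 hx₀'
    rw [enorm_eq_zero] at hz hz'
    have hF : Continuous fun x => ∫ s in (0 : ℝ)..x, k s :=
      intervalIntegral.continuous_primitive (intervalIntegrable_of_locallyIntegrable hki) 0
    have hlim : Tendsto (fun r : ℝ => (∫ s in (0 : ℝ)..(x₀ + r), k s)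
        - ∫ s in (0 : ℝ)..(x₀ - r), k s) (𝓝[>] 0) (𝓝 0) := by
      have : Continuous fun r : ℝ => (∫ s in (0 : ℝ)..(x₀ + r), k s)
        - ∫ s in (0 : ℝ)..(x₀ - r), k s := by
        exact (hF.comp (continuous_const.add continuous_id)).sub
          (hF.comp (continuous_const.sub continuous_id))
      have h1 := this.tendsto 0
      simp only [add_zero, sub_zero, sub_self] at h1
      exact h1.mono_left nhdsWithin_le_nhds
    -- The radius is so small that `k` has integral below `1/2` over the interval; this is the
    -- contraction factor.
    obtain ⟨r, hr, hr0⟩ := ((hlim.eventually (gt_mem_nhds (show (0 : ℝ) < 1 / 2 by norm_num))).and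
      self_mem_nhdsWithin).exists
    have hr0 : 0 < r := hr0
    have hII := intervalIntegrable_of_locallyIntegrable hki
    rw [intervalIntegral.integral_interval_sub_left (hII _ _) (hII _ _)] at hr
    obtain ⟨x₁, hx₁, hmax⟩ := (isCompact_Icc (a := x₀ - r) (b := x₀ + r)).exists_isMaxOn
      ⟨x₀, by constructor <;> linarith⟩ hmc.continuousOn
    have hxI : x₀ ∈ Set.Icc (x₀ - r) (x₀ + r) := by constructor <;> linarith
    have e1 := hφ.enorm_sub_le hx₁ hxI
    have e2 := hφ'.enorm_sub_le hx₁ hxI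
    rw [hz, sub_zero] at e1
    rw [hz', sub_zero] at e2
    have hint : ∫⁻ s in Set.Ioc (x₀ - r) (x₀ + r), ENNReal.ofReal (k s)
        = ENNReal.ofReal (∫ s in (x₀ - r)..(x₀ + r), k s) := by
      rw [intervalIntegral.integral_of_le (by linarith),
        ofReal_integral_eq_lintegral_ofReal (hII _ _).1 (ae_of_all _ fun x => by
          simp only [hk, Pi.zero_apply]; positivity)]
    have e3 : ENNReal.ofReal (m x₁) ≤ ENNReal.ofReal (1 / 2 * m x₁) := by
      calc ENNReal.ofReal (m x₁) = ‖φ x₁‖ₑ + ‖deriv φ x₁‖ₑ := hme x₁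
        _ ≤ (∫⁻ s in Set.Ioc (x₀ - r) (x₀ + r), ‖deriv φ s‖ₑ)
            + ∫⁻ s in Set.Ioc (x₀ - r) (x₀ + r), ‖deriv (deriv φ) s‖ₑ := add_le_add e1 e2
        _ = ∫⁻ s in Set.Ioc (x₀ - r) (x₀ + r), (‖deriv φ s‖ₑ + ‖deriv (deriv φ) s‖ₑ) :=
          (lintegral_add_left hφ'.continuous.measurable.enorm _).symm
        _ ≤ ∫⁻ s in Set.Ioc (x₀ - r) (x₀ + r), ENNReal.ofReal (k s) * ENNReal.ofReal (m x₁) := by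
          refine lintegral_mono_ae ?_
          filter_upwards [ae_restrict_of_ae h, ae_restrict_mem measurableSet_Ioc] with s hs hsI
          have hms : ENNReal.ofReal (m s) ≤ ENNReal.ofReal (m x₁) :=
            ENNReal.ofReal_le_ofReal (hmax (Set.Ioc_subset_Icc_self hsI))
          calc _ ≤ (‖φ s‖ₑ + ‖deriv φ s‖ₑ) + ‖K s‖ₑ * (‖φ s‖ₑ + ‖deriv φ s‖ₑ) :=
              add_le_add le_add_self hs
            _ = ENNReal.ofReal (k s) * ENNReal.ofReal (m s) := by rw [hke, hme, add_mul, one_mul]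
            _ ≤ _ := by gcongr
        _ = ENNReal.ofReal (∫ s in (x₀ - r)..(x₀ + r), k s) * ENNReal.ofReal (m x₁) := by
          rw [lintegral_mul_const' _ _ ENNReal.ofReal_ne_top, hint]
        _ ≤ ENNReal.ofReal (1 / 2) * ENNReal.ofReal (m x₁) := by
          gcongr
        _ = _ := (ENNReal.ofReal_mul (by norm_num)).symm
    have e4 : m x₁ ≤ 1 / 2 * m x₁ := (ENNReal.ofReal_le_ofReal_iff
      (mul_nonneg (by norm_num) (hm0 _))).1 e3
    refine mem_of_superset (Icc_mem_nhds (a := x₀ - r) (b := x₀ + r) (by linarith) (by linarith))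
      fun x hx => ?_
    have : m x ≤ m x₁ := hmax hx
    exact le_antisymm (by linarith) (hm0 x)
  have hclopen : IsClopen {x | m x = 0} := ⟨isClosed_eq hmc continuous_const, hopen⟩
  have huniv := hclopen.eq_univ ⟨0, by simp [hm, h0, h0']⟩
  funext x
  have hx : m x = 0 := by
    have : x ∈ {x | m x = 0} := huniv ▸ Set.mem_univ x
    exact this
  have := norm_nonneg (deriv φ x)
  have h1 : ‖φ x‖ = 0 := le_antisymm (by simp only [hm] at hx; linarith) (norm_nonneg _)
  exact norm_eq_zero.1 h1

/-- The solutions in `H¹(ℝ)` of `H_V u = z D u`. -/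
def eigSolutions (c b : ℝ) (V : ℝ → ℝ) (z : ℂ) : Submodule ℂ H1 :=
  (graphHV c b V).comap (H1.subtype.prod (z • opD.toFun))

/-- A solution is determined by its initial data `(φ(0), φ'(0)) ∈ ℂ²`. -/
theorem finiteDimensional_eigSolutions {c b : ℝ} (hc : 0 < c) {V : ℝ → ℝ}
    (hV : LocallyIntegrable V volume) (z : ℂ) : FiniteDimensional ℂ (eigSolutions c b V z) := by
  have hc0 : (c : ℂ) ≠ 0 := by exact_mod_cast hc.ne'
  have hs : ∀ u : eigSolutions c b V z, Differentiable ℝ (rep u) := fun u =>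
    ((mem_graphHV_iff c b V u _).1 u.2).1
  let F : eigSolutions c b V z →ₗ[ℂ] ℂ × ℂ :=
    { toFun := fun u => (rep u 0, deriv (rep u) 0)
      map_add' := fun u v => by
        rw [Submodule.coe_add, rep_add, deriv_add (hs u 0) (hs v 0)]; rfl
      map_smul' := fun a u => by
        rw [Submodule.coe_smul, rep_smul, deriv_const_smul a (hs u 0)]; rfl }
  refine FiniteDimensional.of_injective F ((injective_iff_map_eq_zero F).2 fun u hu => ?_)
  obtain ⟨h1, h2, h3⟩ := (mem_graphHV_iff c b V u _).1 u.2
  refine Subtype.ext (eq_zero_of_rep_eq_zero ?_)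
  refine eq_zero_of_second_order_bound (locallyAC_rep u) h2
    (K := fun x => c⁻¹ ^ 2 * (b ^ 2 + |V x| + ‖z‖)) ?_ ?_ (congrArg Prod.fst hu)
    (congrArg Prod.snd hu)
  · exact (((locallyIntegrable_const (b ^ 2)).add fun x => (hV x).norm).add
      (locallyIntegrable_const ‖z‖)).continuous_mul continuous_const
  · filter_upwards [h3, ae_deriv_rep (u : H1), Lp.coeFn_smul z (opD (u : H1))] with x a1 a2 a3
    have e : deriv (deriv (rep u)) x = (c : ℂ)⁻¹ ^ 2 * (((b : ℂ) ^ 2 + V x) * rep u x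
        + z * Complex.I * deriv (rep u) x) := by
      have a4 : z * Complex.I * deriv (rep u) x = -(z • opD (u : H1) : L2) x := by
        rw [a3, a2, Pi.smul_apply, smul_eq_mul]
        linear_combination (z * opD (u : H1) x) * Complex.I_mul_I
      rw [a4, show (z • opD (u : H1) : L2) x = _ from a1]
      field_simp
      ring
    have hn : ‖deriv (deriv (rep u)) x‖
        ≤ c⁻¹ ^ 2 * (b ^ 2 + |V x| + ‖z‖) * (‖rep u x‖ + ‖deriv (rep u) x‖) := by
      rw [e, norm_mul, norm_pow, norm_inv, Complex.norm_real, Real.norm_of_nonneg hc.le,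
        mul_assoc (c⁻¹ ^ 2)]
      refine mul_le_mul_of_nonneg_left ((norm_add_le _ _).trans ?_) (by positivity)
      rw [norm_mul, norm_mul, norm_mul, Complex.norm_I, mul_one]
      have hbV : ‖(b : ℂ) ^ 2 + V x‖ ≤ b ^ 2 + |V x| := by
        refine (norm_add_le _ _).trans (le_of_eq ?_)
        rw [norm_pow, Complex.norm_real, Complex.norm_real, Real.norm_eq_abs, Real.norm_eq_abs,
          sq_abs]
      have p1 := norm_nonneg (rep u x)
      have p2 := norm_nonneg (deriv (rep u) x)
      have p3 := norm_nonneg z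
      have p4 := abs_nonneg (V x)
      have p5 := mul_le_mul_of_nonneg_right hbV p1
      nlinarith [mul_nonneg p3 p1, mul_nonneg (add_nonneg (sq_nonneg b) p4) p2]
    have hpos : 0 ≤ c⁻¹ ^ 2 * (b ^ 2 + |V x| + ‖z‖) := by positivity
    have := ENNReal.ofReal_le_ofReal hn
    rwa [ENNReal.ofReal_mul hpos, ENNReal.ofReal_add (norm_nonneg _) (norm_nonneg _), ofReal_norm,
      ofReal_norm, ofReal_norm, ← Real.enorm_of_nonneg hpos] at this

/-! ## The operator `𝒥` -/

theorem opJ_coe (a : HHalf) : opJ (a : HDot) = (sgnHHalf a : HHalf) :=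
  UniformSpace.Completion.map_coe
    (LinearIsometry.isometry ⟨sgnHHalf, norm_sgnHHalf⟩).uniformContinuous a

theorem sgnHHalf_sgnHHalf (a : HHalf) : sgnHHalf (sgnHHalf a) = a := by
  refine Subtype.ext (fourierL2.injective (Lp.ext ?_))
  filter_upwards [fourierL2_opSgnD (show opSqrtAbsD.domain from sgnHHalf a),
    fourierL2_opSgnD (show opSqrtAbsD.domain from a), abs_sign_ae] with ξ h1 h2 h3
  refine h1.trans ?_
  refine (congrArg _ h2).trans ?_
  have h4 : (Real.sign (2 * Real.pi * ξ)) * (Real.sign (2 * Real.pi * ξ)) = 1 := by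
    rw [← abs_mul_abs_self, h3, one_mul]
  rw [← mul_assoc, ← Complex.ofReal_mul, h4, Complex.ofReal_one, one_mul]

theorem opJ_opJ (x : HDot) : opJ (opJ x) = x := by
  induction x using UniformSpace.Completion.induction_on with
  | hp => exact isClosed_eq (opJ.continuous.comp opJ.continuous) continuous_id
  | ih a => rw [opJ_coe, opJ_coe, sgnHHalf_sgnHHalf]

theorem norm_opJ (x : HDot) : ‖opJ x‖ = ‖x‖ := by
  induction x using UniformSpace.Completion.induction_on with
  | hp => exact isClosed_eq opJ.continuous.norm continuous_norm
  | ih a => rw [opJ_coe, UniformSpace.Completion.norm_coe, UniformSpace.Completion.norm_coe,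
      norm_sgnHHalf]

/-- An isometric involution is self-adjoint. -/
theorem inner_opJ_left (x y : HDot) : ⟪opJ x, y⟫_ℂ = ⟪x, opJ y⟫_ℂ := by
  have h := (⟨opJ.toLinearMap, norm_opJ⟩ : HDot →ₗᵢ[ℂ] HDot).inner_map_map x (opJ y)
  change ⟪opJ x, opJ (opJ y)⟫_ℂ = _ at h
  rwa [opJ_opJ] at h

theorem abs_rpow_half_mul_sign (t : ℝ) :
    |t| ^ (1 / 2 : ℝ) * (|t| ^ (1 / 2 : ℝ) * Real.sign t) = t := by
  rw [← mul_assoc, ← Real.sqrt_eq_rpow, Real.mul_self_sqrt (abs_nonneg t)]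
  rcases lt_trichotomy t 0 with h | h | h
  · rw [Real.sign_of_neg h, abs_of_neg h]; ring
  · rw [h]; simp
  · rw [Real.sign_of_pos h, abs_of_pos h]; ring

/-- The bridge between the two inner products, read off on the Fourier side from
`abs_rpow_half_mul_sign`. -/
theorem inner_toHDot_opJ (v a : H1) :
    ⟪toHDot v, opJ (toHDot a)⟫_ℂ = ⟪(v : L2), opD a⟫_ℂ := by
  set v' : HHalf := (show HHalf from Submodule.inclusion H1_le v)
  set a' : HHalf := (show HHalf from Submodule.inclusion H1_le a)
  have h1 : ⟪toHDot v, opJ (toHDot a)⟫_ℂ = ⟪HHalf.sqrtAbsD v', HHalf.sqrtAbsD (sgnHHalf a')⟫_ℂ := by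
    change ⟪(v' : HDot), opJ (a' : HDot)⟫_ℂ = _
    rw [opJ_coe, UniformSpace.Completion.inner_coe, HHalf.inner_def]
  rw [h1, ← fourierL2.inner_map_map, ← fourierL2.inner_map_map (v : L2), inner_eq_integral,
    inner_eq_integral]
  refine integral_congr_ae ?_
  filter_upwards [fourierL2_fourierMultiplier _ (show opSqrtAbsD.domain from v'),
    fourierL2_fourierMultiplier _ (show opSqrtAbsD.domain from sgnHHalf a'),
    fourierL2_opSgnD (a : L2), fourierL2_fourierMultiplier _ a] with ξ e1 e2 e3 e4
  change fourierL2 (HHalf.sqrtAbsD v') ξ = _ * fourierL2 (v : L2) ξ at e1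
  change fourierL2 (HHalf.sqrtAbsD (sgnHHalf a')) ξ
    = _ * fourierL2 (opSgnD ⟨(a : L2), mem_opSgnD a⟩) ξ at e2
  change fourierL2 (opD a) ξ = ((2 * Real.pi * ξ : ℝ) : ℂ) * fourierL2 (a : L2) ξ at e4
  rw [e1, e2, e3, e4, map_mul, Complex.conj_ofReal]
  have h2 : ((|2 * Real.pi * ξ| ^ (1 / 2 : ℝ) : ℝ) : ℂ) * (((|2 * Real.pi * ξ| ^ (1 / 2 : ℝ) : ℝ) : ℂ)
      * ((Real.sign (2 * Real.pi * ξ) : ℝ) : ℂ)) = ((2 * Real.pi * ξ : ℝ) : ℂ) := by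
    rw [← Complex.ofReal_mul, ← Complex.ofReal_mul, abs_rpow_half_mul_sign]
  rw [← h2]
  ring

/-! ## Generalized eigenspaces -/

section GenEigenspace

variable {H : Type*} [NormedAddCommGroup H] [InnerProductSpace ℂ H] {T D : H →ₗ.[ℂ] H} {z : ℂ}

theorem mem_powKer_succ {n : ℕ} {x : H} :
    x ∈ powKer T z (n + 1) ↔ ∃ h : x ∈ T.domain, T ⟨x, h⟩ - z • x ∈ powKer T z n := by
  constructor
  · rintro ⟨y, hy, rfl⟩
    exact ⟨y.2, hy⟩
  · rintro ⟨h, hx⟩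
    exact ⟨⟨x, h⟩, hx, rfl⟩

theorem powKer_le_succ (n : ℕ) : powKer T z n ≤ powKer T z (n + 1) := by
  induction n with
  | zero => exact bot_le
  | succ n ih =>
    intro x hx
    obtain ⟨h, hx⟩ := mem_powKer_succ.1 hx
    exact mem_powKer_succ.2 ⟨h, ih hx⟩

theorem mem_genEigenspace {x : H} : x ∈ genEigenspace T z ↔ ∃ n, x ∈ powKer T z n :=
  Submodule.mem_iSup_of_directed _ (monotone_nat_of_le_succ powKer_le_succ).directed_le

theorem genEigenspace_le_domain : genEigenspace T z ≤ T.domain := by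
  refine iSup_le fun n => ?_
  cases n with
  | zero => exact bot_le
  | succ n =>
    intro x hx
    exact (mem_powKer_succ.1 hx).1

theorem sub_mem_genEigenspace {x : H} (hx : x ∈ genEigenspace T z) :
    T ⟨x, genEigenspace_le_domain hx⟩ - z • x ∈ genEigenspace T z := by
  obtain ⟨n, hn⟩ := mem_genEigenspace.1 hx
  obtain ⟨h, hn⟩ := mem_powKer_succ.1 (powKer_le_succ n hn)
  exact mem_genEigenspace.2 ⟨n, hn⟩

variable (T z) in
/-- The restriction of `T - z` to the generalized eigenspace at `z`. -/
def nilpotentPart : genEigenspace T z →ₗ[ℂ] genEigenspace T z :=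
  ((T.toFun - z • T.domain.subtype) ∘ₗ Submodule.inclusion genEigenspace_le_domain).codRestrict _
    fun x => sub_mem_genEigenspace x.2

theorem coe_nilpotentPart (x : genEigenspace T z) :
    (nilpotentPart T z x : H) = T ⟨x, genEigenspace_le_domain x.2⟩ - z • (x : H) := rfl

theorem exists_nilpotentPart_pow_eq_zero (x : genEigenspace T z) :
    ∃ n, (nilpotentPart T z ^ n) x = 0 := by
  obtain ⟨n, hn⟩ := mem_genEigenspace.1 x.2
  refine ⟨n, ?_⟩
  induction n generalizing x with
  | zero => exact Subtype.ext hn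
  | succ n ih =>
    rw [pow_succ, Module.End.mul_apply]
    exact ih _ (mem_powKer_succ.1 hn).2

/-- The equation is put in the shape `T x = D(z x + w)`, which matches `ℒ x = 𝒥(z x + w)` under
`mem_graphL_iff`. -/
theorem mem_pencilPowKer_succ {n : ℕ} {x : H} :
    x ∈ pencilPowKer T D z (n + 1) ↔ ∃ (h : x ∈ T.domain) (h' : x ∈ D.domain) (w : D.domain),
      (w : H) ∈ pencilPowKer T D z n ∧ T ⟨x, h⟩ = D (z • ⟨x, h'⟩ + w) := by
  constructor
  · rintro ⟨y, ⟨w, hw, hwy⟩, rfl⟩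
    refine ⟨y.2.1, y.2.2, w, hw, ?_⟩
    have h1 : D w = T ⟨y, y.2.1⟩ - z • D ⟨y, y.2.2⟩ := hwy
    change T ⟨y, y.2.1⟩ = _
    rw [D.map_add, D.map_smul, h1]
    change _ = z • D ⟨(y : H), _⟩ + _
    abel
  · rintro ⟨h, h', w, hw, e⟩
    refine ⟨⟨x, h, h'⟩, ⟨w, hw, ?_⟩, rfl⟩
    rw [D.map_add, D.map_smul] at e
    change D w = T ⟨x, h⟩ - z • D ⟨x, h'⟩
    rw [e]
    abel

theorem pencilPowKer_le_succ (n : ℕ) : pencilPowKer T D z n ≤ pencilPowKer T D z (n + 1) := by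
  induction n with
  | zero => exact bot_le
  | succ n ih =>
    intro x hx
    obtain ⟨h, h', w, hw, e⟩ := mem_pencilPowKer_succ.1 hx
    exact mem_pencilPowKer_succ.2 ⟨h, h', w, ih hw, e⟩

theorem mem_pencilGenEigenspace {x : H} :
    x ∈ pencilGenEigenspace T D z ↔ ∃ n, x ∈ pencilPowKer T D z n :=
  Submodule.mem_iSup_of_directed _ (monotone_nat_of_le_succ pencilPowKer_le_succ).directed_le

theorem pencilGenEigenspace_le : pencilGenEigenspace T D z ≤ T.domain ⊓ D.domain := by
  refine iSup_le fun n => ?_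
  cases n with
  | zero => exact bot_le
  | succ n =>
    intro x hx
    obtain ⟨h, h', -⟩ := mem_pencilPowKer_succ.1 hx
    exact ⟨h, h'⟩

end GenEigenspace

/-! ## Correspondence of the two spectral problems -/

section Correspondence

variable {b c : ℝ} {V : ℝ → ℝ}

theorem mem_graphHV_opHV {u : L2} (h : u ∈ (opHV c b V).domain) :
    (u, opHV c b V ⟨u, h⟩) ∈ graphHV c b V := by
  rw [← opHV_graph]
  exact (opHV c b V).mem_graph ⟨u, h⟩

theorem exists_opHV_eq {u f : L2} (h : (u, f) ∈ graphHV c b V) :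
    ∃ h : u ∈ (opHV c b V).domain, opHV c b V ⟨u, h⟩ = f := by
  rw [← opHV_graph, LinearPMap.mem_graph_iff] at h
  obtain ⟨⟨y, hy⟩, rfl, h2⟩ := h
  exact ⟨hy, h2⟩

theorem mem_graphL_opL {x : HDot} (h : x ∈ (opL c b V).domain) :
    (x, opL c b V ⟨x, h⟩) ∈ graphL c b V := by
  rw [← opL_graph]
  exact (opL c b V).mem_graph ⟨x, h⟩

theorem exists_opL_eq {x y : HDot} (h : (x, y) ∈ graphL c b V) :
    ∃ h : x ∈ (opL c b V).domain, opL c b V ⟨x, h⟩ = y := by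
  rw [← opL_graph, LinearPMap.mem_graph_iff] at h
  obtain ⟨⟨w, hw⟩, rfl, h2⟩ := h
  exact ⟨hw, h2⟩

theorem exists_H1_of_mem_opL_domain {x : HDot} (h : x ∈ (opL c b V).domain) :
    ∃ u : H1, toHDot u = x ∧ ∀ v : H1, formV c b V u v = ⟪toHDot v, opL c b V ⟨x, h⟩⟫_ℂ := by
  obtain ⟨u, hu, h'⟩ := mem_graphL_opL h
  exact ⟨u, hu, fun v => (h' v).2⟩

theorem formV_conj (c b : ℝ) (V : ℝ → ℝ) (u v : H1) :
    conj (formV c b V u v) = formV c b V v u := by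
  simp only [formV, map_add, map_mul, map_pow, Complex.conj_ofReal, inner_conj_symm]
  rw [← integral_conj]
  congr 1
  refine integral_congr_ae (ae_of_all _ fun x => ?_)
  simp only [map_mul, Complex.conj_ofReal, Complex.conj_conj]
  ring

theorem inner_opL_left {x y : HDot} (hx : x ∈ (opL c b V).domain) (hy : y ∈ (opL c b V).domain) :
    ⟪opL c b V ⟨x, hx⟩, y⟫_ℂ = ⟪x, opL c b V ⟨y, hy⟩⟫_ℂ := by
  obtain ⟨u, rfl, hu⟩ := exists_H1_of_mem_opL_domain hx
  obtain ⟨v, rfl, hv⟩ := exists_H1_of_mem_opL_domain hy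
  rw [← hv u, ← inner_conj_symm, ← hu v, formV_conj]

variable (hlim : Tendsto (fun x : ℝ => ∫ s in x..(x + 1), |V s|) (cocompact ℝ) (𝓝 0))
  (hV : LocallyIntegrable V volume) (hc : 0 < c)

include hlim hV hc

/-- Both sides say that `𝔱_V[u, v] = ⟨Da, v⟩` for all `v ∈ H¹`: the left one by `inner_toHDot_opJ`,
the right one by the two directions of integration by parts. -/
theorem mem_graphL_iff (u a : H1) :
    (toHDot u, opJ (toHDot a)) ∈ graphL c b V ↔ ((u : L2), opD a) ∈ graphHV c b V := by
  constructor
  · rintro ⟨u', hu', h⟩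
    rw [toHDot_injective hu'] at h
    refine mem_graphHV_of_formV hV hc (fun v => ?_) hlim
    rw [(h v).2, inner_toHDot_opJ]
  · intro h
    refine ⟨u, rfl, fun v => ⟨?_, ?_⟩⟩
    · exact (integrable_potential_rep hlim hV u v).congr (potential_ae_eq V u v).symm
    · rw [formV_eq_inner hlim hV hc h, inner_toHDot_opJ]

/-- The induction works because `w = (𝒜 - z)u`, a priori only in `Ḣ^(1/2)`, belongs to an earlier
kernel and so comes from `H¹`; this makes `mem_graphL_iff` applicable to `zu + w`. -/
theorem powKer_opA (z : ℂ) (n : ℕ) : powKer (opA c b V) z n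
    = ((pencilPowKer (opHV c b V) opD z n).comap H1.subtype).map toHDot := by
  induction n with
  | zero =>
    change (⊥ : Submodule ℂ HDot) = ((⊥ : Submodule ℂ L2).comap H1.subtype).map toHDot
    rw [Submodule.comap_bot, Submodule.ker_subtype, Submodule.map_bot]
  | succ n ih =>
    ext x
    rw [mem_powKer_succ, ih]
    constructor
    · rintro ⟨h, w, hw, hwx⟩
      obtain ⟨u, rfl, -⟩ := exists_H1_of_mem_opL_domain (c := c) (b := b) (V := V) h
      refine ⟨u, ?_, rfl⟩
      have h1 : opL c b V ⟨toHDot u, h⟩ = opJ (toHDot (z • u + w)) := by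
        have h2 : opJ (opL c b V ⟨toHDot u, h⟩) = toHDot (z • u + w) := by
          rw [map_add, map_smul, hwx]
          exact (add_sub_cancel _ _).symm
        rw [← h2, opJ_opJ]
      have h3 := mem_graphL_opL h
      rw [h1, mem_graphL_iff hlim hV hc] at h3
      obtain ⟨h4, h5⟩ := exists_opHV_eq h3
      exact mem_pencilPowKer_succ.2 ⟨h4, u.2, w, hw, h5⟩
    · rintro ⟨u, hu, rfl⟩
      obtain ⟨h, h', w, hw, e⟩ := mem_pencilPowKer_succ.1 hu
      have h1 := mem_graphHV_opHV h
      rw [e] at h1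
      obtain ⟨h2, h3⟩ := exists_opL_eq ((mem_graphL_iff hlim hV hc u (z • u + w)).2 h1)
      refine ⟨h2, w, hw, ?_⟩
      change _ = opJ (opL c b V ⟨toHDot u, h2⟩) - _
      rw [h3, opJ_opJ, map_add, map_smul, add_sub_cancel_left]

theorem eigCalA_eq (z : ℂ) :
    eigCalA c b V z = ((eigA c b V z).comap H1.subtype).map toHDot := by
  ext x
  rw [eigCalA, mem_genEigenspace]
  constructor
  · rintro ⟨n, hn⟩
    rw [powKer_opA hlim hV hc] at hn
    obtain ⟨u, hu, rfl⟩ := hn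
    exact ⟨u, mem_pencilGenEigenspace.2 ⟨n, hu⟩, rfl⟩
  · rintro ⟨u, hu, rfl⟩
    obtain ⟨n, hn⟩ := mem_pencilGenEigenspace.1 hu
    refine ⟨n, ?_⟩
    rw [powKer_opA hlim hV hc]
    exact ⟨u, hn, rfl⟩

omit hlim hV hc in
theorem eigA_eq (z : ℂ) :
    eigA c b V z = ((eigA c b V z).comap H1.subtype).map H1.subtype :=
  (Submodule.map_comap_eq_self (by
    rw [Submodule.range_subtype]
    exact pencilGenEigenspace_le.trans inf_le_right)).symm

theorem edim_eigA (z : ℂ) : edim (eigA c b V z) = edim (eigCalA c b V z) := by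
  rw [eigCalA_eq hlim hV hc, edim_map _ toHDot_injective, eigA_eq,
    edim_map _ H1.subtype_injective]
  congr 1
  rw [← eigA_eq]

end Correspondence

/-! ## Finite dimension of the generalized eigenspaces at real points -/

/-- The kernel is the space of ordinary eigenvectors, which come from the `H¹` solutions of `H_V u =
z D u`. -/
theorem finiteDimensional_ker_nilpotentPart {b c : ℝ} {V : ℝ → ℝ}
    (hlim : Tendsto (fun x : ℝ => ∫ s in x..(x + 1), |V s|) (cocompact ℝ) (𝓝 0))
    (hV : LocallyIntegrable V volume) (hc : 0 < c) (z : ℂ) :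
    FiniteDimensional ℂ (LinearMap.ker (nilpotentPart (opA c b V) z)) := by
  have := finiteDimensional_eigSolutions (c := c) (b := b) hc hV z
  have hmem : ∀ x : LinearMap.ker (nilpotentPart (opA c b V) z),
      ((x : genEigenspace (opA c b V) z) : HDot) ∈ (eigSolutions c b V z).map toHDot := by
    intro x
    have h1 : ((x : genEigenspace (opA c b V) z) : HDot) ∈ powKer (opA c b V) z 1 :=
      mem_powKer_succ.2 ⟨genEigenspace_le_domain x.1.2, congrArg Subtype.val x.2⟩
    rw [powKer_opA hlim hV hc] at h1
    obtain ⟨u, hu, hux⟩ := h1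
    refine ⟨u, ?_, hux⟩
    obtain ⟨h, h', w, hw, e⟩ := mem_pencilPowKer_succ.1 hu
    have hw0 : w = 0 := Subtype.ext hw
    have h2 := mem_graphHV_opHV h
    rw [e, hw0, add_zero, LinearPMap.map_smul] at h2
    exact h2
  exact FiniteDimensional.of_injective
    (((genEigenspace (opA c b V) z).subtype ∘ₗ Submodule.subtype _).codRestrict _ hmem)
    fun x y h => Subtype.ext (Subtype.ext (Subtype.mk.inj h))

theorem mem_opL_domain_of_mem_genEigenspace {b c : ℝ} {V : ℝ → ℝ} {z : ℂ}
    (x : genEigenspace (opA c b V) z) : (x : HDot) ∈ (opL c b V).domain :=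
  genEigenspace_le_domain (T := opA c b V) x.2

/-- The form `(ℒ x, y)` on a generalized eigenspace of `𝒜`. -/
def formOnGenEigenspace (c b : ℝ) (V : ℝ → ℝ) (z : ℂ) (x y : genEigenspace (opA c b V) z) : ℂ :=
  ⟪opL c b V ⟨x, mem_opL_domain_of_mem_genEigenspace x⟩, (y : HDot)⟫_ℂ

theorem formOnGenEigenspace_eq {b c : ℝ} {V : ℝ → ℝ} {z : ℂ}
    (x y : genEigenspace (opA c b V) z) : formOnGenEigenspace c b V z x y
      = ⟪(x : HDot), opL c b V ⟨y, mem_opL_domain_of_mem_genEigenspace y⟩⟫_ℂ :=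
  inner_opL_left _ _

/-- `(ℒ𝒥ℒx, y)`, read as `(𝒥ℒx, ℒy)`, is symmetric because `𝒥` is self-adjoint. The term with `lam`
is symmetric because `ℒ` is symmetric and `lam` is real. -/
theorem formOnGenEigenspace_nilpotentPart {b c : ℝ} {V : ℝ → ℝ} {lam : ℝ}
    (x y : genEigenspace (opA c b V) lam) :
    formOnGenEigenspace c b V lam (nilpotentPart (opA c b V) lam x) y
      = formOnGenEigenspace c b V lam x (nilpotentPart (opA c b V) lam y) := by
  rw [formOnGenEigenspace_eq, formOnGenEigenspace, coe_nilpotentPart, coe_nilpotentPart]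
  change ⟪opJ (opL c b V ⟨x, _⟩) - _, _⟫_ℂ = ⟪_, opJ (opL c b V ⟨y, _⟩) - _⟫_ℂ
  rw [inner_sub_left, inner_sub_right, inner_opJ_left, inner_smul_left, inner_smul_right,
    Complex.conj_ofReal, inner_opL_left _ (mem_opL_domain_of_mem_genEigenspace y)]

/-- Generalized eigenvectors come from `H¹`, and there `(ℒx, x)` is `𝔱_V`, so a neutral subspace
pulls back to a non-positive one. -/
theorem finrank_le_of_formOnGenEigenspace_eq_zero {b c : ℝ} {V : ℝ → ℝ} {z : ℂ} {κ : ℕ}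
    (hκ : ∀ W : Submodule ℂ H1, (∀ u ∈ W, (formV c b V u u).re ≤ 0) → Module.finrank ℂ W ≤ κ)
    (W : Submodule ℂ (genEigenspace (opA c b V) z))
    (hW : ∀ x ∈ W, formOnGenEigenspace c b V z x x = 0) : Module.finrank ℂ W ≤ κ := by
  set W₁ : Submodule ℂ HDot := W.map (Submodule.subtype _)
  have hrange : W₁ ≤ LinearMap.range toHDot := by
    rintro _ ⟨x, -, rfl⟩
    obtain ⟨u, hu, -⟩ := exists_H1_of_mem_opL_domain (mem_opL_domain_of_mem_genEigenspace x)
    exact ⟨u, hu⟩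
  have h1 := hκ (W₁.comap toHDot) fun u hu => by
    obtain ⟨x, hx, hxu⟩ := hu
    obtain ⟨v, hv, hv'⟩ := exists_H1_of_mem_opL_domain (mem_opL_domain_of_mem_genEigenspace x)
    have huv : v = u := toHDot_injective (hv.trans hxu)
    rw [huv] at hv'
    have h2 := hW x hx
    rw [formOnGenEigenspace_eq] at h2
    rw [hv' u, ← hxu]
    exact (congrArg Complex.re h2).le
  rwa [(Submodule.equivMapOfInjective toHDot toHDot_injective (W₁.comap toHDot)).finrank_eq,
    Submodule.map_comap_eq_self hrange,
    ← (Submodule.equivMapOfInjective _ (Submodule.subtype_injective _) W).finrank_eq] at h1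

theorem finiteDimensional_eigCalA {b c : ℝ} (hb : 0 < b) (hc : 0 < c) {V : ℝ → ℝ}
    (hlim : Tendsto (fun x : ℝ => ∫ s in x..(x + 1), |V s|) (cocompact ℝ) (𝓝 0))
    (hV : LocallyIntegrable V volume) (lam : ℝ) : FiniteDimensional ℂ (eigCalA c b V lam) := by
  obtain ⟨κ, hκ⟩ := exists_finrank_le_of_formV_nonpos hb hc hlim hV
  have h := finiteDimensional_ker_nilpotentPart (b := b) hlim hV hc (lam : ℂ)
  unfold eigCalA
  exact finiteDimensional_of_locallyNilpotent (nilpotentPart (opA c b V) lam)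
    exists_nilpotentPart_pow_eq_zero (formOnGenEigenspace c b V lam)
    formOnGenEigenspace_nilpotentPart (fun x => inner_zero_right _) κ
    fun W _ hW => finrank_le_of_formOnGenEigenspace_eq_zero hκ W hW

/-! ## The negative indices in terms of the form -/

/-- The generalized eigenspace of `H_V u = z D u` as a subspace of `H¹(ℝ)`. -/
def eigH1 (c b : ℝ) (V : ℝ → ℝ) (z : ℂ) : Submodule ℂ H1 := (eigA c b V z).comap H1.subtype

section Indices

variable {b c : ℝ} {V : ℝ → ℝ}

theorem negIndexOn_opL (hb : 0 < b) (hc : 0 < c)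
    (hlim : Tendsto (fun x : ℝ => ∫ s in x..(x + 1), |V s|) (cocompact ℝ) (𝓝 0))
    (hV : LocallyIntegrable V volume) (lam : ℝ) :
    negIndexOn (opL c b V) (eigCalA c b V lam)
      = nonposIndex (fun u : H1 => (formV c b V u u).re) (eigH1 c b V lam) := by
  have := finiteDimensional_eigCalA hb hc hlim hV lam
  have hE : eigCalA c b V lam ≤ (opL c b V).domain := genEigenspace_le_domain (T := opA c b V)
  rw [negIndexOn_eq_nonposIndex _ _ hE
    -- The form is transported along the embedding; its value `0` off the image of `H¹` plays no
    -- role.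
    (Function.extend toHDot (fun u : H1 => (formV c b V u u).re) 0)
    (fun u v hu hv => inner_opL_left _ _) (fun x hx => ?_), eigCalA_eq hlim hV hc]
  · exact nonposIndex_map _ toHDot_injective fun u _ => toHDot_injective.extend_apply _ _ u
  · obtain ⟨u, rfl, hu⟩ := exists_H1_of_mem_opL_domain (hE hx)
    rw [toHDot_injective.extend_apply, hu u]

theorem negIndexOn_opHV (hb : 0 < b) (hc : 0 < c)
    (hlim : Tendsto (fun x : ℝ => ∫ s in x..(x + 1), |V s|) (cocompact ℝ) (𝓝 0))
    (hV : LocallyIntegrable V volume) (lam : ℝ) :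
    negIndexOn (opHV c b V) (eigA c b V lam)
      = nonposIndex (fun u : H1 => (formV c b V u u).re) (eigH1 c b V lam) := by
  have hfin : FiniteDimensional ℂ (eigA c b V lam) := by
    have h1 := finiteDimensional_eigCalA hb hc hlim hV lam
    rw [eigCalA_eq hlim hV hc] at h1
    change FiniteDimensional ℂ ((eigH1 c b V lam).map toHDot) at h1
    have h2 := (Submodule.equivMapOfInjective toHDot toHDot_injective
      (eigH1 c b V lam)).symm.finiteDimensional
    have h3 := (Submodule.equivMapOfInjective H1.subtype H1.subtype_injective
      (eigH1 c b V lam)).finiteDimensional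
    rwa [eigH1, ← eigA_eq] at h3
  have hE : eigA c b V lam ≤ (opHV c b V).domain := pencilGenEigenspace_le.trans inf_le_left
  have hE' : eigA c b V lam ≤ H1 := pencilGenEigenspace_le.trans inf_le_right
  have hform : ∀ (u v : L2) (hu : u ∈ eigA c b V lam) (hv : v ∈ eigA c b V lam),
      ⟪v, opHV c b V ⟨u, hE hu⟩⟫_ℂ = formV c b V ⟨u, hE' hu⟩ ⟨v, hE' hv⟩ := fun u v hu hv =>
    (formV_eq_inner hlim hV hc (u := ⟨u, hE' hu⟩) (mem_graphHV_opHV (hE hu)) ⟨v, hE' hv⟩).symm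
  have hinj : Function.Injective H1.subtype := H1.subtype_injective
  rw [negIndexOn_eq_nonposIndex _ _ hE
    (Function.extend H1.subtype (fun u : H1 => (formV c b V u u).re) 0)
    (fun u v hu hv => ?_) (fun x hx => ?_), eigA_eq]
  · exact nonposIndex_map _ hinj fun u _ => hinj.extend_apply _ _ u
  · rw [hform v u hv hu, ← formV_conj, ← hform u v hu hv, inner_conj_symm]
  · rw [hform x x hx hx]
    exact hinj.extend_apply _ _ (⟨x, hE' hx⟩ : H1)

end Indices

/-! ## Complex conjugation -/

/-- Converse of `exists_rep`, by integration by parts against Schwartz functions. It recognizes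
conjugates as elements of `H¹`. -/
theorem opD_eq_of_locallyAC {u w : L2} {φ : ℝ → ℂ} (hu : u =ᵐ[volume] φ) (hφ : LocallyAC φ)
    (hw : deriv φ =ᵐ[volume] fun x => Complex.I * w x) : ∃ h : u ∈ H1, opD ⟨u, h⟩ = w := by
  refine (opD_eq_iff u w).2 fun ψ => ?_
  have hψ : LocallyAC ψ := (ψ.smooth 1).locallyAC
  have hφ2 : MemLp φ 2 volume := (memLp_congr_ae hu).1 (Lp.memLp u)
  have hφ2' : MemLp (deriv φ) 2 volume :=
    (memLp_congr_ae hw).2 ((Lp.memLp w).const_mul Complex.I)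
  have hψ2 : MemLp ψ 2 volume := ψ.memLp 2 volume
  have hψ2' : MemLp (SchwartzMap.derivCLM ℂ ℂ ψ) 2 volume := SchwartzMap.memLp _ 2 volume
  have hprod : LocallyAC fun x => φ x * conj (ψ x) := hφ.mul hψ.conj
  have hd : ∀ᵐ x, deriv (fun x => φ x * conj (ψ x)) x
      = deriv φ x * conj (ψ x) + φ x * conj (SchwartzMap.derivCLM ℂ ℂ ψ x) := by
    filter_upwards [hφ.ae_differentiableAt] with x hx
    exact (hx.hasDerivAt.fun_mul (ψ.differentiable x).hasDerivAt.star).deriv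
  have i1 := integrable_mul_conj hφ2' hψ2
  have i2 := integrable_mul_conj hφ2 hψ2'
  have h0 := hprod.integral_deriv_eq_zero_of_integrable (integrable_mul_conj hφ2 hψ2)
    ((i1.add i2).congr (hd.mono fun x hx => hx.symm))
  rw [integral_congr_ae hd, integral_add i1 i2] at h0
  have e1 : ⟪(SchwartzMap.derivCLM ℂ ℂ ψ).toLp 2, u⟫_ℂ
      = ∫ x, φ x * conj (SchwartzMap.derivCLM ℂ ℂ ψ x) := by
    rw [inner_eq_integral]
    refine integral_congr_ae ?_
    filter_upwards [hu, (SchwartzMap.derivCLM ℂ ℂ ψ).coeFn_toLp 2 volume] with x h1 h2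
    rw [h1, h2]
  have e2 : Complex.I * ⟪ψ.toLp 2, w⟫_ℂ = ∫ x, deriv φ x * conj (ψ x) := by
    rw [inner_eq_integral, ← integral_const_mul]
    refine integral_congr_ae ?_
    filter_upwards [hw, ψ.coeFn_toLp 2 volume] with x h1 h2
    rw [h1, h2, mul_assoc]
  rw [e1, neg_mul, e2]
  exact eq_neg_of_add_eq_zero_right h0

theorem star_coeFn (u : L2) : (star u : L2) =ᵐ[volume] fun x => conj (u x) := Lp.coeFn_star u

theorem deriv_conj (f : ℝ → ℂ) : (deriv fun x => conj (f x)) = fun x => conj (deriv f x) :=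
  funext fun _ => deriv.star

theorem opD_star (u : H1) : ∃ h : star (u : L2) ∈ H1, opD ⟨star (u : L2), h⟩ = -star (opD u) := by
  refine opD_eq_of_locallyAC (φ := fun x => conj (rep u x)) ?_ (locallyAC_rep u).conj ?_
  · filter_upwards [star_coeFn (u : L2), ae_eq_rep u] with x h1 h2
    rw [h1, h2]
  · rw [deriv_conj]
    filter_upwards [ae_deriv_rep u, Lp.coeFn_neg (star (opD u)), star_coeFn (opD u)] with x h1 h2 h3
    rw [h1, h2, Pi.neg_apply, h3, map_mul, Complex.conj_I, neg_mul, mul_neg]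

theorem star_mem_graphHV {c b : ℝ} {V : ℝ → ℝ} {u f : L2} (h : (u, f) ∈ graphHV c b V) :
    (star u, star f) ∈ graphHV c b V := by
  obtain ⟨φ, h1, h2, h3, h4⟩ := h
  refine ⟨fun x => conj (φ x), ?_, fun x => (h2 x).star, ?_, ?_⟩
  · filter_upwards [star_coeFn u, h1] with x a1 a2
    rw [a1, show u x = φ x from a2]
  · rw [deriv_conj]
    exact h3.conj
  · rw [deriv_conj, deriv_conj]
    filter_upwards [star_coeFn f, h4] with x a1 a2
    rw [a1, show f x = _ from a2]
    simp only [map_add, map_mul, map_neg, map_pow, Complex.conj_ofReal]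

theorem norm_star_L2 (u : L2) : ‖(star u : L2)‖ = ‖u‖ := by
  refine le_antisymm (Lp.norm_le_norm_of_ae_le ?_) (Lp.norm_le_norm_of_ae_le ?_)
  all_goals
    filter_upwards [star_coeFn u] with x hx
    rw [hx, RCLike.norm_conj]

theorem star_add_L2 (u v : L2) : (star (u + v) : L2) = star u + star v := Lp.ext (by
  filter_upwards [star_coeFn (u + v), Lp.coeFn_add u v, star_coeFn u, star_coeFn v,
    Lp.coeFn_add (star u : L2) (star v)] with x h1 h2 h3 h4 h5
  rw [h1, h2, h5, Pi.add_apply, Pi.add_apply, h3, h4, map_add])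

/-- Complex conjugation in `H¹(ℝ)`. -/
def conjH1 : H1 →ₛₗ[starRingEnd ℂ] H1 where
  toFun u := ⟨star (u : L2), (opD_star u).1⟩
  map_add' u v := Subtype.ext (star_add_L2 (u : L2) (v : L2))
  map_smul' a u := Subtype.ext (Lp.ext (by
    filter_upwards [star_coeFn (a • (u : L2)), Lp.coeFn_smul a (u : L2), star_coeFn (u : L2),
      Lp.coeFn_smul (conj a) (star (u : L2))] with x h1 h2 h3 h4
    change (star (a • (u : L2)) : L2) x = (conj a • star (u : L2) : L2) x
    rw [h1, h2, h4, Pi.smul_apply, Pi.smul_apply, h3, smul_eq_mul, smul_eq_mul, map_mul]))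

theorem coe_conjH1 (u : H1) : (conjH1 u : L2) = star (u : L2) := rfl

theorem conjH1_conjH1 (u : H1) : conjH1 (conjH1 u) = u := Subtype.ext (star_star _)

theorem opD_conjH1 (u : H1) : opD (conjH1 u) = -star (opD u) := (opD_star u).2

section Symmetry

variable (c b : ℝ) (V : ℝ → ℝ)

theorem formV_conjH1 (u : H1) : formV c b V (conjH1 u) (conjH1 u) = formV c b V u u := by
  simp only [formV, inner_self_eq_norm_sq_to_K, opD_conjH1, coe_conjH1, norm_neg, norm_star_L2]
  congr 1
  refine integral_congr_ae ?_
  filter_upwards [star_coeFn (u : L2)] with x h1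
  rw [h1, Complex.conj_conj]
  ring

/-- `H_V` has real coefficients and commutes with conjugation, while `D` anticommutes with it. Thus
`H_V u = D(zu + w)` becomes `H_V ū = D(-z̄ ū - w̄)`, and the chain continues with `-w̄`. -/
theorem conjH1_mem_pencilPowKer (z : ℂ) (n : ℕ) (u : H1)
    (hu : (u : L2) ∈ pencilPowKer (opHV c b V) opD z n) :
    (conjH1 u : L2) ∈ pencilPowKer (opHV c b V) opD (-conj z) n := by
  induction n generalizing u with
  | zero =>
    have h0 : u = 0 := Subtype.ext hu
    rw [h0, map_zero]
    exact Submodule.zero_mem _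
  | succ n ih =>
    obtain ⟨h, h', w, hw, e⟩ := mem_pencilPowKer_succ.1 hu
    have h1 := star_mem_graphHV (mem_graphHV_opHV h)
    obtain ⟨h2, h3⟩ := exists_opHV_eq h1
    refine mem_pencilPowKer_succ.2 ⟨h2, (conjH1 u).2, -conjH1 w, neg_mem (ih w hw), ?_⟩
    refine h3.trans ?_
    rw [e]
    have h4 : -conj z • conjH1 u + -conjH1 w = -conjH1 (z • u + w) := by
      rw [map_add, LinearMap.map_smulₛₗ, neg_smul, neg_add]
    change _ = opD (-conj z • conjH1 u + -conjH1 w)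
    rw [h4, LinearPMap.map_neg, opD_conjH1, neg_neg]

/-- Both conjugation and `z ↦ -z̄` are involutions, so one inclusion yields the other. -/
theorem eigH1_neg_conj (z : ℂ) : eigH1 c b V (-conj z) = (eigH1 c b V z).map conjH1 := by
  have key : ∀ (z : ℂ) (u : H1), u ∈ eigH1 c b V z → conjH1 u ∈ eigH1 c b V (-conj z) := by
    intro z u hu
    obtain ⟨n, hn⟩ := mem_pencilGenEigenspace.1 hu
    exact mem_pencilGenEigenspace.2 ⟨n, conjH1_mem_pencilPowKer c b V z n u hn⟩
  ext u
  constructor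
  · intro hu
    refine ⟨conjH1 u, ?_, conjH1_conjH1 u⟩
    have h1 := key _ _ hu
    rwa [map_neg, neg_neg, Complex.conj_conj] at h1
  · rintro ⟨v, hv, rfl⟩
    exact key z v hv

theorem conjH1_injective : Function.Injective conjH1 :=
  Function.LeftInverse.injective conjH1_conjH1

theorem edim_eigA_neg_conj (z : ℂ) : edim (eigA c b V (-conj z)) = edim (eigA c b V z) := by
  have h : ∀ z, edim (eigA c b V z) = edim (eigH1 c b V z) := fun z => by
    rw [eigH1, ← edim_map H1.subtype H1.subtype_injective, ← eigA_eq]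
  rw [h, h, eigH1_neg_conj, edim_map _ conjH1_injective]

theorem nonposIndex_eigH1_neg (lam : ℝ) :
    nonposIndex (fun u : H1 => (formV c b V u u).re) (eigH1 c b V ((-lam : ℝ) : ℂ))
      = nonposIndex (fun u : H1 => (formV c b V u u).re) (eigH1 c b V lam) := by
  have h := eigH1_neg_conj c b V lam
  rw [Complex.conj_ofReal, ← Complex.ofReal_neg] at h
  rw [h]
  exact nonposIndex_map conjH1 conjH1_injective fun u _ => by rw [formV_conjH1]

end Symmetry

/-! ## Comparison of the indices -/

/-- Reflection in the imaginary axis exchanges the two open quadrants of the upper half-plane and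
fixes the positive imaginary half-axis. -/
theorem totalMultiplicity_upper {E : ℂ → Submodule ℂ L2}
    (hE : ∀ z, edim (E (-conj z)) = edim (E z)) :
    totalMultiplicity E {z | z.re = 0 ∧ 0 < z.im} + 2 * totalMultiplicity E {z | 0 < z.re ∧ 0 < z.im}
      = totalMultiplicity E {z | 0 < z.im} := by
  have hset : {z : ℂ | 0 < z.im} = {z : ℂ | z.re = 0 ∧ 0 < z.im} ∪
      ({z : ℂ | 0 < z.re ∧ 0 < z.im} ∪ {z : ℂ | z.re < 0 ∧ 0 < z.im}) := by
    ext z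
    simp only [Set.mem_union, Set.mem_ofPred_eq]
    rcases lt_trichotomy z.re 0 with h | h | h <;> simp [h, ne_of_lt, ne_of_gt]
  have hd1 : Disjoint {z : ℂ | 0 < z.re ∧ 0 < z.im} {z : ℂ | z.re < 0 ∧ 0 < z.im} :=
    Set.disjoint_left.2 fun z h1 h2 => lt_asymm h1.1 h2.1
  have hd2 : Disjoint {z : ℂ | z.re = 0 ∧ 0 < z.im}
      ({z : ℂ | 0 < z.re ∧ 0 < z.im} ∪ {z : ℂ | z.re < 0 ∧ 0 < z.im}) :=
    Set.disjoint_left.2 fun z h1 h2 => h2.elim (fun h => h.1.ne' h1.1) fun h => h.1.ne h1.1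
  have hsymm : totalMultiplicity E {z : ℂ | z.re < 0 ∧ 0 < z.im}
      = totalMultiplicity E {z : ℂ | 0 < z.re ∧ 0 < z.im} :=
    totalSum_involution (fun z => edim (E z))
      ⟨fun z => -conj z, fun z => -conj z, fun z => by simp, fun z => by simp⟩
      (fun z => by simp) fun z _ => hE z
  rw [hset]
  unfold totalMultiplicity at hsymm ⊢
  rw [totalSum_union (fun z => edim (E z)) hd2, totalSum_union (fun z => edim (E z)) hd1, hsymm,
    two_mul]

theorem totalNegIndex_ne_zero {T : L2 →ₗ.[ℂ] L2} {E : ℂ → Submodule ℂ L2}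
    (hE : ∀ lam : ℝ, negIndexOn T (E ((-lam : ℝ) : ℂ)) = negIndexOn T (E lam)) :
    2 * totalNegIndex T E {lam | 0 < lam} = totalNegIndex T E {lam | lam ≠ 0} := by
  have hset : {lam : ℝ | lam ≠ 0} = {lam : ℝ | 0 < lam} ∪ {lam : ℝ | lam < 0} := by
    ext x
    exact ne_iff_lt_or_gt.trans or_comm
  have hd : Disjoint {lam : ℝ | 0 < lam} {lam : ℝ | lam < 0} :=
    Set.disjoint_left.2 fun z (h1 : 0 < z) (h2 : z < 0) => lt_asymm h1 h2
  have hsymm : totalNegIndex T E {lam | lam < 0} = totalNegIndex T E {lam | 0 < lam} :=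
    totalSum_involution (fun lam : ℝ => negIndexOn T (E lam)) (Equiv.neg ℝ)
      (fun z => by simp) fun z _ => hE z
  rw [hset]
  unfold totalNegIndex at hsymm ⊢
  rw [totalSum_union (fun lam : ℝ => negIndexOn T (E lam)) hd, hsymm, two_mul]

end KreinIndex

end

/-! ### Equality of the three indices -/

theorem mainTheorem3 (b c : ℝ) (hb : 0 < b) (hc : 0 < c) (V : ℝ → ℝ)
    (hV : LocallyIntegrable V volume)
    (hlim : Tendsto (fun x : ℝ => ∫ s in x..(x + 1), |V s|) (cocompact ℝ) (𝓝 0)) :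
    KreinIndex.kappaUpperA c b V = KreinIndex.kappaUpperCalA c b V ∧
    KreinIndex.kappaNegA c b V = KreinIndex.kappaNegCalA c b V ∧
    KreinIndex.kappaHamA c b V = KreinIndex.kappaHamCalA c b V := by
  have h1 : KreinIndex.kappaUpperA c b V = KreinIndex.kappaUpperCalA c b V :=
    KreinIndex.totalSum_congr fun z => KreinIndex.edim_eigA hlim hV hc z
  have h2 : KreinIndex.kappaNegA c b V = KreinIndex.kappaNegCalA c b V :=
    KreinIndex.totalSum_congr fun lam => by
      rw [KreinIndex.negIndexOn_opL hb hc hlim hV, KreinIndex.negIndexOn_opHV hb hc hlim hV]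
  refine ⟨h1, h2, ?_⟩
  rw [KreinIndex.kappaHamCalA, ← h1, ← h2, KreinIndex.kappaHamA,
    KreinIndex.totalMultiplicity_upper (KreinIndex.edim_eigA_neg_conj c b V),
    KreinIndex.totalNegIndex_ne_zero fun lam => by
      rw [KreinIndex.negIndexOn_opHV hb hc hlim hV, KreinIndex.negIndexOn_opHV hb hc hlim hV,
        KreinIndex.nonposIndex_eigH1_neg]]
  rfl
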